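/- For an integer $n\ge 1$ let $r_1(n)=\#\{(a,p): a\in\mathbb{Z}_{\ge 0},\ p \text{ prime},\ a^2+p^2=n\}$ and let $\omega^*(n)$ be the number of distinct odd prime factors of $n$; for $x>e$ write $L=\log\log x$. Theorem (Granville–Sabuncu–Sedunova). For any fixed integer $\ell\ge 1$ and integer $k\ge 0$ with $k\ll L$ we have \[\sum_{\substack{n\le x\\ \omega^*(n)=k}}\binom{r_1(n)}{\ell}\ll_\ell\frac{x\,L^{O_\ell(1)}}{(\log x)^{\ell+1}}\,\frac{(2^{\ell-1}L)^k}{k!}.\] Explicitly: for every integer $\ell\ge 1$ there are an integer $A\ge 0$ and a real $C>0$, depending only on $\ell$, such that for every $K>0$ there is $x_0=x_0(\ell,K)$ such that for all real $x>x_0$ and all integers $0\le k\le K\log\log x$, \[\sum_{\substack{1\le n\le x\\ \omega^*(n)=k}}\binom{r_1(n)}{\ell}\le C\,\frac{x\,(\log\log x)^{A}}{(\log x)^{\ell+1}}\,\frac{(2^{\ell-1}\log\log x)^k}{k!}.\] -/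

import Mathlib

/-- `r₁(n)`: the number of pairs `(a, p)` with `a ≥ 0` an integer, `p` a prime and
`a² + p² = n`. The set that is counted is finite, see `r1_set_finite`. -/
noncomputable def r1 (n : ℕ) : ℕ :=
  Set.ncard {q : ℕ × ℕ | q.2.Prime ∧ q.1 ^ 2 + q.2 ^ 2 = n}

theorem r1_set_finite (n : ℕ) :
    {q : ℕ × ℕ | q.2.Prime ∧ q.1 ^ 2 + q.2 ^ 2 = n}.Finite := by
  refine ((Set.finite_Iic n).prod (Set.finite_Iic n)).subset ?_
  rintro ⟨a, p⟩ ⟨-, h⟩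
  have h' : a ^ 2 + p ^ 2 = n := h
  have ha : a ≤ a ^ 2 := Nat.le_self_pow two_ne_zero a
  have hp : p ≤ p ^ 2 := Nat.le_self_pow two_ne_zero p
  exact ⟨Set.mem_Iic.2 (by lia), Set.mem_Iic.2 (by lia)⟩

/-- `ω*(n)`: the number of distinct odd prime factors of `n`. -/
def omegaStar (n : ℕ) : ℕ :=
  (n.primeFactors.filter (fun p => Odd p)).card

/-! Put t = log log x and read n = a² + p² as a Gaussian integer a + ip of norm n. Outside a small
exceptional set, n = qm with q prime, q > y = exp(e^t/t²), q not dividing m. Then q is not inert, q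
= Nπ, and each representation of n is wπ or w·star π with Nw = m (`exists_twist_of_isTypical`). So
an l-tuple of distinct representations is encoded by m, by w_1, …, w_l of norm m, by l choices of
conjugation, and by the lattice point π = (u, v) in a box of side about √(x/m).

With all but π fixed, u² + v² and l linear forms in (u, v), the imaginary parts, must all be prime
up to sign; the forms are pairwise independent because the representations are distinct. Modulo p
the linear forms remove l lines, and the norm form removes two more when p ≡ 1 mod 4, one on
average. A sieve of dimension l + 1 thus leaves at most (x/m) t^A / (log x)^(l+1) points, up to a
constant (`exists_sieve_bound`). Powers of t are free, so Brun's pure sieve up to exp(e^t/t⁴) is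
enough, and primes dividing the discriminant of the forms can be ignored.

It remains to sum `normCount m ^ l / m` over m with k − 1 odd prime factors. A prime p ≡ 1 mod 4
contributes 2^l/p and a prime p ≡ 3 mod 4 contributes nothing to first order, so the prime sum is
2^(l−1) t + O(1) and the sum over m is ≪ (2^(l−1) t + O(1))^(k−1)/(k−1)!
(`exists_sum_normCount_pow_div_le`). For k ≤ Kt and t large this is at most t² (2^(l−1) t)^k/k! up
to a constant (`add_pow_div_factorial_le`), and t² goes into the power of L.

The exceptional n are at most √x, or have a square divisor d² with d > y, or have a representation
with small p. They number at most 7x exp(−e^t/t⁴), which beats the divisor bound for `r1` and every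
power of log x (`sum_not_typical_le`). -/

/-! ### Gaussian integers of given norm -/

/-- A set of Gaussian integers of fixed norm is finite. -/
theorem finite_gaussianInt_norm_eq (m : ℕ) : {z : GaussianInt | z.norm = m}.Finite := by
  refine Set.Finite.of_finite_image (f := fun z : GaussianInt => (z.re, z.im))
    (((Set.finite_Icc (-(m : ℤ)) m).prod (Set.finite_Icc (-(m : ℤ)) m)).subset ?_) ?_
  · rintro _ ⟨z, hz, rfl⟩
    have h : z.norm = m := hz
    rw [Zsqrtd.norm_def] at h
    have h1 : z.re * z.re + z.im * z.im = m := by linarith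
    simp only [Set.mem_prod, Set.mem_Icc]
    have a1 : |z.re| ≤ m := by
      have := Int.le_self_sq |z.re|
      rw [sq_abs] at this; nlinarith [mul_self_nonneg z.im]
    have a2 : |z.im| ≤ m := by
      have := Int.le_self_sq |z.im|
      rw [sq_abs] at this; nlinarith [mul_self_nonneg z.re]
    exact ⟨abs_le.1 a1, abs_le.1 a2⟩
  · intro a _ b _ h
    simp only [Prod.mk.injEq] at h
    exact Zsqrtd.ext h.1 h.2

/-- The Gaussian integers of norm `m`. -/
noncomputable def normSet (m : ℕ) : Finset GaussianInt := (finite_gaussianInt_norm_eq m).toFinset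

theorem mem_normSet {m : ℕ} {z : GaussianInt} : z ∈ normSet m ↔ z.norm = m := by
  simp [normSet]

theorem GaussianInt.norm_mk (a b : ℤ) : (⟨a, b⟩ : GaussianInt).norm = a ^ 2 + b ^ 2 := by
  rw [Zsqrtd.norm_def]; ring

theorem GaussianInt.norm_star' (z : GaussianInt) : (star z).norm = z.norm := by
  simp [Zsqrtd.norm_def]

/-- A Gaussian integer whose norm is a rational prime is prime. -/
theorem GaussianInt.prime_of_norm_prime {π : GaussianInt} {p : ℕ} (hp : p.Prime)
    (h : π.norm = p) : Prime π := by
  rw [← irreducible_iff_prime]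
  refine ⟨fun hu => ?_, fun a b hab => ?_⟩
  · rw [← Zsqrtd.norm_eq_one_iff, h] at hu
    exact hp.one_lt.ne' (by simpa using hu)
  · have h2 : a.norm.natAbs * b.norm.natAbs = p := by
      rw [← Int.natAbs_mul, ← Zsqrtd.norm_mul, ← hab, h]; simp
    have := (Nat.prime_mul_iff.1 (h2.symm ▸ hp))
    rw [← Zsqrtd.norm_eq_one_iff, ← Zsqrtd.norm_eq_one_iff]
    rcases this with h | h
    · exact Or.inr h.2
    · exact Or.inl h.2

/-- If `N π = p` is prime and `N z = p m` then `z` is `w π` or `w (star π)` with `N w = m`. -/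
theorem GaussianInt.exists_eq_mul_of_norm {π z : GaussianInt} {p m : ℕ} (hp : p.Prime)
    (h : π.norm = p) (hz : z.norm = (p * m : ℕ)) :
    ∃ w : GaussianInt, w.norm = m ∧ (z = w * π ∨ z = w * star π) := by
  have hpr := GaussianInt.prime_of_norm_prime hp h
  have h1 : π ∣ z * star z := by
    rw [← Zsqrtd.norm_eq_mul_conj, hz]
    have : ((p : ℤ) : GaussianInt) = π * star π := by rw [← h, Zsqrtd.norm_eq_mul_conj]
    refine Dvd.intro (star π * (m : GaussianInt)) ?_
    rw [← mul_assoc, ← this]; push_cast; ring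
  have key : ∀ w π' : GaussianInt, π'.norm = p → z = w * π' → w.norm = m := by
    intro w π' h' hw
    have := congrArg Zsqrtd.norm hw
    rw [Zsqrtd.norm_mul, h', hz] at this
    have hp0 : (p : ℤ) ≠ 0 := by exact_mod_cast hp.ne_zero
    push_cast at this
    exact (mul_left_cancel₀ hp0 (by linarith)).symm
  rcases hpr.dvd_or_dvd h1 with ⟨w, hw⟩ | ⟨w, hw⟩
  · exact ⟨w, key w π h (by rw [hw, mul_comm]), Or.inl (by rw [hw, mul_comm])⟩
  · have e : z = star w * star π := by
      have := congrArg star hw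
      rwa [star_star, star_mul] at this
    exact ⟨star w, key _ _ (by rw [GaussianInt.norm_star', h]) e, Or.inr e⟩

/-- If a prime `p ≡ 3 (mod 4)` divides the norm of `z` then `p` divides `z`. -/
theorem GaussianInt.exists_eq_natCast_mul_of_norm {z : GaussianInt} {p m : ℕ} (hp : p.Prime)
    (h3 : p % 4 = 3) (hz : z.norm = (p * m : ℕ)) :
    ∃ w : GaussianInt, z = p * w ∧ z.norm = p ^ 2 * w.norm := by
  have := Fact.mk hp
  have hpr := GaussianInt.prime_of_nat_prime_of_mod_four_eq_three p h3
  have h1 : (p : GaussianInt) ∣ z * star z := by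
    rw [← Zsqrtd.norm_eq_mul_conj, hz]
    exact Dvd.intro (m : GaussianInt) (by push_cast; ring)
  have h2 : (p : GaussianInt) ∣ z := by
    rcases hpr.dvd_or_dvd h1 with h | ⟨w, hw⟩
    · exact h
    · have := congrArg star hw
      rw [star_star, star_mul, star_natCast] at this
      exact ⟨star w, by rw [this, mul_comm]⟩
  obtain ⟨w, rfl⟩ := h2
  exact ⟨w, rfl, by rw [Zsqrtd.norm_mul, Zsqrtd.norm_natCast]; ring⟩

/-- A prime that is not `3` modulo `4` is the norm of a Gaussian integer. -/
theorem GaussianInt.exists_norm_eq_prime {p : ℕ} (hp : p.Prime) (h3 : p % 4 ≠ 3) :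
    ∃ π : GaussianInt, π.norm = p := by
  have := Fact.mk hp
  obtain ⟨a, b, h⟩ := Nat.Prime.sq_add_sq h3
  exact ⟨⟨a, b⟩, by rw [GaussianInt.norm_mk]; exact_mod_cast h⟩

/-- The number of Gaussian integers of norm `m`. -/
noncomputable def normCount (m : ℕ) : ℕ := (normSet m).card

theorem normCount_one : normCount 1 ≤ 4 := by
  have : normSet 1 ⊆ {(⟨1, 0⟩ : GaussianInt), ⟨-1, 0⟩, ⟨0, 1⟩, ⟨0, -1⟩} := by
    intro z hz
    rw [mem_normSet] at hz
    obtain ⟨a, b⟩ := z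
    rw [GaussianInt.norm_mk] at hz
    push_cast at hz
    have ha1 : a ≤ 1 := by nlinarith [sq_nonneg b]
    have ha2 : -1 ≤ a := by nlinarith [sq_nonneg b]
    have hb1 : b ≤ 1 := by nlinarith [sq_nonneg a]
    have hb2 : -1 ≤ b := by nlinarith [sq_nonneg a]
    have h0 : a = -1 ∨ a = 0 ∨ a = 1 := by omega
    have h1 : b = -1 ∨ b = 0 ∨ b = 1 := by omega
    rcases h0 with rfl | rfl | rfl <;> rcases h1 with rfl | rfl | rfl <;> simp_all
  exact (Finset.card_le_card this).trans Finset.card_le_four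

/-- The local factor that bounds the growth of `normCount` along powers of `p`. -/
def localCount (p e : ℕ) : ℕ := if e = 1 ∧ p % 4 = 3 then 0 else e + 1

/-- Peeling off one factor π or its conjugate at a time leaves only the number i of factors π to
choose, hence e + 1 shapes. -/
theorem normCount_pow_mul_of_ne_three {p : ℕ} (hp : p.Prime) (h3 : p % 4 ≠ 3) (m e : ℕ) :
    normCount (p ^ e * m) ≤ (e + 1) * normCount m := by
  obtain ⟨π, hπ⟩ := GaussianInt.exists_norm_eq_prime hp h3
  have key : ∀ e : ℕ, ∀ z : GaussianInt, z.norm = (p ^ e * m : ℕ) →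
      ∃ i ∈ Finset.range (e + 1), ∃ w ∈ normSet m, π ^ i * star π ^ (e - i) * w = z := by
    intro e
    induction e with
    | zero => intro z hz; exact ⟨0, by simp, z, by rw [mem_normSet, hz]; simp, by simp⟩
    | succ e ih =>
      intro z hz
      rw [pow_succ', mul_assoc] at hz
      obtain ⟨z', hz', h⟩ := GaussianInt.exists_eq_mul_of_norm hp hπ hz
      obtain ⟨i, hi, w, hw, h'⟩ := ih z' hz'
      rw [Finset.mem_range] at hi
      rcases h with rfl | rfl
      · refine ⟨i + 1, Finset.mem_range.2 (by omega), w, hw, ?_⟩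
        rw [← h', Nat.add_sub_add_right, pow_succ]; ring
      · refine ⟨i, Finset.mem_range.2 (by omega), w, hw, ?_⟩
        rw [← h', show e + 1 - i = (e - i) + 1 by omega, pow_succ]; ring
  have hsub : normSet (p ^ e * m) ⊆ (Finset.range (e + 1) ×ˢ normSet m).image
      fun q => π ^ q.1 * star π ^ (e - q.1) * q.2 := by
    intro z hz
    obtain ⟨i, hi, w, hw, h⟩ := key e z (mem_normSet.1 hz)
    exact Finset.mem_image.2 ⟨(i, w), Finset.mem_product.2 ⟨hi, hw⟩, h⟩
  calc normCount (p ^ e * m) ≤ _ := Finset.card_le_card hsub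
    _ ≤ _ := Finset.card_image_le
    _ = _ := by simp [normCount]

theorem normCount_prime_mul_of_three {p : ℕ} (hp : p.Prime) (h3 : p % 4 = 3) {m : ℕ}
    (hm : ¬ p ∣ m) : normCount (p * m) = 0 := by
  rw [normCount, Finset.card_eq_zero, Finset.eq_empty_iff_forall_notMem]
  intro z hz
  rw [mem_normSet] at hz
  obtain ⟨w, -, h⟩ := GaussianInt.exists_eq_natCast_mul_of_norm hp h3 hz
  rw [hz] at h
  have hp0 : (p : ℤ) ≠ 0 := by exact_mod_cast hp.ne_zero
  have : (m : ℤ) = p * w.norm := mul_left_cancel₀ hp0 (by push_cast at h; linarith)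
  exact hm (Int.natCast_dvd_natCast.1 ⟨_, this⟩)

theorem normCount_sq_mul_of_three {p : ℕ} (hp : p.Prime) (h3 : p % 4 = 3) (m : ℕ) :
    normCount (p ^ 2 * m) ≤ normCount m := by
  have hsub : normSet (p ^ 2 * m) ⊆ (normSet m).image fun w => (p : GaussianInt) * w := by
    intro z hz
    rw [mem_normSet] at hz
    obtain ⟨w, hw, h⟩ := GaussianInt.exists_eq_natCast_mul_of_norm hp h3 (m := p * m)
      (by rw [hz, sq, mul_assoc])
    refine Finset.mem_image.2 ⟨w, ?_, hw.symm⟩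
    rw [hz] at h
    have hp0 : (p : ℤ) ^ 2 ≠ 0 := by exact_mod_cast (pow_pos hp.pos 2).ne'
    rw [mem_normSet]
    exact (mul_left_cancel₀ hp0 (by push_cast at h; linarith)).symm
  exact (Finset.card_le_card hsub).trans Finset.card_image_le

/-- For inert p the odd powers contribute 0 and the even ones at most 1. `localCount` records this
only at e = 1 because higher prime powers have convergent sums and cannot affect the leading
constant. -/
theorem normCount_pow_mul {p e m : ℕ} (hp : p.Prime) (he : 1 ≤ e) (hm : ¬ p ∣ m) :
    normCount (p ^ e * m) ≤ localCount p e * normCount m := by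
  by_cases h3 : p % 4 = 3
  · have key : ∀ j : ℕ, normCount (p ^ (2 * j + 1) * m) = 0 ∧ normCount (p ^ (2 * j) * m) ≤
        normCount m := by
      intro j
      induction j with
      | zero => simpa using normCount_prime_mul_of_three hp h3 hm
      | succ j ih =>
        have e1 : p ^ (2 * (j + 1) + 1) * m = p ^ 2 * (p ^ (2 * j + 1) * m) := by ring
        have e2 : p ^ (2 * (j + 1)) * m = p ^ 2 * (p ^ (2 * j) * m) := by ring
        rw [e1, e2]
        exact ⟨Nat.le_zero.1 (ih.1 ▸ normCount_sq_mul_of_three hp h3 _),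
          (normCount_sq_mul_of_three hp h3 _).trans ih.2⟩
    unfold localCount
    rcases Nat.even_or_odd' e with ⟨j, rfl | rfl⟩
    · rw [if_neg (by omega)]
      exact (key j).2.trans (Nat.le_mul_of_pos_left _ (by omega))
    · rw [(key j).1]; exact Nat.zero_le _
  · rw [localCount, if_neg (by tauto)]
    exact normCount_pow_mul_of_ne_three hp h3 m e

theorem localCount_le (p e : ℕ) : localCount p e ≤ e + 1 := by
  unfold localCount; split_ifs <;> omega

/-- The Gaussian integers of norm `n` are at most `4 d(n)` in number. -/
theorem normCount_le {n : ℕ} (hn : n ≠ 0) :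
    normCount n ≤ 4 * ∏ p ∈ n.primeFactors, (n.factorization p + 1) := by
  induction n using Nat.recOnPrimePow with
  | zero => exact absurd rfl hn
  | one => simpa using normCount_one
  | prime_pow_mul a p e hp hpa he ih =>
    have ha : a ≠ 0 := by rintro rfl; simp at hpa
    have hcop : Nat.Coprime (p ^ e) a := (hp.coprime_iff_not_dvd.2 hpa).pow_left e
    have hpn : p ∉ a.primeFactors := fun h => hpa (Nat.dvd_of_mem_primeFactors h)
    rw [hcop.primeFactors_mul, Nat.primeFactors_prime_pow he.ne' hp, ← Finset.insert_eq,
      Finset.prod_insert hpn]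
    have e1 : (p ^ e * a).factorization p = e := by
      rw [Nat.factorization_mul (pow_pos hp.pos e).ne' ha, hp.factorization_pow]
      simp [Nat.factorization_eq_zero_of_not_dvd hpa]
    have e2 : ∏ q ∈ a.primeFactors, ((p ^ e * a).factorization q + 1) =
        ∏ q ∈ a.primeFactors, (a.factorization q + 1) := by
      refine Finset.prod_congr rfl fun q hq => ?_
      have : q ≠ p := by rintro rfl; exact hpn hq
      rw [Nat.factorization_mul (pow_pos hp.pos e).ne' ha, hp.factorization_pow]
      simp [Finsupp.single_eq_of_ne this]
    rw [e1, e2]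
    calc normCount (p ^ e * a) ≤ localCount p e * normCount a := normCount_pow_mul hp he hpa
      _ ≤ (e + 1) * (4 * ∏ q ∈ a.primeFactors, (a.factorization q + 1)) :=
        Nat.mul_le_mul (localCount_le p e) (ih ha)
      _ = _ := by ring

/-! ### Sums of submultiplicative functions -/

theorem Finset.sum_le_sum_of_injOn' {ι κ : Type*} {s : Finset ι} {t : Finset κ} {f : ι → ℝ}
    {g : κ → ℝ} (i : ι → κ) (hi : ∀ a ∈ s, i a ∈ t) (hinj : Set.InjOn i s)
    (hfg : ∀ a ∈ s, f a ≤ g (i a)) (hg : ∀ b ∈ t, 0 ≤ g b) : ∑ a ∈ s, f a ≤ ∑ b ∈ t, g b := by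
  classical
  calc ∑ a ∈ s, f a ≤ ∑ a ∈ s, g (i a) := Finset.sum_le_sum hfg
    _ = ∑ b ∈ s.image i, g b := (Finset.sum_image hinj).symm
    _ ≤ _ := Finset.sum_le_sum_of_subset_of_nonneg
      (Finset.image_subset_iff.2 hi) fun b hb _ => hg b hb

/-- Splitting off the full power of a prime factor. -/
theorem Nat.ordCompl_facts {n p N : ℕ} (hp : p.Prime) (hn : n ∈ Finset.Icc 1 N) (hpn : p ∣ n) :
    1 ≤ n.factorization p ∧ n.factorization p ∈ Finset.Icc 1 N ∧
      n / p ^ n.factorization p ∈ Finset.Icc 1 N ∧ ¬ p ∣ n / p ^ n.factorization p ∧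
      p ^ n.factorization p * (n / p ^ n.factorization p) = n ∧
      (n / p ^ n.factorization p).primeFactors = n.primeFactors.erase p := by
  rw [Finset.mem_Icc] at hn
  have hn0 : n ≠ 0 := by omega
  have h1 : 1 ≤ n.factorization p := hp.factorization_pos_of_dvd hn0 hpn
  refine ⟨h1, Finset.mem_Icc.2 ⟨h1, ?_⟩, Finset.mem_Icc.2 ⟨Nat.ordCompl_pos p hn0, ?_⟩,
    Nat.not_dvd_ordCompl hp hn0, Nat.ordProj_mul_ordCompl_eq_self n p, ?_⟩
  · have := Nat.factorization_lt p hn0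
    omega
  · exact (Nat.ordCompl_le n p).trans hn.2
  · rw [← Nat.support_factorization, Nat.factorization_ordCompl, Finsupp.support_erase,
      Nat.support_factorization]

/-- One half of an Euler product. Inserting p into P, the new n split uniquely as p^e m with m
supported on the old primes, so the sum grows at most by the local factor. -/
theorem sum_le_prod_of_submultiplicative {f : ℕ → ℝ} {g : ℕ → ℕ → ℝ} (hf : ∀ n, 0 ≤ f n)
    (hg : ∀ p e, 0 ≤ g p e)
    (hfg : ∀ p e m, p.Prime → 1 ≤ e → ¬ p ∣ m → f (p ^ e * m) ≤ g p e * f m) (N : ℕ)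
    (P : Finset ℕ) :
    ∑ n ∈ (Finset.Icc 1 N).filter (fun n => n.primeFactors ⊆ P), f n ≤
      f 1 * ∏ p ∈ P, (1 + ∑ e ∈ Finset.Icc 1 N, g p e) := by
  classical
  induction P using Finset.induction_on with
  | empty =>
    simp only [Finset.prod_empty, mul_one]
    have : (Finset.Icc 1 N).filter (fun n => n.primeFactors ⊆ ∅) ⊆ {1} := by
      intro n hn
      simp only [Finset.subset_empty, Nat.primeFactors_eq_empty, Finset.mem_filter,
        Finset.mem_Icc] at hn
      rw [Finset.mem_singleton]; omega
    exact (Finset.sum_le_sum_of_subset_of_nonneg this fun n _ _ => hf n).trans (by simp)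
  | insert p P hpP ih =>
    rw [Finset.prod_insert hpP]
    set B := (Finset.Icc 1 N).filter (fun n => n.primeFactors ⊆ P) with hB
    set A := (Finset.Icc 1 N).filter (fun n => n.primeFactors ⊆ insert p P) with hA
    have hB0 : 0 ≤ ∑ n ∈ B, f n := Finset.sum_nonneg fun n _ => hf n
    have hG0 : 0 ≤ ∑ e ∈ Finset.Icc 1 N, g p e := Finset.sum_nonneg fun e _ => hg p e
    have h1 : ∑ n ∈ A.filter (fun n => ¬ p ∈ n.primeFactors), f n ≤ ∑ n ∈ B, f n := by
      refine Finset.sum_le_sum_of_subset_of_nonneg ?_ fun n _ _ => hf n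
      intro n hn
      simp only [hA, hB, Finset.mem_filter] at hn ⊢
      exact ⟨hn.1.1, (Finset.subset_insert_iff_of_notMem hn.2).1 hn.1.2⟩
    have h2 : ∑ n ∈ A.filter (fun n => p ∈ n.primeFactors), f n ≤
        (∑ e ∈ Finset.Icc 1 N, g p e) * ∑ n ∈ B, f n := by
      rw [Finset.sum_mul_sum, ← Finset.sum_product']
      refine Finset.sum_le_sum_of_injOn'
        (fun n => (n.factorization p, n / p ^ n.factorization p)) ?_ ?_ ?_ ?_
      · intro n hn
        simp only [hA, Finset.mem_filter] at hn
        obtain ⟨-, h2, h3, -, -, h6⟩ := Nat.ordCompl_facts (Nat.prime_of_mem_primeFactors hn.2)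
          hn.1.1 (Nat.dvd_of_mem_primeFactors hn.2)
        refine Finset.mem_product.2 ⟨h2, Finset.mem_filter.2 ⟨h3, ?_⟩⟩
        change Nat.primeFactors (n / p ^ n.factorization p) ⊆ P
        rw [h6]
        intro q hq
        rw [Finset.mem_erase] at hq
        exact (Finset.mem_insert.1 (hn.1.2 hq.2)).resolve_left hq.1
      · intro a ha b hb hab
        simp only [Prod.mk.injEq] at hab
        rw [← Nat.ordProj_mul_ordCompl_eq_self a p, ← Nat.ordProj_mul_ordCompl_eq_self b p,
          hab.2, hab.1]
      · intro n hn
        simp only [hA, Finset.mem_filter] at hn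
        have hp := Nat.prime_of_mem_primeFactors hn.2
        obtain ⟨h1, -, -, h4, h5, -⟩ := Nat.ordCompl_facts hp
          hn.1.1 (Nat.dvd_of_mem_primeFactors hn.2)
        calc f n = f (p ^ n.factorization p * (n / p ^ n.factorization p)) := by rw [h5]
          _ ≤ _ := hfg p _ _ hp h1 h4
      · intro b _
        exact mul_nonneg (hg _ _) (hf _)
    rw [← Finset.sum_filter_add_sum_filter_not A (fun n => p ∈ n.primeFactors)]
    calc _ ≤ (1 + ∑ e ∈ Finset.Icc 1 N, g p e) * ∑ n ∈ B, f n := by linarith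
      _ ≤ (1 + ∑ e ∈ Finset.Icc 1 N, g p e) *
          (f 1 * ∏ p ∈ P, (1 + ∑ e ∈ Finset.Icc 1 N, g p e)) := by gcongr
      _ = _ := by ring

theorem sum_Icc_le_prod_of_submultiplicative {f : ℕ → ℝ} {g : ℕ → ℕ → ℝ} (hf : ∀ n, 0 ≤ f n)
    (hg : ∀ p e, 0 ≤ g p e)
    (hfg : ∀ p e m, p.Prime → 1 ≤ e → ¬ p ∣ m → f (p ^ e * m) ≤ g p e * f m) (N : ℕ) :
    ∑ n ∈ Finset.Icc 1 N, f n ≤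
      f 1 * ∏ p ∈ (Finset.Icc 1 N).filter Nat.Prime, (1 + ∑ e ∈ Finset.Icc 1 N, g p e) := by
  refine le_trans (le_of_eq ?_) (sum_le_prod_of_submultiplicative hf hg hfg N _)
  rw [Finset.filter_true_of_mem]
  intro n hn p hp
  rw [Finset.mem_Icc] at hn
  have := Nat.prime_of_mem_primeFactors hp
  exact Finset.mem_filter.2 ⟨Finset.mem_Icc.2 ⟨this.one_lt.le,
    (Nat.le_of_dvd (by omega) (Nat.dvd_of_mem_primeFactors hp)).trans hn.2⟩, this⟩

theorem omegaStar_mul {p e m : ℕ} (hp : p.Prime) (ho : Odd p) (he : 1 ≤ e) (hm : ¬ p ∣ m) :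
    omegaStar (p ^ e * m) = omegaStar m + 1 := by
  have hcop : Nat.Coprime (p ^ e) m := (hp.coprime_iff_not_dvd.2 hm).pow_left e
  have hpn : p ∉ m.primeFactors := fun h => hm (Nat.dvd_of_mem_primeFactors h)
  rw [omegaStar, omegaStar, hcop.primeFactors_mul, Nat.primeFactors_prime_pow (by omega) hp,
    ← Finset.insert_eq, Finset.filter_insert, if_pos ho, Finset.card_insert_of_notMem]
  exact fun h => hpn (Finset.mem_filter.1 h).1

/-- The sum of a submultiplicative function over the integers with exactly `j` odd prime
factors. -/
theorem sum_omegaStar_le {f : ℕ → ℝ} {g : ℕ → ℕ → ℝ} (hf : ∀ n, 0 ≤ f n)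
    (hg : ∀ p e, 0 ≤ g p e)
    (hfg : ∀ p e m, p.Prime → 1 ≤ e → ¬ p ∣ m → f (p ^ e * m) ≤ g p e * f m) (N j : ℕ) :
    ∑ n ∈ (Finset.Icc 1 N).filter (fun n => omegaStar n = j), f n ≤
      f 1 * (1 + ∑ e ∈ Finset.Icc 1 N, g 2 e) *
      ((∑ p ∈ (Finset.Icc 1 N).filter (fun p => p.Prime ∧ Odd p),
        ∑ e ∈ Finset.Icc 1 N, g p e) ^ j / (j.factorial : ℝ)) := by
  classical
  set T := ∑ p ∈ (Finset.Icc 1 N).filter (fun p => p.Prime ∧ Odd p),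
        ∑ e ∈ Finset.Icc 1 N, g p e with hT
  have hT0 : 0 ≤ T := Finset.sum_nonneg fun p _ => Finset.sum_nonneg fun e _ => hg p e
  induction j with
  | zero =>
    -- With no odd prime factor only powers of 2 remain, which explains the separate factor at 2.
    have h := sum_le_prod_of_submultiplicative hf hg hfg N {2}
    rw [Finset.prod_singleton] at h
    simp only [pow_zero, Nat.factorial_zero, Nat.cast_one, div_one, mul_one]
    refine le_trans (Finset.sum_le_sum_of_subset_of_nonneg ?_ fun n _ _ => hf n) h
    intro n hn
    simp only [Finset.mem_filter, omegaStar, Finset.card_eq_zero] at hn ⊢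
    refine ⟨hn.1, fun p hp => ?_⟩
    rw [Finset.mem_singleton]
    refine (Nat.prime_of_mem_primeFactors hp).eq_two_or_odd'.resolve_right fun ho => ?_
    have : p ∈ (∅ : Finset ℕ) := hn.2 ▸ Finset.mem_filter.2 ⟨hp, ho⟩
    simp at this
  | succ j ih =>
    set B := (Finset.Icc 1 N).filter (fun n => omegaStar n = j) with hB
    set A := (Finset.Icc 1 N).filter (fun n => omegaStar n = j + 1) with hA
    -- Each n in A is counted once for each of its j + 1 odd primes p. The pair (n, p) is recovered
    -- from p, its exponent and the cofactor in B; iterating produces the factorial.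
    have key : ((j : ℝ) + 1) * ∑ n ∈ A, f n ≤ T * ∑ n ∈ B, f n := by
      have e1 : ((j : ℝ) + 1) * ∑ n ∈ A, f n =
          ∑ q ∈ A.sigma (fun n => n.primeFactors.filter (fun p => Odd p)), f q.1 := by
        rw [Finset.sum_sigma, Finset.mul_sum]
        refine Finset.sum_congr rfl fun n hn => ?_
        have hn' : (n.primeFactors.filter (fun p => Odd p)).card = j + 1 :=
          (Finset.mem_filter.1 hn).2
        simp [hn']
      have e2 : T * ∑ n ∈ B, f n = ∑ q ∈ (((Finset.Icc 1 N).filter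
          (fun p => p.Prime ∧ Odd p)) ×ˢ (Finset.Icc 1 N)) ×ˢ B, g q.1.1 q.1.2 * f q.2 := by
        rw [hT, Finset.sum_product, Finset.sum_product, Finset.sum_mul]
        refine Finset.sum_congr rfl fun p _ => ?_
        rw [Finset.sum_mul]
        refine Finset.sum_congr rfl fun e _ => ?_
        rw [Finset.mul_sum]
      rw [e1, e2]
      refine Finset.sum_le_sum_of_injOn'
        (fun q => ((q.2, q.1.factorization q.2), q.1 / q.2 ^ q.1.factorization q.2)) ?_ ?_ ?_ ?_
      · rintro ⟨n, p⟩ hq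
        simp only [hA, Finset.mem_sigma, Finset.mem_filter] at hq
        have hp := Nat.prime_of_mem_primeFactors hq.2.1
        have hd := Nat.dvd_of_mem_primeFactors hq.2.1
        obtain ⟨h1, h2, h3, h4, h5, h6⟩ := Nat.ordCompl_facts hp hq.1.1 hd
        have hn := Finset.mem_Icc.1 hq.1.1
        have ho : omegaStar (n / p ^ n.factorization p) + 1 = j + 1 := by
          rw [← omegaStar_mul hp hq.2.2 h1 h4, h5, hq.1.2]
        simp only [hB, Finset.mem_product, Finset.mem_filter]
        exact ⟨⟨⟨Finset.mem_Icc.2 ⟨hp.one_lt.le, (Nat.le_of_dvd (by omega) hd).trans hn.2⟩,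
          hp, hq.2.2⟩, h2⟩, h3, by omega⟩
      · rintro ⟨n, p⟩ _ ⟨n', p'⟩ _ h
        simp only [Prod.mk.injEq] at h
        obtain ⟨⟨rfl, h2⟩, h3⟩ := h
        have : n = n' := by
          rw [← Nat.ordProj_mul_ordCompl_eq_self n p, ← Nat.ordProj_mul_ordCompl_eq_self n' p,
            h3, h2]
        rw [this]
      · rintro ⟨n, p⟩ hq
        simp only [hA, Finset.mem_sigma, Finset.mem_filter] at hq
        have hp := Nat.prime_of_mem_primeFactors hq.2.1
        obtain ⟨h1, -, -, h4, h5, -⟩ := Nat.ordCompl_facts hp hq.1.1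
          (Nat.dvd_of_mem_primeFactors hq.2.1)
        calc f n = f (p ^ n.factorization p * (n / p ^ n.factorization p)) := by rw [h5]
          _ ≤ _ := hfg p _ _ hp h1 h4
      · intro b _
        exact mul_nonneg (hg _ _) (hf _)
    have hj : (0 : ℝ) < (j : ℝ) + 1 := by positivity
    rw [Nat.factorial_succ]
    push_cast
    calc ∑ n ∈ A, f n = (((j : ℝ) + 1) * ∑ n ∈ A, f n) / ((j : ℝ) + 1) := by field_simp
      _ ≤ (T * ∑ n ∈ B, f n) / ((j : ℝ) + 1) := by gcongr
      _ ≤ (T * (f 1 * (1 + ∑ e ∈ Finset.Icc 1 N, g 2 e) * (T ^ j / (j.factorial : ℝ)))) /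
          ((j : ℝ) + 1) := by gcongr
      _ = _ := by
        have : (j.factorial : ℝ) ≠ 0 := by positivity
        field_simp
        ring

/-! ### Upper bounds for prime sums from L-functions -/

open scoped ArithmeticFunction.vonMangoldt

/-- The sum over finitely many primes of a nonnegative bounded sequence is at most its L-series. -/
theorem sum_le_re_LSeries {b : ℕ → ℝ} {B : ℝ} (hb : ∀ n, 0 ≤ b n) (hB : ∀ n, b n ≤ B) {s : ℝ}
    (hs : 1 < s) (P : Finset ℕ) (hP : ∀ p ∈ P, p ≠ 0) :
    ∑ p ∈ P, b p * (p : ℝ) ^ (-s) ≤ (LSeries (fun n => (b n : ℂ)) s).re := by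
  have hsum : LSeriesSummable (fun n => (b n : ℂ)) s := by
    refine LSeriesSummable_of_bounded_of_one_lt_real (m := B) (fun n _ => ?_) hs
    rw [Complex.norm_real, Real.norm_of_nonneg (hb n)]
    exact hB n
  have hre : ∀ n : ℕ, n ≠ 0 → (LSeries.term (fun n => (b n : ℂ)) s n).re = b n * (n : ℝ) ^ (-s) := by
    intro n hn
    rw [LSeries.term_of_ne_zero hn, Real.rpow_neg (Nat.cast_nonneg n),
      show ((n : ℂ) ^ (s : ℂ)) = (((n : ℝ) ^ s : ℝ) : ℂ) by
        rw [Complex.ofReal_cpow (Nat.cast_nonneg n)]; simp, ← Complex.ofReal_div,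
      Complex.ofReal_re, div_eq_mul_inv]
  have hnn : ∀ n : ℕ, 0 ≤ (LSeries.term (fun n => (b n : ℂ)) s n).re := by
    intro n
    by_cases hn : n = 0
    · simp [hn]
    · rw [hre n hn]; have := hb n; positivity
  rw [LSeries, Complex.re_tsum hsum]
  calc ∑ p ∈ P, b p * (p : ℝ) ^ (-s) = ∑ p ∈ P, (LSeries.term (fun n => (b n : ℂ)) s p).re :=
        Finset.sum_congr rfl fun p hp => (hre p (hP p hp)).symm
    _ ≤ _ := Summable.sum_le_tsum _ (fun n _ => hnn n) (Complex.hasSum_re hsum.hasSum).summable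

/-- For s > 1, ζ(s) − 1/(s − 1) equals 1 minus a nonnegative quantity, and 1 ≤ 1/(s − 1) for s ≤ 2.
-/
theorem norm_riemannZeta_le {s : ℝ} (hs : 1 < s) (hs2 : s ≤ 2) : ‖riemannZeta s‖ ≤ 2 / (s - 1) := by
  have h1 := ZetaAsymptotics.zeta_limit_aux1 hs
  have h0 : 0 ≤ ZetaAsymptotics.termTSum s := by
    exact tsum_nonneg fun n => ZetaAsymptotics.term_nonneg _ _
  have h2 : riemannZeta s = ((∑' n : ℕ, 1 / (n + 1 : ℝ) ^ s : ℝ) : ℂ) := by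
    rw [zeta_eq_tsum_one_div_nat_add_one_cpow (by simpa using hs), Complex.ofReal_tsum]
    refine tsum_congr fun n => ?_
    rw [Complex.ofReal_div, Complex.ofReal_cpow (by positivity)]
    simp
  rw [h2, Complex.norm_real, Real.norm_of_nonneg (tsum_nonneg fun n => by positivity)]
  have h3 : 0 < s - 1 := by linarith
  have h4 : 1 ≤ 1 / (s - 1) := by rw [le_div_iff₀ h3]; linarith
  have h5 : 2 / (s - 1) = 1 / (s - 1) + 1 / (s - 1) := by ring
  have h6 : 0 ≤ s * ZetaAsymptotics.termTSum s := by positivity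
  linarith

theorem vonMangoldt_div_log_nonneg (n : ℕ) : 0 ≤ Λ n / Real.log n :=
  div_nonneg ArithmeticFunction.vonMangoldt_nonneg (Real.log_natCast_nonneg n)

theorem vonMangoldt_div_log_le_one (n : ℕ) : Λ n / Real.log n ≤ 1 :=
  div_le_one_of_le₀ ArithmeticFunction.vonMangoldt_le_log (Real.log_natCast_nonneg n)

theorem vonMangoldt_div_log_prime {p : ℕ} (hp : p.Prime) : Λ p / Real.log p = 1 := by
  rw [ArithmeticFunction.vonMangoldt_apply_prime hp,
    div_self (Real.log_pos (by exact_mod_cast hp.one_lt)).ne']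

/-- The series of Λ(n)/log n · n^(−s) exponentiates to ζ(s). Its terms are nonnegative and those at
primes are p^(−s), so dropping the others only helps. -/
theorem sum_prime_rpow_le {s : ℝ} (hs : 1 < s) (hs2 : s ≤ 2) {P : Finset ℕ}
    (hP : ∀ p ∈ P, p.Prime) :
    ∑ p ∈ P, (p : ℝ) ^ (-s) ≤ Real.log (1 / (s - 1)) + 1 := by
  have h := sum_le_re_LSeries vonMangoldt_div_log_nonneg vonMangoldt_div_log_le_one hs P
    fun p hp => (hP p hp).ne_zero
  have h2 : ∑ p ∈ P, (p : ℝ) ^ (-s) = ∑ p ∈ P, Λ p / Real.log p * (p : ℝ) ^ (-s) :=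
    Finset.sum_congr rfl fun p hp => by rw [vonMangoldt_div_log_prime (hP p hp), one_mul]
  rw [h2]
  refine h.trans ?_
  have h3 : Real.exp (LSeries (fun n => ((Λ n / Real.log n : ℝ) : ℂ)) s).re ≤ 2 / (s - 1) := by
    rw [← Complex.norm_exp]
    have := riemannZeta_eq_exp_LSeries (s := s) (by simpa using hs)
    push_cast at this ⊢
    rw [this]
    exact norm_riemannZeta_le hs hs2
  have h4 : 0 < s - 1 := by linarith
  rw [← Real.le_log_iff_exp_le (by positivity)] at h3
  have h5 : Real.log (2 / (s - 1)) = Real.log 2 + Real.log (1 / (s - 1)) := by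
    rw [← Real.log_mul (by norm_num) (by positivity)]; congr 1; ring
  have := Real.log_two_lt_d9
  linarith

/-- The nontrivial Dirichlet character modulo `4` with complex values. -/
noncomputable def chiFour : DirichletCharacter ℂ 4 := ZMod.χ₄.ringHomComp (Int.castRingHom ℂ)

theorem chiFour_natCast (n : ℕ) : chiFour n = ((ZMod.χ₄ n : ℤ) : ℂ) := rfl

theorem chiFour_ne_one : chiFour ≠ 1 := by
  intro h
  have h1 : chiFour ((3 : ℕ) : ZMod 4) = -1 := by
    rw [chiFour_natCast, ZMod.χ₄_nat_three_mod_four (by norm_num)]; norm_num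
  rw [h, MulChar.one_apply (by decide)] at h1
  norm_num at h1

/-- The L-function of a nontrivial character is entire, hence bounded on the compact interval [1,
2]. Only this upper bound is needed, not the nonvanishing at 1. -/
theorem exists_norm_LSeries_chiFour_le :
    ∃ B : ℝ, 1 ≤ B ∧ ∀ s : ℝ, 1 < s → s ≤ 2 → ‖LSeries (fun n => chiFour n) s‖ ≤ B := by
  have hc : Continuous fun s : ℝ => DirichletCharacter.LFunction chiFour s :=
    (DirichletCharacter.differentiable_LFunction chiFour_ne_one).continuous.comp
      Complex.continuous_ofReal
  obtain ⟨B, hB⟩ := isCompact_Icc.exists_bound_of_continuousOn (s := Set.Icc (1 : ℝ) 2)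
    hc.continuousOn
  refine ⟨max B 1, le_max_right _ _, fun s hs hs2 => ?_⟩
  rw [← DirichletCharacter.LFunction_eq_LSeries _ (by simpa using hs)]
  exact (hB s ⟨hs.le, hs2⟩).trans (le_max_left _ _)

/-- The coefficients (1 + χ₄(n)) Λ(n)/log n of log(ζ · L(χ₄)) are nonnegative and equal 2 at primes
p ≡ 1 mod 4, so a bound for the product ζ · L(χ₄) bounds the prime sum. -/
theorem exists_sum_prime_one_mod_four_rpow_le :
    ∃ C : ℝ, 0 ≤ C ∧ ∀ s : ℝ, 1 < s → s ≤ 2 → ∀ P : Finset ℕ,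
      (∀ p ∈ P, p.Prime ∧ p % 4 = 1) →
      2 * ∑ p ∈ P, (p : ℝ) ^ (-s) ≤ Real.log (1 / (s - 1)) + C := by
  obtain ⟨B, hB1, hB⟩ := exists_norm_LSeries_chiFour_le
  refine ⟨Real.log (2 * B), Real.log_nonneg (by linarith), fun s hs hs2 P hP => ?_⟩
  set b : ℕ → ℝ := fun n => (1 + (ZMod.χ₄ n : ℤ)) * (Λ n / Real.log n) with hb
  have hχ : ∀ n : ℕ, (-1 : ℝ) ≤ (ZMod.χ₄ n : ℤ) ∧ ((ZMod.χ₄ n : ℤ) : ℝ) ≤ 1 := by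
    intro n
    rw [ZMod.χ₄_nat_eq_if_mod_four]
    split_ifs <;> norm_num
  have hb0 : ∀ n, 0 ≤ b n := fun n =>
    mul_nonneg (by linarith [(hχ n).1]) (vonMangoldt_div_log_nonneg n)
  have hb2 : ∀ n, b n ≤ 2 := fun n => by
    have := vonMangoldt_div_log_le_one n
    have := vonMangoldt_div_log_nonneg n
    have := hχ n
    simp only [hb]; nlinarith
  have h := sum_le_re_LSeries hb0 hb2 hs P fun p hp => (hP p hp).1.ne_zero
  have h2 : 2 * ∑ p ∈ P, (p : ℝ) ^ (-s) = ∑ p ∈ P, b p * (p : ℝ) ^ (-s) := by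
    rw [Finset.mul_sum]
    refine Finset.sum_congr rfl fun p hp => ?_
    simp only [hb]
    rw [vonMangoldt_div_log_prime (hP p hp).1, ZMod.χ₄_nat_one_mod_four (hP p hp).2]
    norm_num
  rw [h2]
  refine h.trans ?_
  have hre : 1 < (s : ℂ).re := by simpa using hs
  have h3 : Real.exp (LSeries (fun n => (b n : ℂ)) s).re ≤ 2 / (s - 1) * B := by
    rw [← Complex.norm_exp]
    have e1 := riemannZeta_eq_exp_LSeries hre
    have e2 := DirichletCharacter.LSeries_eq_exp_LSeries chiFour hre
    have e3 : LSeries (fun n => (b n : ℂ)) s =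
        LSeries (fun n => (Λ n : ℂ) / Real.log n) s +
        LSeries (fun n => chiFour n * Λ n / Real.log n) s := by
      rw [← LSeries_add]
      · congr 1
        ext n
        simp only [hb, chiFour_natCast, Pi.add_apply]
        push_cast; ring
      · refine LSeriesSummable_of_bounded_of_one_lt_real (m := 1) (fun n _ => ?_) hs
        rw [← Complex.ofReal_div, Complex.norm_real,
          Real.norm_of_nonneg (vonMangoldt_div_log_nonneg n)]
        exact vonMangoldt_div_log_le_one n
      · refine LSeriesSummable_of_bounded_of_one_lt_real (m := 1) (fun n _ => ?_) hs
        rw [mul_div_assoc, norm_mul, ← Complex.ofReal_div, Complex.norm_real,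
          Real.norm_of_nonneg (vonMangoldt_div_log_nonneg n)]
        exact mul_le_one₀ (DirichletCharacter.norm_le_one _ _) (vonMangoldt_div_log_nonneg n)
          (vonMangoldt_div_log_le_one n)
    rw [e3, Complex.exp_add, e1, e2, norm_mul]
    have h4 : 0 < s - 1 := by linarith
    exact mul_le_mul (norm_riemannZeta_le hs hs2) (hB s hs hs2) (norm_nonneg _) (by positivity)
  have h4 : 0 < s - 1 := by linarith
  rw [← Real.le_log_iff_exp_le (by positivity)] at h3
  have h5 : Real.log (2 / (s - 1) * B) = Real.log (1 / (s - 1)) + Real.log (2 * B) := by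
    rw [← Real.log_mul (by positivity) (by positivity)]; congr 1; ring
  linarith

/-! ### Prime powers and Mertens-type bounds -/

theorem sum_Icc_one_le {a : ℕ → ℝ} (ha : ∀ n, 0 ≤ a n) (N : ℕ) :
    ∑ e ∈ Finset.Icc 1 N, a e ≤ a 1 + ∑ e ∈ Finset.Icc 2 N, a e := by
  have h : Finset.Icc 1 N ⊆ insert 1 (Finset.Icc 2 N) := by
    intro e he
    simp only [Finset.mem_Icc, Finset.mem_insert] at he ⊢
    omega
  refine (Finset.sum_le_sum_of_subset_of_nonneg h fun e _ _ => ha e).trans (le_of_eq ?_)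
  rw [Finset.sum_insert (by simp)]

theorem summable_add_one_pow_div_two_pow (l : ℕ) :
    Summable fun e : ℕ => ((e : ℝ) + 1) ^ l / 2 ^ e := by
  have h := (summable_nat_add_iff 1).2
    (summable_pow_mul_geometric_of_norm_lt_one l (r := (1 / 2 : ℝ)) (by norm_num))
  refine (h.mul_left 2).congr fun e => ?_
  push_cast
  rw [pow_succ (1 / 2 : ℝ), one_div_pow]; ring

/-- For e ≥ 2 one has p^(−e) ≤ 4 p^(−2) 2^(−e), which separates the sum into two convergent ones.
This bounds the contribution of all higher prime powers. -/
theorem exists_sum_prime_powers_le (l : ℕ) :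
    ∃ C : ℝ, 0 ≤ C ∧ ∀ (N : ℕ) (P : Finset ℕ), (∀ p ∈ P, p.Prime) →
      ∑ p ∈ P, ∑ e ∈ Finset.Icc 2 N, ((e : ℝ) + 1) ^ l / (p : ℝ) ^ e ≤ C := by
  set S := ∑' e : ℕ, ((e : ℝ) + 1) ^ l / 2 ^ e
  set Z := ∑' n : ℕ, 1 / (n : ℝ) ^ 2
  have hS0 : 0 ≤ S := tsum_nonneg fun e => by positivity
  have hZ0 : 0 ≤ Z := tsum_nonneg fun e => by positivity
  refine ⟨4 * S * Z, by positivity, fun N P hP => ?_⟩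
  have h1 : ∀ p ∈ P, ∑ e ∈ Finset.Icc 2 N, ((e : ℝ) + 1) ^ l / (p : ℝ) ^ e ≤
      4 * S * (1 / (p : ℝ) ^ 2) := by
    intro p hp
    have hp2 : (2 : ℝ) ≤ p := by exact_mod_cast (hP p hp).two_le
    calc _ ≤ ∑ e ∈ Finset.Icc 2 N, (4 / (p : ℝ) ^ 2) * (((e : ℝ) + 1) ^ l / 2 ^ e) := by
          refine Finset.sum_le_sum fun e he => ?_
          obtain ⟨j, rfl⟩ := Nat.exists_eq_add_of_le (Finset.mem_Icc.1 he).1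
          have h2 : (2 : ℝ) ^ j ≤ (p : ℝ) ^ j := pow_le_pow_left₀ (by norm_num) hp2 j
          rw [div_mul_div_comm, pow_add, pow_add]
          rw [div_le_div_iff₀ (by positivity) (by positivity)]
          have : 0 ≤ (((2 + j : ℕ) : ℝ) + 1) ^ l * (p : ℝ) ^ 2 := by positivity
          nlinarith [mul_le_mul_of_nonneg_left h2 this]
      _ = (4 / (p : ℝ) ^ 2) * ∑ e ∈ Finset.Icc 2 N, (((e : ℝ) + 1) ^ l / 2 ^ e) := by
          rw [Finset.mul_sum]
      _ ≤ (4 / (p : ℝ) ^ 2) * S := by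
          gcongr
          exact (summable_add_one_pow_div_two_pow l).sum_le_tsum _ fun e _ => by positivity
      _ = _ := by ring
  calc _ ≤ ∑ p ∈ P, 4 * S * (1 / (p : ℝ) ^ 2) := Finset.sum_le_sum h1
    _ = 4 * S * ∑ p ∈ P, (1 / (p : ℝ) ^ 2) := by rw [Finset.mul_sum]
    _ ≤ _ := by
      gcongr
      exact (Real.summable_one_div_nat_pow.2 (by norm_num)).sum_le_tsum _ fun e _ => by positivity

theorem prod_one_add_le_exp_sum {ι : Type*} (s : Finset ι) {a : ι → ℝ} (ha : ∀ i ∈ s, 0 ≤ a i) :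
    ∏ i ∈ s, (1 + a i) ≤ Real.exp (∑ i ∈ s, a i) := by
  rw [Real.exp_sum]
  exact Finset.prod_le_prod (fun i hi => by linarith [ha i hi])
    fun i _ => by linarith [Real.add_one_le_exp (a i)]

theorem log_le_sum_one_div (N : ℕ) : Real.log N ≤ ∑ n ∈ Finset.Icc 1 N, 1 / (n : ℝ) := by
  have h := log_add_one_le_harmonic N
  rw [harmonic_eq_sum_Icc] at h
  push_cast at h
  simp only [one_div]
  refine le_trans ?_ h
  rcases Nat.eq_zero_or_pos N with rfl | hN
  · simp
  · exact Real.log_le_log (by exact_mod_cast hN) (by linarith)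

/-- The lower bound in Mertens' second theorem. -/
theorem exists_log_log_le_sum_prime :
    ∃ C : ℝ, ∀ N : ℕ, 2 ≤ N → Real.log (Real.log N) - C ≤
      ∑ p ∈ (Finset.Icc 1 N).filter Nat.Prime, 1 / (p : ℝ) := by
  obtain ⟨C, -, hC⟩ := exists_sum_prime_powers_le 0
  refine ⟨C, fun N hN => ?_⟩
  -- The harmonic sum, at least log N, is bounded by its Euler product, whose logarithm is the prime
  -- sum plus O(1).
  have h := sum_Icc_le_prod_of_submultiplicative (f := fun n => 1 / (n : ℝ))
    (g := fun p e => 1 / (p : ℝ) ^ e) (fun n => by positivity) (fun p e => by positivity)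
    (fun p e m _ _ _ => by push_cast; rw [one_div_mul_one_div]) N
  have hlog : 0 < Real.log N := Real.log_pos (by exact_mod_cast hN)
  have h2 := (log_le_sum_one_div N).trans (h.trans (mul_le_mul_of_nonneg_left
    (prod_one_add_le_exp_sum _ fun p _ => Finset.sum_nonneg fun e _ => by positivity)
    (by positivity)))
  rw [Nat.cast_one, one_div_one, one_mul, ← Real.log_le_iff_le_exp hlog] at h2
  have h3 : ∑ p ∈ (Finset.Icc 1 N).filter Nat.Prime, ∑ e ∈ Finset.Icc 1 N, 1 / (p : ℝ) ^ e ≤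
      ∑ p ∈ (Finset.Icc 1 N).filter Nat.Prime, 1 / (p : ℝ) + C := by
    refine le_trans ?_ (add_le_add_right (hC N ((Finset.Icc 1 N).filter Nat.Prime)
      fun p hp => (Finset.mem_filter.1 hp).2) _)
    rw [← Finset.sum_add_distrib]
    refine Finset.sum_le_sum fun p _ => ?_
    refine (sum_Icc_one_le (fun e => by positivity) N).trans (le_of_eq ?_)
    simp
  linarith

/-- Keep only the points a + bi with 1 ≤ b ≤ a ≤ √(N/2). There 1/(a² + b²) ≥ 1/(2a²), and summing
over b leaves half a harmonic sum. This elementary bound takes the place of L(1, χ₄) ≠ 0. -/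
theorem log_sub_le_sum_normCount (N : ℕ) (hN : 1 ≤ N) :
    (Real.log N - Real.log 2) / 4 ≤ ∑ n ∈ Finset.Icc 1 N, (normCount n : ℝ) / n := by
  set M := Nat.sqrt (N / 2) with hM
  have hM1 : M * M ≤ N / 2 := Nat.sqrt_le _
  have hM2 : N / 2 < (M + 1) * (M + 1) := Nat.lt_succ_sqrt _
  have e1 : ∑ n ∈ Finset.Icc 1 N, (normCount n : ℝ) / n =
      ∑ q ∈ (Finset.Icc 1 N).sigma normSet, 1 / (q.1 : ℝ) := by
    rw [Finset.sum_sigma]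
    refine Finset.sum_congr rfl fun n _ => ?_
    simp [normCount, div_eq_mul_inv]
  have e2 : ∑ a ∈ Finset.Icc 1 M, 1 / (2 * (a : ℝ)) =
      ∑ q ∈ (Finset.Icc 1 M).sigma (fun a => Finset.Icc 1 a), 1 / (2 * (q.1 : ℝ) ^ 2) := by
    rw [Finset.sum_sigma]
    refine Finset.sum_congr rfl fun a ha => ?_
    have : (a : ℝ) ≠ 0 := by have := (Finset.mem_Icc.1 ha).1; positivity
    simp
    field_simp
  have h1 : ∑ a ∈ Finset.Icc 1 M, 1 / (2 * (a : ℝ)) ≤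
      ∑ n ∈ Finset.Icc 1 N, (normCount n : ℝ) / n := by
    rw [e1, e2]
    refine Finset.sum_le_sum_of_injOn' (fun q => ⟨q.1 ^ 2 + q.2 ^ 2, ⟨q.1, q.2⟩⟩) ?_ ?_ ?_ ?_
    · rintro ⟨a, b⟩ h
      simp only [Finset.mem_sigma, Finset.mem_Icc] at h ⊢
      refine ⟨⟨by nlinarith, ?_⟩, ?_⟩
      · have : a * a ≤ M * M := Nat.mul_le_mul h.1.2 h.1.2
        have : b * b ≤ a * a := Nat.mul_le_mul h.2.2 h.2.2
        rw [sq, sq]; omega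
      · rw [mem_normSet, GaussianInt.norm_mk]; push_cast; rfl
    · rintro ⟨a, b⟩ _ ⟨a', b'⟩ _ h
      simp only [Sigma.mk.injEq] at h
      obtain ⟨h1, h2⟩ := h
      rw [heq_eq_eq, Zsqrtd.ext_iff] at h2
      simp only [Nat.cast_inj] at h2
      obtain ⟨rfl, rfl⟩ := h2
      rfl
    · rintro ⟨a, b⟩ h
      simp only [Finset.mem_sigma, Finset.mem_Icc] at h
      have ha : (1 : ℝ) ≤ a := by exact_mod_cast h.1.1
      have hb : (b : ℝ) ≤ a := by exact_mod_cast h.2.2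
      have hb0 : (0 : ℝ) ≤ b := Nat.cast_nonneg b
      push_cast
      exact one_div_le_one_div_of_le (by positivity) (by nlinarith)
    · intro b _; positivity
  refine le_trans ?_ h1
  have h2 := log_add_one_le_harmonic M
  rw [harmonic_eq_sum_Icc] at h2
  push_cast at h2
  have h3 : ∑ a ∈ Finset.Icc 1 M, 1 / (2 * (a : ℝ)) =
      (1 / 2) * ∑ a ∈ Finset.Icc 1 M, (a : ℝ)⁻¹ := by
    rw [Finset.mul_sum]; exact Finset.sum_congr rfl fun a _ => by rw [one_div, mul_inv]; ring
  have h4 : (N : ℝ) / 2 ≤ ((M : ℝ) + 1) ^ 2 := by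
    have : N ≤ 2 * ((M + 1) * (M + 1)) := by omega
    have : (N : ℝ) ≤ 2 * ((M + 1) * (M + 1)) := by exact_mod_cast this
    linarith
  have hN' : (0 : ℝ) < N := by exact_mod_cast hN
  have h5 := Real.log_le_log (by positivity) h4
  rw [Real.log_div hN'.ne' (by norm_num), Real.log_pow] at h5
  push_cast at h5
  rw [h3]; linarith

/-- The lower bound in Mertens' second theorem for the primes that are `1` modulo `4`. -/
theorem exists_log_log_le_sum_prime_one_mod_four :
    ∃ C : ℝ, ∀ N : ℕ, 4 ≤ N → Real.log (Real.log N) - C ≤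
      2 * ∑ p ∈ (Finset.Icc 1 N).filter (fun p => p.Prime ∧ p % 4 = 1), 1 / (p : ℝ) := by
  obtain ⟨C, -, hC⟩ := exists_sum_prime_powers_le 1
  -- As log N ≥ 2 log 2, the lower bound for the sum is at least (log N)/8, while `normCount 1 ≤ 4`;
  -- together these give 32.
  refine ⟨C + 1 + Real.log 32, fun N hN => ?_⟩
  have h := sum_Icc_le_prod_of_submultiplicative (f := fun n => (normCount n : ℝ) / (n : ℝ))
    (g := fun p e => (localCount p e : ℝ) / (p : ℝ) ^ e) (fun n => by positivity)
    (fun p e => by positivity) (fun p e m hp he hm => by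
      rw [div_mul_div_comm]; push_cast
      have : (normCount (p ^ e * m) : ℝ) ≤ localCount p e * normCount m := by
        exact_mod_cast normCount_pow_mul hp he hm
      gcongr) N
  have hlog2 := Real.log_two_lt_d9
  have hN' : (4 : ℝ) ≤ N := by exact_mod_cast hN
  have hlog4 : 2 * Real.log 2 ≤ Real.log N := by
    have := Real.log_le_log (by norm_num) hN'
    rwa [show (4 : ℝ) = 2 ^ 2 by norm_num, Real.log_pow] at this
  have hlog : 0 < Real.log N := Real.log_pos (by linarith)
  have h2 := (log_sub_le_sum_normCount N (by omega)).trans (h.trans (mul_le_mul_of_nonneg_left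
    (prod_one_add_le_exp_sum _ fun p _ => Finset.sum_nonneg fun e _ => by positivity)
    (by positivity)))
  set X := ∑ p ∈ (Finset.Icc 1 N).filter Nat.Prime,
    ∑ e ∈ Finset.Icc 1 N, (localCount p e : ℝ) / (p : ℝ) ^ e with hX
  have h3 : X ≤ 2 * ∑ p ∈ (Finset.Icc 1 N).filter (fun p => p.Prime ∧ p % 4 = 1), 1 / (p : ℝ) +
      1 + C := by
    refine le_trans ?_ (add_le_add_right (hC N ((Finset.Icc 1 N).filter Nat.Prime)
      fun p hp => (Finset.mem_filter.1 hp).2) _)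
    -- Inert primes drop out, and the prime 2 accounts for the summand 1.
    have e1 : ∑ p ∈ (Finset.Icc 1 N).filter Nat.Prime, (localCount p 1 : ℝ) / p ≤
        2 * ∑ p ∈ (Finset.Icc 1 N).filter (fun p => p.Prime ∧ p % 4 = 1), 1 / (p : ℝ) + 1 := by
      have hsub : (1 : ℝ) = ∑ p ∈ ({2} : Finset ℕ), 2 / (p : ℝ) := by simp
      have h2 : 2 * ∑ p ∈ (Finset.Icc 1 N).filter (fun p => p.Prime ∧ p % 4 = 1), 1 / (p : ℝ) + 1 =
          ∑ p ∈ insert 2 ((Finset.Icc 1 N).filter (fun p => p.Prime ∧ p % 4 = 1)), 2 / (p : ℝ) := by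
        rw [Finset.sum_insert (by simp), Finset.mul_sum]
        simp only [mul_one_div]
        norm_num [add_comm]
      rw [h2]
      have h4 : ∑ p ∈ (Finset.Icc 1 N).filter Nat.Prime, (localCount p 1 : ℝ) / p =
          ∑ p ∈ ((Finset.Icc 1 N).filter Nat.Prime).filter (fun p => p % 4 ≠ 3),
            (localCount p 1 : ℝ) / p := by
        refine (Finset.sum_filter_of_ne (p := fun p => p % 4 ≠ 3) ?_).symm
        intro p _ hp h3
        exact hp (by simp [localCount, h3])
      rw [h4]
      refine Finset.sum_le_sum_of_injOn' id ?_ Function.injective_id.injOn ?_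
        fun p _ => by positivity
      · intro p hp
        simp only [Finset.mem_filter, Finset.mem_insert, id] at hp ⊢
        rcases hp.1.2.eq_two_or_odd with h | h
        · exact Or.inl h
        · exact Or.inr ⟨hp.1.1, hp.1.2, by omega⟩
      · intro p _
        have : (localCount p 1 : ℝ) ≤ 2 := by exact_mod_cast localCount_le p 1
        simp only [id]
        gcongr
    refine le_trans ?_ (add_le_add_left e1 _)
    rw [hX, ← Finset.sum_add_distrib]
    refine Finset.sum_le_sum fun p _ => ?_
    refine (sum_Icc_one_le (fun e => by positivity) N).trans (add_le_add (by simp) ?_)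
    refine Finset.sum_le_sum fun e _ => ?_
    have : (localCount p e : ℝ) ≤ e + 1 := by exact_mod_cast localCount_le p e
    rw [pow_one]
    gcongr
  have h4 : (normCount 1 : ℝ) / (1 : ℕ) ≤ 4 := by
    rw [Nat.cast_one, div_one]; exact_mod_cast normCount_one
  have h5 : Real.log N ≤ 32 * Real.exp X := by
    have := mul_le_mul_of_nonneg_right h4 (Real.exp_pos X).le
    linarith
  have h6 := Real.log_le_log hlog h5
  rw [Real.log_mul (by norm_num) (Real.exp_pos X).ne', Real.log_exp] at h6
  linarith

/-- A crude upper bound of the order of Mertens' second theorem. -/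
theorem sum_prime_one_div_le {H : ℝ} (hH : 3 ≤ H) {P : Finset ℕ}
    (hP : ∀ p ∈ P, p.Prime ∧ (p : ℝ) ≤ H) :
    ∑ p ∈ P, 1 / (p : ℝ) ≤ 3 * Real.log (Real.log H) + 3 := by
  have hlog : 1 ≤ Real.log H := by
    rw [Real.le_log_iff_exp_le (by linarith)]
    linarith [Real.exp_one_lt_d9]
  have hll : 0 ≤ Real.log (Real.log H) := Real.log_nonneg hlog
  have hinv : 1 / Real.log H ≤ 1 := div_le_one_of_le₀ hlog (by linarith)
  -- With this s, p^(−1) ≤ e · p^(−s) for all p ≤ H.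
  have h := sum_prime_rpow_le (s := 1 + 1 / Real.log H) (by
    have : 0 < 1 / Real.log H := by positivity
    linarith) (by linarith) fun p hp => (hP p hp).1
  rw [add_sub_cancel_left, one_div_one_div] at h
  have h2 : ∑ p ∈ P, 1 / (p : ℝ) ≤ Real.exp 1 * ∑ p ∈ P, (p : ℝ) ^ (-(1 + 1 / Real.log H)) := by
    rw [Finset.mul_sum]
    refine Finset.sum_le_sum fun p hp => ?_
    have hp0 : (0 : ℝ) < p := by exact_mod_cast (hP p hp).1.pos
    rw [neg_add, Real.rpow_add hp0, Real.rpow_neg_one]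
    have h3 : Real.exp (-1) ≤ (p : ℝ) ^ (-(1 / Real.log H)) := by
      rw [Real.rpow_def_of_pos hp0]
      refine Real.exp_le_exp.2 ?_
      have := Real.log_le_log hp0 (hP p hp).2
      have h4 : Real.log p * (1 / Real.log H) ≤ 1 := by
        rw [mul_one_div]; exact div_le_one_of_le₀ this (by linarith)
      linarith
    have h5 : 1 ≤ Real.exp 1 * (p : ℝ) ^ (-(1 / Real.log H)) := by
      calc (1 : ℝ) = Real.exp 1 * Real.exp (-1) := by rw [← Real.exp_add]; simp
        _ ≤ _ := by gcongr
    rw [one_div]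
    calc (p : ℝ)⁻¹ = (p : ℝ)⁻¹ * 1 := by ring
      _ ≤ (p : ℝ)⁻¹ * (Real.exp 1 * (p : ℝ) ^ (-(1 / Real.log H))) := by gcongr
      _ = _ := by ring
  have he := Real.exp_one_lt_d9
  have h0 : 0 ≤ Real.log (Real.log H) + 1 := by linarith
  calc _ ≤ _ := h2
    _ ≤ Real.exp 1 * (Real.log (Real.log H) + 1) := by gcongr
    _ ≤ 3 * (Real.log (Real.log H) + 1) := by gcongr; linarith
    _ = _ := by ring

/-- The primes up to H are bounded by Mertens. At most log D / log 2 ≤ 2H primes divide D, and those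
beyond H contribute at most 1/H each. -/
theorem sum_primeFactors_one_div_le {D : ℕ} (hD : D ≠ 0) {H : ℝ} (hH : 3 ≤ H)
    (hDH : Real.log D ≤ H) :
    ∑ p ∈ D.primeFactors, 1 / (p : ℝ) ≤ 3 * Real.log (Real.log H) + 5 := by
  rw [← Finset.sum_filter_add_sum_filter_not D.primeFactors (fun p : ℕ => (p : ℝ) ≤ H)]
  have h1 := sum_prime_one_div_le hH (P := D.primeFactors.filter (fun p : ℕ => (p : ℝ) ≤ H))
    fun p hp => ⟨Nat.prime_of_mem_primeFactors (Finset.mem_filter.1 hp).1,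
      (Finset.mem_filter.1 hp).2⟩
  have h2 : ∑ p ∈ D.primeFactors.filter (fun p : ℕ => ¬ (p : ℝ) ≤ H), 1 / (p : ℝ) ≤ 2 := by
    have hc : (2 : ℝ) ^ D.primeFactors.card ≤ D := by
      have e1 : 2 ^ D.primeFactors.card ≤ ∏ p ∈ D.primeFactors, p :=
        Finset.pow_card_le_prod _ _ _ fun p hp => (Nat.prime_of_mem_primeFactors hp).two_le
      exact_mod_cast e1.trans (Nat.le_of_dvd (by omega) (Nat.prod_primeFactors_dvd D))
    have hc2 := Real.log_le_log (by positivity) hc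
    rw [Real.log_pow] at hc2
    have hl := Real.log_two_gt_d9
    have hc3 : (D.primeFactors.card : ℝ) ≤ 2 * H := by
      have : (0 : ℝ) ≤ D.primeFactors.card := Nat.cast_nonneg _
      nlinarith
    calc _ ≤ ∑ p ∈ D.primeFactors.filter (fun p : ℕ => ¬ (p : ℝ) ≤ H), 1 / H := by
          refine Finset.sum_le_sum fun p hp => ?_
          exact one_div_le_one_div_of_le (by linarith) (not_le.1 (Finset.mem_filter.1 hp).2).le
      _ ≤ ∑ p ∈ D.primeFactors, 1 / H :=
          Finset.sum_le_sum_of_subset_of_nonneg (Finset.filter_subset _ _)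
            fun p _ _ => by positivity
      _ = D.primeFactors.card / H := by simp [div_eq_mul_inv]
      _ ≤ 2 := by rw [div_le_iff₀ (by linarith)]; exact hc3
  linarith

/-! ### The mean of powers of the norm count -/

/-- Rankin's trick: for m ≤ x the shift of the exponent by 1/log x costs a factor at most e, and it
makes the Dirichlet series bounds applicable. -/
theorem sum_div_le_three_mul_sum_rpow {x : ℝ} (hx0 : 0 < x) (hx : 1 ≤ Real.log x) {a : ℕ → ℝ}
    (ha : ∀ m, 0 ≤ a m) (q : ℕ → Prop) [DecidablePred q] :
    ∑ m ∈ (Finset.Icc 1 ⌊x⌋₊).filter q, a m / m ≤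
      3 * ∑ m ∈ (Finset.Icc 1 ⌊x⌋₊).filter q, a m * (m : ℝ) ^ (-(1 + 1 / Real.log x)) := by
  rw [Finset.mul_sum]
  refine Finset.sum_le_sum fun m hm => ?_
  have hm' := Finset.mem_Icc.1 (Finset.mem_filter.1 hm).1
  have hm0 : (0 : ℝ) < m := by exact_mod_cast hm'.1
  have hmx : (m : ℝ) ≤ x := (Nat.cast_le.2 hm'.2).trans (Nat.floor_le hx0.le)
  have h1 : Real.exp (-1) ≤ (m : ℝ) ^ (-(1 / Real.log x)) := by
    rw [Real.rpow_def_of_pos hm0]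
    refine Real.exp_le_exp.2 ?_
    have := Real.log_le_log hm0 hmx
    have h4 : Real.log m * (1 / Real.log x) ≤ 1 := by
      rw [mul_one_div]; exact div_le_one_of_le₀ this (by linarith)
    linarith
  have h2 : 1 ≤ 3 * (m : ℝ) ^ (-(1 / Real.log x)) := by
    calc (1 : ℝ) = Real.exp 1 * Real.exp (-1) := by rw [← Real.exp_add]; simp
      _ ≤ 3 * _ := by gcongr; linarith [Real.exp_one_lt_d9]
  rw [neg_add, Real.rpow_add hm0, Real.rpow_neg_one, div_eq_mul_inv]
  have h3 : 0 ≤ a m * (m : ℝ)⁻¹ := mul_nonneg (ha m) (by positivity)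
  calc a m * (m : ℝ)⁻¹ = a m * (m : ℝ)⁻¹ * 1 := by ring
    _ ≤ a m * (m : ℝ)⁻¹ * (3 * (m : ℝ) ^ (-(1 / Real.log x))) := by gcongr
    _ = _ := by ring

/-- The factor 2^(l−1) is half of 2^l = (local count)^l, since only the primes p ≡ 1 mod 4 matter at
first order: they carry half of the total log log x. -/
theorem exists_sum_normCount_pow_div_le (l : ℕ) (hl : 1 ≤ l) :
    ∃ C : ℝ, 0 ≤ C ∧ ∀ (x : ℝ) (j : ℕ), 0 < x → 1 ≤ Real.log x →
      ∑ m ∈ (Finset.Icc 1 ⌊x⌋₊).filter (fun m => omegaStar m = j), (normCount m : ℝ) ^ l / m ≤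
        C * ((2 ^ (l - 1) * Real.log (Real.log x) + C) ^ j / (j.factorial : ℝ)) := by
  obtain ⟨C1, hC10, hC1⟩ := exists_sum_prime_powers_le l
  obtain ⟨C2, hC20, hC2⟩ := exists_sum_prime_one_mod_four_rpow_le
  -- One constant serves twice: the first summand bounds the outer factor (Rankin, m = 1, the prime
  -- 2), the second the O(1) inside the j-th power.
  set Cf : ℝ := 3 * 4 ^ l * (1 + 2 ^ l + C1) + (2 ^ (l - 1) * C2 + C1) with hCf
  refine ⟨Cf, by positivity, fun x j hx0 hx => ?_⟩
  set N := ⌊x⌋₊ with hN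
  set s : ℝ := 1 + 1 / Real.log x with hs
  have hinv : 1 / Real.log x ≤ 1 := div_le_one_of_le₀ hx (by linarith)
  have hinv0 : 0 < 1 / Real.log x := by positivity
  have hs1 : 1 < s := by linarith
  set f : ℕ → ℝ := fun m => (normCount m : ℝ) ^ l * (m : ℝ) ^ (-s) with hf
  set g : ℕ → ℕ → ℝ := fun p e => (localCount p e : ℝ) ^ l * ((p : ℝ) ^ e) ^ (-s) with hg
  have hf0 : ∀ n, 0 ≤ f n := fun n => by positivity
  have hg0 : ∀ p e, 0 ≤ g p e := fun p e => by positivity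
  have hfg : ∀ p e m, p.Prime → 1 ≤ e → ¬ p ∣ m → f (p ^ e * m) ≤ g p e * f m := by
    intro p e m hp he hm
    have h1 : (normCount (p ^ e * m) : ℝ) ≤ localCount p e * normCount m := by
      exact_mod_cast normCount_pow_mul hp he hm
    simp only [hf, hg]
    push_cast
    rw [Real.mul_rpow (by positivity) (by positivity)]
    calc _ ≤ ((localCount p e : ℝ) * normCount m) ^ l * (((p : ℝ) ^ e) ^ (-s) * (m : ℝ) ^ (-s)) := by
          gcongr
      _ = _ := by rw [mul_pow]; ring
  have hgle : ∀ p e : ℕ, p.Prime → g p e ≤ ((e : ℝ) + 1) ^ l / (p : ℝ) ^ e := by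
    intro p e hp
    have h1 : (localCount p e : ℝ) ≤ e + 1 := by exact_mod_cast localCount_le p e
    have hp1 : (1 : ℝ) ≤ (p : ℝ) ^ e := one_le_pow₀ (by exact_mod_cast hp.one_lt.le)
    have h2 : ((p : ℝ) ^ e) ^ (-s) ≤ ((p : ℝ) ^ e)⁻¹ := by
      rw [← Real.rpow_neg_one]
      exact Real.rpow_le_rpow_of_exponent_le hp1 (by linarith)
    simp only [hg]
    rw [div_eq_mul_inv]
    gcongr
  have hbase := sum_omegaStar_le hf0 hg0 hfg N j
  have hf1 : f 1 ≤ 4 ^ l := by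
    simp only [hf, Nat.cast_one, Real.one_rpow, mul_one]
    have : (normCount 1 : ℝ) ≤ 4 := by exact_mod_cast normCount_one
    gcongr
  have hg2 : ∑ e ∈ Finset.Icc 1 N, g 2 e ≤ 2 ^ l + C1 := by
    refine (sum_Icc_one_le (hg0 2) N).trans (add_le_add ?_ ?_)
    · refine (hgle 2 1 Nat.prime_two).trans ?_
      push_cast
      rw [show (1 : ℝ) + 1 = 2 by norm_num, pow_one]
      have : (0 : ℝ) ≤ 2 ^ l := by positivity
      linarith
    · refine (Finset.sum_le_sum fun e _ => hgle 2 e Nat.prime_two).trans ?_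
      have := hC1 N {2} (by simp [Nat.prime_two])
      simpa using this
  have hT : ∑ p ∈ (Finset.Icc 1 N).filter (fun p => p.Prime ∧ Odd p),
      ∑ e ∈ Finset.Icc 1 N, g p e ≤ 2 ^ (l - 1) * Real.log (Real.log x) + Cf := by
    set Q := (Finset.Icc 1 N).filter (fun p => p.Prime ∧ Odd p) with hQ
    have h1 : ∑ p ∈ Q, ∑ e ∈ Finset.Icc 1 N, g p e ≤ ∑ p ∈ Q, g p 1 + C1 := by
      refine le_trans ?_ (add_le_add_right (hC1 N Q fun p hp => (Finset.mem_filter.1 hp).2.1) _)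
      rw [← Finset.sum_add_distrib]
      refine Finset.sum_le_sum fun p hp => ?_
      refine (sum_Icc_one_le (hg0 p) N).trans (add_le_add_right ?_ _)
      exact Finset.sum_le_sum fun e _ => hgle p e (Finset.mem_filter.1 hp).2.1
    have h2 : ∑ p ∈ Q, g p 1 = ∑ p ∈ Q.filter (fun p => p % 4 = 1), g p 1 := by
      refine (Finset.sum_filter_of_ne ?_).symm
      intro p hp hne
      by_contra h
      have hodd := Nat.odd_iff.1 (Finset.mem_filter.1 hp).2.2
      exact hne (by simp [hg, localCount, show p % 4 = 3 by omega, show l ≠ 0 by omega])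
    have h3 : ∑ p ∈ Q.filter (fun p => p % 4 = 1), g p 1 ≤
        2 ^ l * ∑ p ∈ Q.filter (fun p => p % 4 = 1), (p : ℝ) ^ (-s) := by
      rw [Finset.mul_sum]
      refine Finset.sum_le_sum fun p _ => ?_
      have : (localCount p 1 : ℝ) ≤ 2 := by exact_mod_cast localCount_le p 1
      simp only [hg, pow_one]
      gcongr
    have h4 := hC2 s hs1 (by linarith) (Q.filter (fun p => p % 4 = 1)) fun p hp => by
      simp only [hQ, Finset.mem_filter] at hp
      exact ⟨hp.1.2.1, hp.2⟩
    rw [hs, add_sub_cancel_left, one_div_one_div, ← hs] at h4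
    have h5 : (2 : ℝ) ^ l = 2 ^ (l - 1) * 2 := by
      rw [← pow_succ]; congr 1; omega
    have h6 := mul_le_mul_of_nonneg_left h4 (by positivity : (0 : ℝ) ≤ 2 ^ (l - 1))
    have h7 : (0 : ℝ) ≤ 3 * 4 ^ l * (1 + 2 ^ l + C1) := by positivity
    rw [h2] at h1
    rw [h5, mul_assoc] at h3
    linarith
  have hconv := sum_div_le_three_mul_sum_rpow hx0 hx
    (a := fun m => (normCount m : ℝ) ^ l) (fun m => by positivity)
    (fun m => omegaStar m = j)
  have hT0 : 0 ≤ ∑ p ∈ (Finset.Icc 1 N).filter (fun p => p.Prime ∧ Odd p),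
      ∑ e ∈ Finset.Icc 1 N, g p e :=
    Finset.sum_nonneg fun p _ => Finset.sum_nonneg fun e _ => hg0 p e
  have hg20 : 0 ≤ ∑ e ∈ Finset.Icc 1 N, g 2 e := Finset.sum_nonneg fun e _ => hg0 2 e
  have hll : 0 ≤ Real.log (Real.log x) := Real.log_nonneg hx
  set T := ∑ p ∈ (Finset.Icc 1 N).filter (fun p => p.Prime ∧ Odd p),
      ∑ e ∈ Finset.Icc 1 N, g p e
  set G := ∑ e ∈ Finset.Icc 1 N, g 2 e
  set U := 2 ^ (l - 1) * Real.log (Real.log x) + Cf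
  have hfac : (0 : ℝ) < j.factorial := by positivity
  have hpow : T ^ j / (j.factorial : ℝ) ≤ U ^ j / (j.factorial : ℝ) :=
    div_le_div_of_nonneg_right (pow_le_pow_left₀ hT0 hT j) hfac.le
  have hU0 : 0 ≤ U ^ j / (j.factorial : ℝ) := div_nonneg (pow_nonneg (hT0.trans hT) j) hfac.le
  have hcoef : f 1 * (1 + G) ≤ 4 ^ l * (1 + (2 ^ l + C1)) :=
    mul_le_mul hf1 (by linarith) (by linarith) (by positivity)
  have hfin := hbase.trans (mul_le_mul hcoef hpow (div_nonneg (pow_nonneg hT0 j) hfac.le)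
    (by positivity))
  have hCf2 : 3 * (4 ^ l * (1 + (2 ^ l + C1))) ≤ Cf := by
    have : 0 ≤ 2 ^ (l - 1) * C2 + C1 := by positivity
    rw [hCf]; linarith
  refine hconv.trans ((mul_le_mul_of_nonneg_left hfin (by norm_num)).trans ?_)
  rw [← mul_assoc]
  exact mul_le_mul_of_nonneg_right hCf2 hU0

/-! ### Lattice points in residue classes and Brun's sieve -/

theorem abs_card_filter_cast_sub_le (N d : ℕ) (hd : 0 < d) (a : ZMod d) :
    |(((Finset.Icc (-(N : ℤ)) N).filter (fun u : ℤ => (u : ZMod d) = a)).card : ℝ) -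
      (2 * N + 1) / d| ≤ 1 := by
  have : NeZero d := ⟨hd.ne'⟩
  have h := Int.Ico_filter_modEq_card (-(N : ℤ)) (N + 1) (r := d) (by exact_mod_cast hd) a.val
  have e : (Finset.Icc (-(N : ℤ)) N).filter (fun u : ℤ => (u : ZMod d) = a) =
      (Finset.Ico (-(N : ℤ)) (N + 1)).filter (fun u => u ≡ a.val [ZMOD d]) := by
    ext u
    simp only [Finset.mem_filter, Finset.mem_Icc, Finset.mem_Ico]
    rw [← ZMod.intCast_eq_intCast_iff]
    simp
  rw [e]
  set X : ℚ := (((N : ℤ) + 1 : ℤ) - ((a.val : ℤ) : ℚ)) / ((d : ℤ) : ℚ) with hX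
  set Y : ℚ := ((-(N : ℤ) : ℤ) - ((a.val : ℤ) : ℚ)) / ((d : ℤ) : ℚ) with hY
  set c := ((Finset.Ico (-(N : ℤ)) (N + 1)).filter (fun u => u ≡ a.val [ZMOD d])).card
  have hXY : X - Y = (2 * N + 1) / d := by
    rw [hX, hY, ← sub_div]; push_cast; ring
  have h1 := Int.le_ceil X
  have h2 := Int.ceil_lt_add_one X
  have h3 := Int.le_ceil Y
  have h4 := Int.ceil_lt_add_one Y
  have hd' : (0 : ℚ) < d := by exact_mod_cast hd
  have h5 : (0 : ℚ) < (2 * N + 1) / d := by positivity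
  have hle : ⌈Y⌉ ≤ ⌈X⌉ := Int.ceil_mono (by linarith)
  rw [max_eq_left (by linarith)] at h
  have hq : |(c : ℚ) - (2 * N + 1) / d| ≤ 1 := by
    have : (c : ℚ) = ⌈X⌉ - ⌈Y⌉ := by exact_mod_cast h
    rw [this, abs_le]
    constructor <;> linarith
  have hr : ((|(c : ℚ) - (2 * N + 1) / d| : ℚ) : ℝ) ≤ 1 := by exact_mod_cast hq
  push_cast at hr
  exact hr

theorem card_box_filter_le (N d : ℕ) (hd : 0 < d) (W : Finset (ZMod d × ZMod d)) :
    |((((Finset.Icc (-(N : ℤ)) N) ×ˢ (Finset.Icc (-(N : ℤ)) N)).filter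
      (fun w : ℤ × ℤ => ((w.1 : ZMod d), (w.2 : ZMod d)) ∈ W)).card : ℝ) -
      (2 * N + 1) ^ 2 * (W.card / (d : ℝ) ^ 2)| ≤ 3 * (2 * N + 1) * (d : ℝ) ^ 2 := by
  classical
  have : NeZero d := ⟨hd.ne'⟩
  set I := Finset.Icc (-(N : ℤ)) N with hI
  set c : ZMod d → ℝ := fun a => ((I.filter (fun u : ℤ => (u : ZMod d) = a)).card : ℝ) with hc
  have hcount : (((I ×ˢ I).filter
      (fun w : ℤ × ℤ => ((w.1 : ZMod d), (w.2 : ZMod d)) ∈ W)).card : ℝ) =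
      ∑ q ∈ W, c q.1 * c q.2 := by
    rw [Finset.card_eq_sum_card_fiberwise (f := fun w : ℤ × ℤ => ((w.1 : ZMod d), (w.2 : ZMod d)))
      (s := (I ×ˢ I).filter (fun w : ℤ × ℤ => ((w.1 : ZMod d), (w.2 : ZMod d)) ∈ W))
      (t := W) (fun w hw => (Finset.mem_filter.1 hw).2)]
    push_cast
    refine Finset.sum_congr rfl fun q hq => ?_
    simp only [hc]
    rw [← Nat.cast_mul, ← Finset.card_product]
    congr 2
    ext w
    obtain ⟨q1, q2⟩ := q
    simp only [Finset.mem_filter, Finset.mem_product, Prod.mk.injEq]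
    constructor
    · rintro ⟨⟨⟨h1, h2⟩, -⟩, h3, h4⟩; exact ⟨⟨h1, h3⟩, h2, h4⟩
    · rintro ⟨⟨h1, h3⟩, h2, h4⟩; exact ⟨⟨⟨h1, h2⟩, by rw [h3, h4]; exact hq⟩, h3, h4⟩
  have hd1 : (1 : ℝ) ≤ d := by exact_mod_cast hd
  set M : ℝ := 2 * N + 1 with hM
  have hM1 : 1 ≤ M := by have : (0 : ℝ) ≤ N := Nat.cast_nonneg N; linarith
  have hMd : M / d ≤ M := div_le_self (by linarith) hd1
  have hMd0 : 0 ≤ M / d := by positivity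
  have hc1 : ∀ a, |c a - M / d| ≤ 1 := fun a => abs_card_filter_cast_sub_le N d hd a
  -- Each coordinate count is M/d + O(1), so a product of two is (M/d)² + O(M).
  have hterm : ∀ q ∈ W, |c q.1 * c q.2 - (M / d) ^ 2| ≤ 3 * M := by
    intro q _
    have h1 := abs_le.1 (hc1 q.1)
    have h2 := abs_le.1 (hc1 q.2)
    have e : c q.1 * c q.2 - (M / d) ^ 2 = (c q.1 - M / d) * (c q.2 - M / d) +
        (M / d) * (c q.1 - M / d) + (M / d) * (c q.2 - M / d) := by ring
    rw [e]
    refine (abs_add_three _ _ _).trans ?_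
    rw [abs_mul, abs_mul, abs_mul, abs_of_nonneg hMd0]
    have a1 := hc1 q.1
    have a2 := hc1 q.2
    have a3 : |c q.1 - M / d| * |c q.2 - M / d| ≤ 1 := mul_le_one₀ a1 (abs_nonneg _) a2
    nlinarith
  have hWc : (W.card : ℝ) ≤ (d : ℝ) ^ 2 := by
    have : W.card ≤ d ^ 2 := by
      refine (Finset.card_le_univ W).trans (le_of_eq ?_)
      rw [Fintype.card_prod, ZMod.card, sq]
    exact_mod_cast this
  rw [hcount]
  have e2 : M ^ 2 * (W.card / (d : ℝ) ^ 2) = ∑ q ∈ W, (M / d) ^ 2 := by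
    rw [Finset.sum_const, nsmul_eq_mul]; ring
  rw [e2, ← Finset.sum_sub_distrib]
  calc _ ≤ ∑ q ∈ W, |c q.1 * c q.2 - (M / d) ^ 2| := Finset.abs_sum_le_sum_abs _ _
    _ ≤ ∑ q ∈ W, 3 * M := Finset.sum_le_sum hterm
    _ = 3 * M * W.card := by rw [Finset.sum_const, nsmul_eq_mul]; ring
    _ ≤ _ := by gcongr

/-- The Chinese remainder theorem for pairs of residues with local conditions. -/
theorem exists_crt_set (S : Finset ℕ) (hS : ∀ p ∈ S, p.Prime)
    (Ω : ∀ p : ℕ, Finset (ZMod p × ZMod p)) :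
    ∃ W : Finset (ZMod (∏ p ∈ S, p) × ZMod (∏ p ∈ S, p)), W.card = ∏ p ∈ S, (Ω p).card ∧
      ∀ u v : ℤ, ((u : ZMod (∏ p ∈ S, p)), (v : ZMod (∏ p ∈ S, p))) ∈ W ↔
        ∀ p ∈ S, ((u : ZMod p), (v : ZMod p)) ∈ Ω p := by
  classical
  have hd : ∏ p ∈ S, p ≠ 0 := Finset.prod_ne_zero_iff.2 fun p hp => (hS p hp).ne_zero
  rw [← Finset.prod_coe_sort S (fun p => p)] at hd ⊢
  have : NeZero (∏ i : S, (i : ℕ)) := ⟨hd⟩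
  have hcop : Pairwise (Function.onFun Nat.Coprime (fun i : S => (i : ℕ))) := by
    intro i j hij
    exact (Nat.coprime_primes (hS i i.2) (hS j j.2)).2 fun h => hij (Subtype.ext h)
  set e := ZMod.prodEquivPi (fun i : S => (i : ℕ)) hcop
  refine ⟨Finset.univ.filter (fun w => ∀ i : S, (e w.1 i, e w.2 i) ∈ Ω i), ?_, ?_⟩
  · rw [← Finset.prod_coe_sort S (fun p => (Ω p).card), ← Fintype.card_piFinset]
    refine Finset.card_bij (fun w _ i => (e w.1 i, e w.2 i)) ?_ ?_ ?_
    · intro w hw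
      rw [Fintype.mem_piFinset]
      exact (Finset.mem_filter.1 hw).2
    · intro w _ w' _ h
      have h1 : e w.1 = e w'.1 := funext fun i => congrArg Prod.fst (congrFun h i)
      have h2 : e w.2 = e w'.2 := funext fun i => congrArg Prod.snd (congrFun h i)
      exact Prod.ext (e.injective h1) (e.injective h2)
    · intro f hf
      rw [Fintype.mem_piFinset] at hf
      refine ⟨(e.symm fun i => (f i).1, e.symm fun i => (f i).2), ?_, ?_⟩
      · rw [Finset.mem_filter]
        refine ⟨Finset.mem_univ _, fun i => ?_⟩
        rw [e.apply_symm_apply, e.apply_symm_apply]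
        exact hf i
      · funext i
        change (e (e.symm fun i => (f i).1) i, e (e.symm fun i => (f i).2) i) = f i
        rw [e.apply_symm_apply, e.apply_symm_apply]
  · intro u v
    simp only [Finset.mem_filter, Finset.mem_univ, true_and, map_intCast, Pi.intCast_apply]
    exact ⟨fun h p hp => h ⟨p, hp⟩, fun h i => h i i.2⟩

/-- The Bonferroni inequality: truncation of the inclusion-exclusion sum after an even term. -/
theorem bonferroni_le {ι : Type*} [DecidableEq ι] (T : Finset ι) {r : ℕ} (hr : Even r) :
    (if T = ∅ then (1 : ℝ) else 0) ≤
      ∑ S ∈ T.powerset.filter (fun S => S.card ≤ r), (-1 : ℝ) ^ S.card := by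
  have h1 : ∑ S ∈ T.powerset.filter (fun S => S.card ≤ r), (-1 : ℝ) ^ S.card =
      ∑ j ∈ Finset.range (r + 1), (-1 : ℝ) ^ j * T.card.choose j := by
    rw [← Finset.sum_fiberwise_of_maps_to (s := T.powerset.filter (fun S => S.card ≤ r))
      (t := Finset.range (r + 1)) (g := Finset.card)
      (fun S hS => Finset.mem_range.2 (Nat.lt_succ_of_le (Finset.mem_filter.1 hS).2))]
    refine Finset.sum_congr rfl fun j hj => ?_
    have e : (T.powerset.filter (fun S => S.card ≤ r)).filter (fun S => S.card = j) =
        T.powersetCard j := by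
      ext S
      simp only [Finset.mem_filter, Finset.mem_powerset, Finset.mem_powersetCard]
      have := Finset.mem_range.1 hj
      constructor
      · rintro ⟨⟨a, -⟩, b⟩; exact ⟨a, b⟩
      · rintro ⟨a, b⟩; exact ⟨⟨a, by omega⟩, b⟩
    rw [e, Finset.sum_congr rfl (fun S hS => by rw [(Finset.mem_powersetCard.1 hS).2]),
      Finset.sum_const, Finset.card_powersetCard, nsmul_eq_mul, mul_comm]
  rw [h1]
  by_cases hT : T = ∅
  · subst hT
    rw [if_pos rfl, Finset.sum_range_succ']
    simp
  · rw [if_neg hT]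
    obtain ⟨n, hn⟩ : ∃ n, T.card = n + 1 :=
      Nat.exists_eq_succ_of_ne_zero (Finset.card_ne_zero.2 (Finset.nonempty_iff_ne_empty.2 hT))
    -- Alternating partial sums of binomial coefficients telescope by Pascal's rule; for even r the
    -- value is nonnegative.
    have h2 : ∀ r : ℕ, ∑ j ∈ Finset.range (r + 1), (-1 : ℝ) ^ j * (n + 1).choose j =
        (-1) ^ r * n.choose r := by
      intro r
      induction r with
      | zero => simp
      | succ r ih =>
        rw [Finset.sum_range_succ, ih, Nat.choose_succ_succ]
        push_cast; ring
    rw [hn, h2, hr.neg_one_pow]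
    positivity

/-- An upper bound sieve for lattice points in a square (Brun's pure sieve). -/
theorem brun_sieve (P : Finset ℕ) (hP : ∀ p ∈ P, p.Prime) (z : ℕ) (hz : 1 ≤ z)
    (hPz : ∀ p ∈ P, p ≤ z) (Ω : ∀ p : ℕ, Finset (ZMod p × ZMod p)) (N r : ℕ) (hr : Even r) :
    ((((Finset.Icc (-(N : ℤ)) N) ×ˢ (Finset.Icc (-(N : ℤ)) N)).filter
      (fun w : ℤ × ℤ => ∀ p ∈ P, ((w.1 : ZMod p), (w.2 : ZMod p)) ∉ Ω p)).card : ℝ) ≤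
      (2 * N + 1) ^ 2 * (Real.exp (-∑ p ∈ P, ((Ω p).card : ℝ) / (p : ℝ) ^ 2) +
        Real.exp (-r + 3 * ∑ p ∈ P, ((Ω p).card : ℝ) / (p : ℝ) ^ 2)) +
      3 * (2 * N + 1) * (z : ℝ) ^ (3 * r) := by
  classical
  set box := (Finset.Icc (-(N : ℤ)) N) ×ˢ (Finset.Icc (-(N : ℤ)) N) with hbox
  set M : ℝ := 2 * N + 1 with hM
  set δ : ℕ → ℝ := fun p => ((Ω p).card : ℝ) / (p : ℝ) ^ 2 with hδ
  have hM0 : 0 < M := by positivity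
  have hδ0 : ∀ p, 0 ≤ δ p := fun p => by positivity
  have hδ1 : ∀ p ∈ P, δ p ≤ 1 := by
    intro p hp
    have := Fact.mk (hP p hp)
    have h1 : (Ω p).card ≤ p ^ 2 := by
      refine (Finset.card_le_univ _).trans (le_of_eq ?_)
      rw [Fintype.card_prod, ZMod.card, sq]
    exact div_le_one_of_le₀ (by exact_mod_cast h1) (by positivity)
  set F := P.powerset.filter (fun S => S.card ≤ r) with hF
  set cnt : Finset ℕ → ℝ := fun S =>
    ((box.filter (fun w : ℤ × ℤ => ∀ p ∈ S, ((w.1 : ZMod p), (w.2 : ZMod p)) ∈ Ω p)).card : ℝ)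
    with hcnt
  have hstep1 : ((box.filter
      (fun w : ℤ × ℤ => ∀ p ∈ P, ((w.1 : ZMod p), (w.2 : ZMod p)) ∉ Ω p)).card : ℝ) ≤
      ∑ S ∈ F, (-1 : ℝ) ^ S.card * cnt S := by
    have e1 : ((box.filter
      (fun w : ℤ × ℤ => ∀ p ∈ P, ((w.1 : ZMod p), (w.2 : ZMod p)) ∉ Ω p)).card : ℝ) =
      ∑ w ∈ box, if P.filter (fun p => ((w.1 : ZMod p), (w.2 : ZMod p)) ∈ Ω p) = ∅
        then (1 : ℝ) else 0 := by
      rw [Finset.card_filter]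
      push_cast
      refine Finset.sum_congr rfl fun w _ => ?_
      simp only [Finset.filter_eq_empty_iff]
    have e2 : ∑ S ∈ F, (-1 : ℝ) ^ S.card * cnt S = ∑ w ∈ box,
        ∑ S ∈ (P.filter (fun p => ((w.1 : ZMod p), (w.2 : ZMod p)) ∈ Ω p)).powerset.filter
          (fun S => S.card ≤ r), (-1 : ℝ) ^ S.card := by
      have : ∀ w ∈ box, ∑ S ∈ (P.filter (fun p => ((w.1 : ZMod p), (w.2 : ZMod p)) ∈
          Ω p)).powerset.filter (fun S => S.card ≤ r), (-1 : ℝ) ^ S.card =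
          ∑ S ∈ F, if (∀ p ∈ S, ((w.1 : ZMod p), (w.2 : ZMod p)) ∈ Ω p)
            then (-1 : ℝ) ^ S.card else 0 := by
        intro w _
        rw [← Finset.sum_filter]
        refine Finset.sum_congr ?_ fun _ _ => rfl
        ext S
        simp only [hF, Finset.mem_filter, Finset.mem_powerset, Finset.subset_iff]
        constructor
        · rintro ⟨h1, h2⟩; exact ⟨⟨fun p hp => (h1 hp).1, h2⟩, fun p hp => (h1 hp).2⟩
        · rintro ⟨⟨h1, h2⟩, h3⟩; exact ⟨fun p hp => ⟨h1 hp, h3 p hp⟩, h2⟩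
      rw [Finset.sum_congr rfl this, Finset.sum_comm]
      refine Finset.sum_congr rfl fun S _ => ?_
      rw [← Finset.sum_filter, Finset.sum_const, nsmul_eq_mul, mul_comm]
    rw [e1, e2]
    exact Finset.sum_le_sum fun w _ => bonferroni_le _ hr
  have hcntS : ∀ S ∈ F, |cnt S - M ^ 2 * ∏ p ∈ S, δ p| ≤ 3 * M * (z : ℝ) ^ (2 * r) := by
    intro S hS
    simp only [hF, Finset.mem_filter, Finset.mem_powerset] at hS
    obtain ⟨W, hW1, hW2⟩ := exists_crt_set S (fun p hp => hP p (hS.1 hp)) Ω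
    have hd : 0 < ∏ p ∈ S, p := Finset.prod_pos fun p hp => (hP p (hS.1 hp)).pos
    have h := card_box_filter_le N _ hd W
    simp only [hW2] at h
    rw [hW1] at h
    have e : ((∏ p ∈ S, (Ω p).card : ℕ) : ℝ) / ((∏ p ∈ S, p : ℕ) : ℝ) ^ 2 = ∏ p ∈ S, δ p := by
      push_cast
      rw [← Finset.prod_pow, ← Finset.prod_div_distrib]
    rw [e] at h
    refine h.trans ?_
    have hdz : ∏ p ∈ S, p ≤ z ^ r :=
      (Finset.prod_le_pow_card _ _ _ fun p hp => hPz p (hS.1 hp)).trans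
        (Nat.pow_le_pow_right hz hS.2)
    have hdz' : ((∏ p ∈ S, p : ℕ) : ℝ) ≤ (z : ℝ) ^ r := by exact_mod_cast hdz
    rw [mul_comm 2 r, pow_mul]
    gcongr
  -- A set of primes is determined by its product, which is at most z^r.
  have hFcard : (F.card : ℝ) ≤ (z : ℝ) ^ r := by
    have : F.card ≤ (Finset.Icc 1 (z ^ r)).card := by
      refine Finset.card_le_card_of_injOn (fun S => ∏ p ∈ S, p) ?_ ?_
      · intro S hS
        simp only [hF, Finset.mem_coe, Finset.mem_filter, Finset.mem_powerset] at hS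
        rw [Finset.mem_coe, Finset.mem_Icc]
        exact ⟨Finset.prod_pos fun p hp => (hP p (hS.1 hp)).pos,
          (Finset.prod_le_pow_card _ _ _ fun p hp => hPz p (hS.1 hp)).trans
          (Nat.pow_le_pow_right hz hS.2)⟩
      · intro S hS S' hS' h
        simp only [hF, Finset.mem_coe, Finset.mem_filter, Finset.mem_powerset] at hS hS'
        have h1 := Nat.primeFactors_prod fun p hp => hP p (hS.1 hp)
        have h2 := Nat.primeFactors_prod fun p hp => hP p (hS'.1 hp)
        rw [← h1, ← h2]
        exact congrArg _ h
    rw [Nat.card_Icc, Nat.add_sub_cancel] at this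
    exact_mod_cast this
  have hstep2 : ∑ S ∈ F, (-1 : ℝ) ^ S.card * cnt S ≤
      M ^ 2 * ∑ S ∈ F, (-1 : ℝ) ^ S.card * ∏ p ∈ S, δ p + 3 * M * (z : ℝ) ^ (3 * r) := by
    have h1 : ∀ S ∈ F, (-1 : ℝ) ^ S.card * cnt S ≤
        M ^ 2 * ((-1 : ℝ) ^ S.card * ∏ p ∈ S, δ p) + 3 * M * (z : ℝ) ^ (2 * r) := by
      intro S hS
      have h := abs_le.1 (hcntS S hS)
      rcases neg_one_pow_eq_or ℝ S.card with h' | h' <;> rw [h'] <;> linarith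
    calc _ ≤ _ := Finset.sum_le_sum h1
      _ = M ^ 2 * ∑ S ∈ F, (-1 : ℝ) ^ S.card * ∏ p ∈ S, δ p +
          F.card * (3 * M * (z : ℝ) ^ (2 * r)) := by
        rw [Finset.sum_add_distrib, Finset.sum_const, nsmul_eq_mul, Finset.mul_sum]
      _ ≤ M ^ 2 * ∑ S ∈ F, (-1 : ℝ) ^ S.card * ∏ p ∈ S, δ p +
          (z : ℝ) ^ r * (3 * M * (z : ℝ) ^ (2 * r)) := by gcongr
      _ = _ := by ring
  have hmain : ∑ S ∈ F, (-1 : ℝ) ^ S.card * ∏ p ∈ S, δ p ≤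
      Real.exp (-∑ p ∈ P, δ p) + Real.exp (-r + 3 * ∑ p ∈ P, δ p) := by
    have h1 : ∏ p ∈ P, (1 - δ p) ≤ Real.exp (-∑ p ∈ P, δ p) := by
      rw [← Finset.sum_neg_distrib, Real.exp_sum]
      exact Finset.prod_le_prod (fun p hp => by linarith [hδ1 p hp])
        fun p _ => by linarith [Real.add_one_le_exp (-δ p)]
    have h2 : ∏ p ∈ P, (1 - δ p) = ∑ S ∈ P.powerset, (-1 : ℝ) ^ S.card * ∏ p ∈ S, δ p := by
      simp only [sub_eq_add_neg]
      rw [Finset.prod_one_add]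
      exact Finset.sum_congr rfl fun S _ => by rw [Finset.prod_neg]
    -- The tail beyond r is bounded by weighting every prime with 3 > e: then 3^|S| ≥ e^r, and the
    -- weighted sum over all S is a product.
    have h3 : ∑ S ∈ P.powerset.filter (fun S => ¬ S.card ≤ r), ∏ p ∈ S, δ p ≤
        Real.exp (-r + 3 * ∑ p ∈ P, δ p) := by
      have h4 : ∑ S ∈ P.powerset, ∏ p ∈ S, (3 * δ p) ≤ Real.exp (3 * ∑ p ∈ P, δ p) := by
        rw [← Finset.prod_one_add, Finset.mul_sum]
        exact prod_one_add_le_exp_sum P fun p _ => by have := hδ0 p; positivity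
      rw [Real.exp_add]
      calc _ ≤ ∑ S ∈ P.powerset.filter (fun S => ¬ S.card ≤ r),
            Real.exp (-r) * ∏ p ∈ S, (3 * δ p) := by
            refine Finset.sum_le_sum fun S hS => ?_
            have hSr := (Finset.mem_filter.1 hS).2
            rw [Finset.prod_mul_distrib, Finset.prod_const]
            have h5 : Real.exp r ≤ 3 ^ S.card := by
              calc Real.exp r = Real.exp 1 ^ r := by rw [← Real.exp_nat_mul, mul_one]
                _ ≤ 3 ^ r := by gcongr; linarith [Real.exp_one_lt_d9]
                _ ≤ 3 ^ S.card := pow_le_pow_right₀ (by norm_num) (by omega)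
            have h6 : 1 ≤ Real.exp (-r) * 3 ^ S.card := by
              calc (1 : ℝ) = Real.exp (-r) * Real.exp r := by rw [← Real.exp_add]; simp
                _ ≤ _ := by gcongr
            have h7 : 0 ≤ ∏ p ∈ S, δ p := Finset.prod_nonneg fun p _ => hδ0 p
            rw [← mul_assoc]
            exact le_mul_of_one_le_left h7 h6
        _ ≤ ∑ S ∈ P.powerset, Real.exp (-r) * ∏ p ∈ S, (3 * δ p) :=
            Finset.sum_le_sum_of_subset_of_nonneg (Finset.filter_subset _ _) fun S _ _ =>
              mul_nonneg (Real.exp_pos _).le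
                (Finset.prod_nonneg fun p _ => by have := hδ0 p; positivity)
        _ ≤ _ := by rw [← Finset.mul_sum]; gcongr
    have h4 : -∑ S ∈ P.powerset.filter (fun S => ¬ S.card ≤ r), ∏ p ∈ S, δ p ≤
        ∑ S ∈ P.powerset.filter (fun S => ¬ S.card ≤ r), (-1 : ℝ) ^ S.card * ∏ p ∈ S, δ p := by
      rw [← Finset.sum_neg_distrib]
      refine Finset.sum_le_sum fun S _ => ?_
      have h7 : 0 ≤ ∏ p ∈ S, δ p := Finset.prod_nonneg fun p _ => hδ0 p
      rcases neg_one_pow_eq_or ℝ S.card with h' | h' <;> rw [h'] <;> linarith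
    rw [h2, ← Finset.sum_filter_add_sum_filter_not P.powerset (fun S => S.card ≤ r)] at h1
    linarith
  calc _ ≤ _ := hstep1
    _ ≤ _ := hstep2
    _ ≤ _ := by gcongr

/-! ### Local conditions for the norm form and the linear forms -/

/-- Pairwise independent linear forms over a finite field vanish on a union of lines. -/
theorem exists_union_lines {F ι : Type*} [Field F] [Fintype F] [Fintype ι] (c : ι → F × F)
    (hc : ∀ i, c i ≠ 0) (hdet : ∀ i j, i ≠ j → (c i).1 * (c j).2 - (c i).2 * (c j).1 ≠ 0) :
    ∃ Ω : Finset (F × F), Ω.card = Fintype.card ι * (Fintype.card F - 1) ∧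
      ∀ w ∈ Ω, ∃ i, (c i).1 * w.1 + (c i).2 * w.2 = 0 := by
  classical
  -- Each line is parametrised with the origin removed, so that distinct lines are disjoint and the
  -- cardinality is exact.
  refine ⟨((Finset.univ : Finset ι) ×ˢ (Finset.univ.erase (0 : F))).image
    (fun q => (q.2 * (c q.1).2, -(q.2 * (c q.1).1))), ?_, ?_⟩
  · rw [Finset.card_image_of_injOn, Finset.card_product, Finset.card_univ,
      Finset.card_erase_of_mem (Finset.mem_univ _), Finset.card_univ]
    rintro ⟨i, t⟩ hq ⟨j, s⟩ _ h
    have ht : t ≠ 0 := by simpa using hq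
    simp only [Prod.mk.injEq, neg_inj] at h
    obtain ⟨h1, h2⟩ := h
    have hij : i = j := by
      by_contra hij
      refine hdet i j hij ((mul_eq_zero.1 (?_ : t * _ = 0)).resolve_left ht)
      linear_combination (c j).2 * h2 - (c j).1 * h1
    subst hij
    have hts : t = s := by
      by_contra hts
      have hts' : t - s ≠ 0 := sub_ne_zero.2 hts
      refine hc i (Prod.ext ?_ ?_)
      · exact (mul_eq_zero.1 (by linear_combination h2 : (t - s) * (c i).1 = 0)).resolve_left hts'
      · exact (mul_eq_zero.1 (by linear_combination h1 : (t - s) * (c i).2 = 0)).resolve_left hts'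
    rw [hts]
  · intro w hw
    obtain ⟨⟨i, t⟩, -, rfl⟩ := Finset.mem_image.1 hw
    exact ⟨i, by ring⟩

/-- The number of lines modulo `p` on which `(u² + v²) ∏ (α_j u + β_j v)` vanishes. -/
def lineCount (l p : ℕ) : ℕ := l + if p % 4 = 1 then 2 else 0

/-- For p ≡ 1 mod 4 the norm form splits as (u + ιv)(u − ιv) with ι² = −1, giving two lines beyond
those of the linear forms. They differ from the latter because α_j² + β_j² = m is a unit mod p; the
linear forms differ among themselves by the determinant hypothesis. -/
theorem exists_local_set {l : ℕ} {α β : Fin l → ℤ} {m p : ℕ} (hp : p.Prime)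
    (hm : ∀ j, α j ^ 2 + β j ^ 2 = m) (hpm : ¬ p ∣ m)
    (hdet : ∀ i j, i ≠ j → ¬ (p : ℤ) ∣ α i * β j - β i * α j) :
    ∃ Ω : Finset (ZMod p × ZMod p), Ω.card = lineCount l p * (p - 1) ∧
      ∀ u v : ℤ, ((u : ZMod p), (v : ZMod p)) ∈ Ω →
        (p : ℤ) ∣ u ^ 2 + v ^ 2 ∨ ∃ j, (p : ℤ) ∣ α j * u + β j * v := by
  have := Fact.mk hp
  have hm0 : (m : ZMod p) ≠ 0 := by rwa [Ne, ZMod.natCast_eq_zero_iff]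
  have hmz : ∀ j, (α j : ZMod p) ^ 2 + (β j : ZMod p) ^ 2 = m := by
    intro j
    have h := congrArg (Int.cast : ℤ → ZMod p) (hm j)
    push_cast at h
    exact h
  have hdz : ∀ i j, i ≠ j → (α i : ZMod p) * β j - β i * α j ≠ 0 := by
    intro i j hij h
    exact hdet i j hij ((ZMod.intCast_zmod_eq_zero_iff_dvd _ p).1 (by push_cast; exact h))
  have hform : ∀ j, ((α j : ZMod p), (β j : ZMod p)) ≠ 0 := by
    intro j h
    rw [Prod.mk_eq_zero] at h
    exact hm0 (by rw [← hmz j, h.1, h.2]; ring)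
  by_cases h4 : p % 4 = 1
  · obtain ⟨ι, hι⟩ := ZMod.exists_sq_eq_neg_one_iff.2 (show p % 4 ≠ 3 by omega)
    have hι0 : ι ≠ 0 := by rintro rfl; simp at hι
    have h2 : (2 : ZMod p) ≠ 0 := by
      intro h
      have : ((2 : ℕ) : ZMod p) = 0 := by exact_mod_cast h
      rw [ZMod.natCast_eq_zero_iff] at this
      have := (Nat.prime_dvd_prime_iff_eq hp Nat.prime_two).1 this
      omega
    have hmix : ∀ j, ∀ κ : ZMod p, κ * κ = -1 → (α j : ZMod p) * κ - β j ≠ 0 := by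
      intro j κ hκ h
      exact hm0 (by rw [← hmz j]; linear_combination (-(α j : ZMod p) * κ - β j) * h +
        (α j : ZMod p) ^ 2 * hκ)
    set c : Fin l ⊕ Bool → ZMod p × ZMod p := Sum.elim (fun j => (α j, β j))
      (fun b => (1, if b then ι else -ι)) with hc
    have hs : ∀ b : Bool, (if b then ι else -ι) * (if b then ι else -ι) = -1 := by
      intro b; cases b <;> simp [← hι]
    obtain ⟨Ω, h1, h3⟩ := exists_union_lines c (by
      rintro (j | b)
      · exact hform j
      · intro h; simp [hc] at h) (by
      rintro (i | a) (j | b) hij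
      · exact hdz i j fun h => hij (by rw [h])
      · have := hmix i _ (hs b)
        simp only [hc, Sum.elim_inl, Sum.elim_inr, mul_one]
        exact this
      · have := hmix j _ (hs a)
        simp only [hc, Sum.elim_inl, Sum.elim_inr, one_mul]
        intro h; exact this (by linear_combination -h)
      · have h2ι : 2 * ι ≠ 0 := mul_ne_zero h2 hι0
        cases a <;> cases b <;> simp [hc] at hij ⊢
        · intro h; exact h2ι (by linear_combination h)
        · intro h; exact h2ι (by linear_combination -h))
    refine ⟨Ω, by rw [h1, ZMod.card]; simp [lineCount, h4], fun u v huv => ?_⟩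
    obtain ⟨i | b, hi⟩ := h3 _ huv
    · right
      refine ⟨i, (ZMod.intCast_zmod_eq_zero_iff_dvd _ p).1 ?_⟩
      push_cast; exact hi
    · left
      refine (ZMod.intCast_zmod_eq_zero_iff_dvd _ p).1 ?_
      simp only [hc, Sum.elim_inr, one_mul] at hi
      push_cast
      have := hs b
      linear_combination ((u : ZMod p) - (if b then ι else -ι) * v) * hi + (v : ZMod p) ^ 2 * this
  · obtain ⟨Ω, h1, h3⟩ := exists_union_lines (fun j => ((α j : ZMod p), (β j : ZMod p))) hform hdz
    refine ⟨Ω, by rw [h1, ZMod.card]; simp [lineCount, h4], fun u v huv => ?_⟩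
    obtain ⟨i, hi⟩ := h3 _ huv
    right
    refine ⟨i, (ZMod.intCast_zmod_eq_zero_iff_dvd _ p).1 ?_⟩
    push_cast; exact hi

/-- The product of the determinants of the pairs of forms, times `2m`. -/
def formDisc {l : ℕ} (α β : Fin l → ℤ) (m : ℕ) : ℕ :=
  2 * m * ∏ q : Fin l × Fin l, if q.1 = q.2 then 1 else (α q.1 * β q.2 - β q.1 * α q.2).natAbs

theorem formDisc_ne_zero {l : ℕ} {α β : Fin l → ℤ} {m : ℕ} (hm : m ≠ 0)
    (hdet : ∀ i j, i ≠ j → α i * β j - β i * α j ≠ 0) : formDisc α β m ≠ 0 := by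
  refine mul_ne_zero (by omega) (Finset.prod_ne_zero_iff.2 fun q _ => ?_)
  split_ifs with h
  · exact one_ne_zero
  · exact Int.natAbs_ne_zero.2 (hdet _ _ h)

theorem formDisc_le {l : ℕ} {α β : Fin l → ℤ} {m : ℕ} (hm0 : 1 ≤ m)
    (hm : ∀ j, α j ^ 2 + β j ^ 2 = m) : formDisc α β m ≤ (2 * m) ^ (1 + l ^ 2) := by
  rw [pow_add, pow_one, formDisc]
  refine Nat.mul_le_mul_left _ ?_
  have h : ∀ q : Fin l × Fin l, (if q.1 = q.2 then 1 else
      (α q.1 * β q.2 - β q.1 * α q.2).natAbs) ≤ 2 * m := by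
    intro q
    split_ifs
    · omega
    · have h1 := hm q.1
      have h2 := hm q.2
      have : |α q.1 * β q.2 - β q.1 * α q.2| ≤ 2 * m := by
        rw [abs_le]
        constructor <;> nlinarith [sq_nonneg (α q.1 - β q.2), sq_nonneg (α q.1 + β q.2),
          sq_nonneg (β q.1 - α q.2), sq_nonneg (β q.1 + α q.2)]
      zify; exact this
  refine (Finset.prod_le_pow_card _ _ _ fun q _ => h q).trans (le_of_eq ?_)
  simp [sq]

theorem exists_local_set_of_not_dvd {l : ℕ} {α β : Fin l → ℤ} {m p : ℕ} (hp : p.Prime)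
    (hm : ∀ j, α j ^ 2 + β j ^ 2 = m) (hpD : ¬ p ∣ formDisc α β m) :
    ∃ Ω : Finset (ZMod p × ZMod p), Ω.card = lineCount l p * (p - 1) ∧
      ∀ u v : ℤ, ((u : ZMod p), (v : ZMod p)) ∈ Ω →
        (p : ℤ) ∣ u ^ 2 + v ^ 2 ∨ ∃ j, (p : ℤ) ∣ α j * u + β j * v := by
  refine exists_local_set hp hm (fun h => hpD ?_) fun i j hij h => hpD ?_
  · exact (h.mul_left 2).mul_right _
  · refine Dvd.dvd.mul_left ?_ _
    have h1 := Finset.dvd_prod_of_mem (fun q : Fin l × Fin l => if q.1 = q.2 then 1 else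
      (α q.1 * β q.2 - β q.1 * α q.2).natAbs) (Finset.mem_univ (i, j))
    simp only [if_neg hij] at h1
    exact (Int.natCast_dvd.1 h).trans h1

/-! ### The sieve level and the sieve bound -/

/-- The sieving level attached to `t = log log x`. -/
noncomputable def sieveLevel (t : ℝ) : ℕ := ⌊Real.exp (Real.exp t / t ^ 4)⌋₊

theorem pow_le_exp_mul {t : ℝ} (ht : 0 ≤ t) (n : ℕ) : t ^ n ≤ n.factorial * Real.exp t := by
  have := Real.pow_div_factorial_le_exp t ht n
  rwa [div_le_iff₀ (by positivity), mul_comm] at this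

/-- Dividing e^t by t⁴ lowers log log z by only 4 log t + O(1), a power of t after exponentiation,
yet keeps z^(3r) small when r is of order t. -/
theorem sieveLevel_bounds {t : ℝ} (ht : 240 ≤ t) :
    4 ≤ sieveLevel t ∧ t - 4 * Real.log t - 1 ≤ Real.log (Real.log (sieveLevel t)) ∧
      (sieveLevel t : ℝ) ≤ Real.exp (Real.exp t / t ^ 4) := by
  set W := Real.exp t / t ^ 4 with hW
  have ht0 : 0 < t := by linarith
  have hW2 : 2 ≤ W := by
    rw [hW, le_div_iff₀ (by positivity)]
    have h := pow_le_exp_mul ht0.le 5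
    have e : ((5 : ℕ).factorial : ℝ) = 120 := by norm_num [Nat.factorial]
    rw [e] at h
    have : 240 * t ^ 4 ≤ t ^ 5 := by rw [pow_succ t 4, mul_comm]; gcongr
    linarith
  have hle : (sieveLevel t : ℝ) ≤ Real.exp W := Nat.floor_le (Real.exp_pos _).le
  have hlow : Real.exp (W / 2) ≤ sieveLevel t := by
    have h1 : Real.exp W < sieveLevel t + 1 := Nat.lt_floor_add_one _
    have h2 : Real.exp W = Real.exp (W / 2) * Real.exp (W / 2) := by rw [← Real.exp_add]; ring_nf
    have h3 : 2 ≤ Real.exp (W / 2) := by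
      have := Real.add_one_le_exp (W / 2); linarith
    nlinarith
  have hWbig : 4 ≤ W := by
    rw [hW, le_div_iff₀ (by positivity)]
    have h := pow_le_exp_mul ht0.le 6
    have e : ((6 : ℕ).factorial : ℝ) = 720 := by norm_num [Nat.factorial]
    rw [e] at h
    have h57600 : 57600 * t ^ 4 ≤ t ^ 6 := by
      have h2 : 57600 ≤ t ^ 2 := by nlinarith
      calc 57600 * t ^ 4 ≤ t ^ 2 * t ^ 4 := by gcongr
        _ = _ := by ring
    have : 0 < t ^ 4 := by positivity
    linarith
  have hz4 : (4 : ℝ) ≤ sieveLevel t := by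
    refine le_trans ?_ hlow
    have h1 : Real.exp (W / 2) = Real.exp (W / 4) * Real.exp (W / 4) := by
      rw [← Real.exp_add]; ring_nf
    have h3 : 2 ≤ Real.exp (W / 4) := by
      have := Real.add_one_le_exp (W / 4); linarith
    nlinarith
  refine ⟨by exact_mod_cast hz4, ?_, hle⟩
  have h1 : W / 2 ≤ Real.log (sieveLevel t) := by
    rw [Real.le_log_iff_exp_le (by linarith)]; exact hlow
  have h2 := Real.log_le_log (by linarith) h1
  refine le_trans ?_ h2
  rw [Real.log_div (by linarith) (by norm_num), hW, Real.log_div (Real.exp_pos t).ne' (by positivity),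
    Real.log_exp, Real.log_pow]
  have := Real.log_two_lt_d9
  push_cast
  linarith

theorem log_formDisc_le {l : ℕ} {α β : Fin l → ℤ} {m : ℕ} (hm0 : 1 ≤ m)
    (hm : ∀ j, α j ^ 2 + β j ^ 2 = m) (hdet : ∀ i j, i ≠ j → α i * β j - β i * α j ≠ 0)
    {t : ℝ} (ht : 0 ≤ t) (hmt : (m : ℝ) ≤ Real.exp (Real.exp t)) :
    Real.log (formDisc α β m) ≤ (1 + (l : ℝ) ^ 2) * (2 * Real.exp t) := by
  have h1 : (formDisc α β m : ℝ) ≤ (2 * (m : ℝ)) ^ (1 + l ^ 2) := by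
    exact_mod_cast formDisc_le hm0 hm
  have h0 : (0 : ℝ) < formDisc α β m := by
    exact_mod_cast Nat.pos_of_ne_zero (formDisc_ne_zero (by omega) hdet)
  have hmpos : (0 : ℝ) < m := by exact_mod_cast hm0
  have h2 := Real.log_le_log h0 h1
  rw [Real.log_pow, Real.log_mul (by norm_num) hmpos.ne'] at h2
  refine h2.trans ?_
  push_cast
  have h3 : Real.log m ≤ Real.exp t := by
    rw [Real.log_le_iff_le_exp hmpos]; exact hmt
  have h4 := Real.add_one_le_exp t
  have := Real.log_two_lt_d9
  gcongr
  linarith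

/-- The discriminant is at most a fixed power of 2m, so its logarithm is O(e^t). Omitting its prime
factors from the sieve therefore costs only a power of t. -/
theorem sum_primeFactors_formDisc_le {l : ℕ} {α β : Fin l → ℤ} {m : ℕ} (hm0 : 1 ≤ m)
    (hm : ∀ j, α j ^ 2 + β j ^ 2 = m) (hdet : ∀ i j, i ≠ j → α i * β j - β i * α j ≠ 0)
    {t : ℝ} (ht : 2 * (1 + (l : ℝ) ^ 2) ≤ t) (hmt : (m : ℝ) ≤ Real.exp (Real.exp t)) :
    ∑ p ∈ (formDisc α β m).primeFactors, 1 / (p : ℝ) ≤ 3 * Real.log t + 8 := by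
  have hl0 : (0 : ℝ) ≤ (l : ℝ) ^ 2 := by positivity
  have ht0 : 0 < t := by linarith
  have hexp := Real.add_one_le_exp t
  set H := (1 + (l : ℝ) ^ 2) * (2 * Real.exp t) with hH
  have hH3 : 3 ≤ H := by nlinarith
  have h := sum_primeFactors_one_div_le (formDisc_ne_zero (by omega) hdet) hH3
    (log_formDisc_le hm0 hm hdet ht0.le hmt)
  have h1 : Real.log H ≤ 2 * t := by
    rw [Real.log_le_iff_le_exp (by linarith), two_mul, Real.exp_add, hH]
    nlinarith [Real.exp_pos t]
  have h2 : 0 < Real.log H := Real.log_pos (by linarith)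
  have h3 := Real.log_le_log h2 h1
  rw [Real.log_mul (by norm_num) ht0.ne'] at h3
  have := Real.log_two_lt_d9
  linarith

theorem lineCount_le (l p : ℕ) : (lineCount l p : ℝ) ≤ l + 2 := by
  have : lineCount l p ≤ l + 2 := by unfold lineCount; split_ifs <;> omega
  exact_mod_cast this

/-- The sieve has dimension l + 1: l/p summed over all primes gives l log log z, and 2/p summed over
p ≡ 1 mod 4 gives one more. -/
theorem exists_local_density_lower (l : ℕ) :
    ∃ C : ℝ, ∀ (D z : ℕ), D ≠ 0 → 4 ≤ z →
      (l + 1) * Real.log (Real.log z) - (l + 2) * ∑ p ∈ D.primeFactors, 1 / (p : ℝ) - C ≤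
      ∑ p ∈ ((Finset.Icc 1 z).filter Nat.Prime).filter (fun p => ¬ p ∣ D),
        ((lineCount l p * (p - 1) : ℕ) : ℝ) / (p : ℝ) ^ 2 := by
  obtain ⟨C1, hC1⟩ := exists_log_log_le_sum_prime
  obtain ⟨C2, hC2⟩ := exists_log_log_le_sum_prime_one_mod_four
  obtain ⟨C3, hC30, hC3⟩ := exists_sum_prime_powers_le 0
  refine ⟨l * C1 + C2 + (l + 2) * C3, fun D z hD hz => ?_⟩
  set Q := (Finset.Icc 1 z).filter Nat.Prime with hQ
  have hQp : ∀ p ∈ Q, p.Prime := fun p hp => (Finset.mem_filter.1 hp).2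
  have e1 : ∑ p ∈ Q.filter (fun p => ¬ p ∣ D), ((lineCount l p * (p - 1) : ℕ) : ℝ) / (p : ℝ) ^ 2 =
      ∑ p ∈ Q.filter (fun p => ¬ p ∣ D), (lineCount l p : ℝ) / p -
      ∑ p ∈ Q.filter (fun p => ¬ p ∣ D), (lineCount l p : ℝ) / (p : ℝ) ^ 2 := by
    rw [← Finset.sum_sub_distrib]
    refine Finset.sum_congr rfl fun p hp => ?_
    have hp' := hQp p (Finset.mem_filter.1 hp).1
    have : (p : ℝ) ≠ 0 := by exact_mod_cast hp'.ne_zero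
    rw [Nat.cast_mul, Nat.cast_sub hp'.one_lt.le]
    push_cast
    field_simp
  have e2 : ∑ p ∈ Q.filter (fun p => ¬ p ∣ D), (lineCount l p : ℝ) / (p : ℝ) ^ 2 ≤
      (l + 2) * C3 := by
    have h := hC3 2 Q hQp
    simp only [pow_zero, Finset.Icc_self, Finset.sum_singleton] at h
    calc _ ≤ ∑ p ∈ Q, (lineCount l p : ℝ) / (p : ℝ) ^ 2 :=
          Finset.sum_le_sum_of_subset_of_nonneg (Finset.filter_subset _ _)
            fun p _ _ => by positivity
      _ ≤ ∑ p ∈ Q, (l + 2) * (1 / (p : ℝ) ^ 2) := by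
          refine Finset.sum_le_sum fun p _ => ?_
          rw [mul_one_div]
          have := lineCount_le l p
          gcongr
      _ = (l + 2) * ∑ p ∈ Q, (1 / (p : ℝ) ^ 2) := by rw [Finset.mul_sum]
      _ ≤ _ := by gcongr
  have e3 : ∑ p ∈ Q.filter (fun p => ¬ ¬ p ∣ D), (lineCount l p : ℝ) / p ≤
      (l + 2) * ∑ p ∈ D.primeFactors, 1 / (p : ℝ) := by
    rw [Finset.mul_sum]
    refine Finset.sum_le_sum_of_injOn' id ?_ Function.injective_id.injOn ?_
      fun p _ => by positivity
    · intro p hp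
      rw [Finset.mem_filter, not_not] at hp
      exact Nat.mem_primeFactors.2 ⟨hQp p hp.1, hp.2, hD⟩
    · intro p _
      rw [id, mul_one_div]
      have := lineCount_le l p
      gcongr
  have e4 := Finset.sum_filter_add_sum_filter_not Q (fun p => ¬ p ∣ D)
    (fun p => (lineCount l p : ℝ) / p)
  have e5 : ∑ p ∈ Q, (lineCount l p : ℝ) / p = l * ∑ p ∈ Q, 1 / (p : ℝ) +
      2 * ∑ p ∈ (Finset.Icc 1 z).filter (fun p => p.Prime ∧ p % 4 = 1), 1 / (p : ℝ) := by
    rw [← Finset.filter_filter, ← hQ, Finset.mul_sum, Finset.mul_sum,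
      Finset.sum_filter (s := Q) (p := fun p => p % 4 = 1), ← Finset.sum_add_distrib]
    refine Finset.sum_congr rfl fun p _ => ?_
    unfold lineCount
    split_ifs <;> push_cast <;> ring
  have h1 := mul_le_mul_of_nonneg_left (hC1 z (by omega)) (Nat.cast_nonneg (α := ℝ) l)
  have h2 := hC2 z hz
  rw [e1]
  linarith

theorem local_density_upper (l : ℕ) {z : ℕ} {t : ℝ} (ht : 2 ≤ t)
    (hz : (z : ℝ) ≤ Real.exp (Real.exp t)) (D : ℕ) :
    ∑ p ∈ ((Finset.Icc 1 z).filter Nat.Prime).filter (fun p => ¬ p ∣ D),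
        ((lineCount l p * (p - 1) : ℕ) : ℝ) / (p : ℝ) ^ 2 ≤ (l + 2) * (3 * t + 3) := by
  set Q := ((Finset.Icc 1 z).filter Nat.Prime).filter (fun p => ¬ p ∣ D)
  have hexp := Real.add_one_le_exp t
  have hH3 : 3 ≤ Real.exp (Real.exp t) := by
    have := Real.add_one_le_exp (Real.exp t); linarith
  have hQ : ∀ p ∈ Q, p.Prime ∧ (p : ℝ) ≤ Real.exp (Real.exp t) := by
    intro p hp
    obtain ⟨hp, -⟩ := Finset.mem_filter.1 hp
    obtain ⟨hp, hpp⟩ := Finset.mem_filter.1 hp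
    exact ⟨hpp, (Nat.cast_le.2 (Finset.mem_Icc.1 hp).2).trans hz⟩
  have h := sum_prime_one_div_le hH3 hQ
  rw [Real.log_exp, Real.log_exp] at h
  calc _ ≤ ∑ p ∈ Q, (l + 2) * (1 / (p : ℝ)) := by
        refine Finset.sum_le_sum fun p hp => ?_
        have hp0 : (0 : ℝ) < p := by exact_mod_cast (hQ p hp).1.pos
        rw [mul_one_div, div_le_div_iff₀ (by positivity) hp0, Nat.cast_mul]
        have h1 := lineCount_le l p
        have h2 : ((p - 1 : ℕ) : ℝ) ≤ p := by exact_mod_cast Nat.sub_le p 1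
        have h3 : (lineCount l p : ℝ) * ((p - 1 : ℕ) : ℝ) ≤ (l + 2) * p := by gcongr
        calc _ ≤ (l + 2) * (p : ℝ) * p := by gcongr
          _ = _ := by ring
    _ = (l + 2) * ∑ p ∈ Q, 1 / (p : ℝ) := by rw [Finset.mul_sum]
    _ ≤ _ := by gcongr

/-- In terms of Y = e^t/t², the left side is exp(O(Y/t)) while M ≥ exp(Y/4), so the remainder of the
sieve has plenty of room. -/
theorem sieve_error_le {l r : ℕ} {t z M : ℝ} (hz0 : 0 ≤ z) (ht1 : 1 ≤ t)
    (ht2 : 132 * 16 * ((l : ℝ) + 2) ≤ t) (ht3 : 400 * ((l : ℝ) + 2) ≤ t)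
    (hz : z ≤ Real.exp (Real.exp t / t ^ 4)) (hr : (r : ℝ) ≤ 44 * (l + 2) * t)
    (hM : Real.exp (Real.exp t / (4 * t ^ 2)) ≤ M) :
    3 * z ^ (3 * r) ≤ M * Real.exp (-((l + 1) * t)) := by
  have ht0 : 0 < t := by linarith
  have hl0 : (0 : ℝ) ≤ l := Nat.cast_nonneg l
  set Y := Real.exp t / t ^ 2 with hY
  have hY0 : 0 < Y := by positivity
  have e4 : Real.exp t / t ^ 4 = Y / t ^ 2 := by rw [hY]; field_simp
  have e2 : Real.exp t / (4 * t ^ 2) = Y / 4 := by rw [hY]; field_simp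
  rw [e4] at hz
  rw [e2] at hM
  have h1 : z ^ (3 * r) ≤ Real.exp (132 * (l + 2) * (Y / t)) := by
    calc z ^ (3 * r) ≤ (Real.exp (Y / t ^ 2)) ^ (3 * r) := pow_le_pow_left₀ hz0 hz _
      _ = Real.exp ((3 * r : ℕ) * (Y / t ^ 2)) := by rw [Real.exp_nat_mul]
      _ ≤ _ := by
        refine Real.exp_le_exp.2 ?_
        have h2 : ((3 * r : ℕ) : ℝ) ≤ 132 * (l + 2) * t := by
          push_cast
          linarith
        calc _ ≤ 132 * (l + 2) * t * (Y / t ^ 2) :=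
              mul_le_mul_of_nonneg_right h2 (by positivity)
          _ = 132 * (l + 2) * (Y / t) := by
              generalize (l : ℝ) = a
              field_simp
  have h3 : (3 : ℝ) ≤ Real.exp 2 := by
    have := Real.add_one_le_exp (2 : ℝ); linarith
  have hY1 : t ^ 2 ≤ 24 * Y := by
    have h := pow_le_exp_mul ht0.le 4
    have e : ((4 : ℕ).factorial : ℝ) = 24 := by norm_num [Nat.factorial]
    rw [e] at h
    rw [hY, ← mul_div_assoc, le_div_iff₀ (by positivity)]
    calc t ^ 2 * t ^ 2 = t ^ 4 := by ring
      _ ≤ _ := h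
  have h5 : 132 * (l + 2) * (Y / t) ≤ Y / 16 := by
    rw [mul_div_assoc', div_le_div_iff₀ ht0 (by norm_num)]
    have := mul_le_mul_of_nonneg_right ht2 hY0.le
    linarith
  have h6 : 2 + (l + 1) * t ≤ Y / 16 := by
    have h7 : 400 * ((l : ℝ) + 2) * t ≤ t ^ 2 := by
      rw [sq]; exact mul_le_mul_of_nonneg_right ht3 ht0.le
    have h8 : 0 ≤ (l : ℝ) * t := by positivity
    linarith
  calc 3 * z ^ (3 * r) ≤ Real.exp 2 * Real.exp (132 * (l + 2) * (Y / t)) :=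
        mul_le_mul h3 h1 (pow_nonneg hz0 _) (Real.exp_pos _).le
    _ = Real.exp (2 + 132 * (l + 2) * (Y / t)) := by rw [Real.exp_add]
    _ ≤ Real.exp (Y / 4 + -((l + 1) * t)) := Real.exp_le_exp.2 (by linarith)
    _ = Real.exp (Y / 4) * Real.exp (-((l + 1) * t)) := Real.exp_add _ _
    _ ≤ M * Real.exp (-((l + 1) * t)) := mul_le_mul_of_nonneg_right hM (Real.exp_pos _).le

/-- The sieve bound for lattice points at which a norm form and `l` linear forms have no small
prime factor. -/
theorem exists_sieve_bound (l : ℕ) :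
    ∃ (A : ℕ) (C t₀ : ℝ), 0 ≤ C ∧ ∀ t : ℝ, t₀ ≤ t → ∀ (m N : ℕ) (α β : Fin l → ℤ), 1 ≤ m →
      (m : ℝ) ≤ Real.exp (Real.exp t) → (∀ j, α j ^ 2 + β j ^ 2 = m) →
      (∀ i j, i ≠ j → α i * β j - β i * α j ≠ 0) →
      Real.exp (Real.exp t / (4 * t ^ 2)) ≤ N →
      ∀ B : Finset (ℤ × ℤ), B ⊆ (Finset.Icc (-(N : ℤ)) N) ×ˢ (Finset.Icc (-(N : ℤ)) N) →
      (∀ w ∈ B, ∀ p : ℕ, p.Prime → p ≤ sieveLevel t → ¬ (p : ℤ) ∣ w.1 ^ 2 + w.2 ^ 2 ∧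
        ∀ j, ¬ (p : ℤ) ∣ α j * w.1 + β j * w.2) →
      (B.card : ℝ) ≤ C * (N : ℝ) ^ 2 * t ^ A * Real.exp (-((l + 1) * t)) := by
  classical
  obtain ⟨C0, hC0⟩ := exists_local_density_lower l
  -- The first part pays for the loss of 4 log t in log log z, the second for the primes dividing
  -- the discriminant.
  set A := 4 * (l + 1) + 3 * (l + 2) with hA
  set C1 : ℝ := Real.exp ((l + 1) + 8 * (l + 2) + C0) with hC1
  refine ⟨A, 9 * (C1 + 2), 240 + 2 * (1 + (l : ℝ) ^ 2) + 132 * 16 * (l + 2) + 400 * (l + 2),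
    by positivity, fun t ht m N α β hm0 hmt hm hdet hN B hBbox hB => ?_⟩
  have hl0 : (0 : ℝ) ≤ l := Nat.cast_nonneg l
  have hlsq : (0 : ℝ) ≤ (l : ℝ) ^ 2 := by positivity
  have ht240 : 240 ≤ t := by linarith
  have ht0 : 0 < t := by linarith
  have hlt : ((l : ℝ) + 2) * 2 ≤ (l + 2) * t := by gcongr; linarith
  obtain ⟨hz4, hzlog, hzle⟩ := sieveLevel_bounds ht240
  set z := sieveLevel t with hz
  set D := formDisc α β m with hD
  have hD0 : D ≠ 0 := formDisc_ne_zero (by omega) hdet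
  set P := ((Finset.Icc 1 z).filter Nat.Prime).filter (fun p => ¬ p ∣ D) with hP
  have hPp : ∀ p ∈ P, p.Prime ∧ p ≤ z ∧ ¬ p ∣ D := by
    intro p hp
    obtain ⟨hp, hpD⟩ := Finset.mem_filter.1 hp
    obtain ⟨hp, hpp⟩ := Finset.mem_filter.1 hp
    exact ⟨hpp, (Finset.mem_Icc.1 hp).2, hpD⟩
  have hex : ∀ p : ℕ, ∃ Ω : Finset (ZMod p × ZMod p), p ∈ P →
      (Ω.card = lineCount l p * (p - 1) ∧
      ∀ u v : ℤ, ((u : ZMod p), (v : ZMod p)) ∈ Ω →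
        (p : ℤ) ∣ u ^ 2 + v ^ 2 ∨ ∃ j, (p : ℤ) ∣ α j * u + β j * v) := by
    intro p
    by_cases hp : p ∈ P
    · obtain ⟨Ω, h⟩ := exists_local_set_of_not_dvd (hPp p hp).1 hm (hPp p hp).2.2
      exact ⟨Ω, fun _ => h⟩
    · exact ⟨∅, fun h => absurd h hp⟩
  choose Ω hΩ using hex
  -- The truncation r is even, as Bonferroni requires, and r ≥ 20(l + 2)(t + 1) exceeds 3δ + (l +
  -- 1)t because δ ≤ 3(l + 2)(t + 1).
  set R : ℝ := 10 * (l + 2) * (t + 1) with hR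
  set r : ℕ := 2 * ⌈R⌉₊ with hr
  have hR0 : 0 ≤ R := by positivity
  have hr1 : 2 * R ≤ r := by rw [hr]; push_cast; linarith [Nat.le_ceil R]
  have hr2 : (r : ℝ) ≤ 2 * R + 2 := by rw [hr]; push_cast; linarith [Nat.ceil_lt_add_one hR0]
  have hbrun := brun_sieve P (fun p hp => (hPp p hp).1) z (by omega) (fun p hp => (hPp p hp).2.1)
    Ω N r (even_two_mul _)
  have hsub : (B.card : ℝ) ≤
      ((((Finset.Icc (-(N : ℤ)) N) ×ˢ (Finset.Icc (-(N : ℤ)) N)).filter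
      (fun w : ℤ × ℤ => ∀ p ∈ P, ((w.1 : ZMod p), (w.2 : ZMod p)) ∉ Ω p)).card : ℝ) := by
    refine Nat.cast_le.2 (Finset.card_le_card fun w hw => ?_)
    rw [Finset.mem_filter]
    refine ⟨hBbox hw, fun p hp hmem => ?_⟩
    have h1 := hB w hw p (hPp p hp).1 (hPp p hp).2.1
    rcases (hΩ p hp).2 _ _ hmem with h | ⟨j, h⟩
    · exact h1.1 h
    · exact h1.2 j h
  have hδ : ∑ p ∈ P, ((Ω p).card : ℝ) / (p : ℝ) ^ 2 =
      ∑ p ∈ P, ((lineCount l p * (p - 1) : ℕ) : ℝ) / (p : ℝ) ^ 2 :=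
    Finset.sum_congr rfl fun p hp => by rw [(hΩ p hp).1]
  rw [hδ] at hbrun
  set δ := ∑ p ∈ P, ((lineCount l p * (p - 1) : ℕ) : ℝ) / (p : ℝ) ^ 2 with hδdef
  have hlow : (l + 1) * t - (A : ℝ) * Real.log t - ((l + 1) + 8 * (l + 2) + C0) ≤ δ := by
    have h1 := hC0 D z hD0 hz4
    have h2 := sum_primeFactors_formDisc_le hm0 hm hdet (by linarith) hmt
    have h3 := mul_le_mul_of_nonneg_left h2 (by positivity : (0 : ℝ) ≤ l + 2)
    have h4 := mul_le_mul_of_nonneg_left hzlog (by positivity : (0 : ℝ) ≤ l + 1)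
    have hAc : (A : ℝ) = 4 * (l + 1) + 3 * (l + 2) := by rw [hA]; push_cast; ring
    rw [hAc]
    linarith
  have hupp : δ ≤ (l + 2) * (3 * t + 3) := by
    refine local_density_upper l (by linarith) (hzle.trans (Real.exp_le_exp.2 ?_)) D
    exact div_le_self (Real.exp_pos t).le (one_le_pow₀ (by linarith))
  have hE1 : Real.exp (-δ) ≤ C1 * t ^ A * Real.exp (-((l + 1) * t)) := by
    have : t ^ A = Real.exp (A * Real.log t) := by
      rw [Real.exp_nat_mul, Real.exp_log ht0]
    rw [this, hC1, ← Real.exp_add, ← Real.exp_add]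
    exact Real.exp_le_exp.2 (by linarith)
  have hE2 : Real.exp (-r + 3 * δ) ≤ Real.exp (-((l + 1) * t)) := by
    refine Real.exp_le_exp.2 ?_
    rw [hR] at hr1
    linarith
  have hN1 : (1 : ℝ) ≤ N := by
    refine le_trans ?_ hN
    exact Real.one_le_exp (by positivity)
  set M : ℝ := 2 * N + 1 with hM
  have hMN : M ^ 2 ≤ 9 * (N : ℝ) ^ 2 := by rw [hM]; nlinarith
  have hM0 : 0 < M := by positivity
  have htA : 1 ≤ t ^ A := one_le_pow₀ (by linarith)
  have hE3 : 3 * M * (z : ℝ) ^ (3 * r) ≤ M ^ 2 * Real.exp (-((l + 1) * t)) := by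
    have h2 : 3 * (z : ℝ) ^ (3 * r) ≤ M * Real.exp (-((l + 1) * t)) := by
      refine sieve_error_le (Nat.cast_nonneg z) (by linarith) (by linarith) (by linarith) hzle ?_
        (hN.trans (by linarith))
      rw [hR] at hr2
      linarith
    calc _ = M * (3 * (z : ℝ) ^ (3 * r)) := by ring
      _ ≤ M * (M * Real.exp (-((l + 1) * t))) := by gcongr
      _ = _ := by ring
  set E := Real.exp (-((l + 1) * t)) with hE
  have hE0 : 0 < E := Real.exp_pos _
  have hC10 : 0 < C1 := Real.exp_pos _
  have hEA : E ≤ t ^ A * E := le_mul_of_one_le_left hE0.le htA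
  calc _ ≤ _ := hsub
    _ ≤ _ := hbrun
    _ ≤ M ^ 2 * (C1 * t ^ A * E + E) + M ^ 2 * E := by gcongr
    _ ≤ M ^ 2 * (C1 * (t ^ A * E) + t ^ A * E) + M ^ 2 * (t ^ A * E) := by
        rw [mul_assoc C1]; gcongr
    _ = M ^ 2 * ((C1 + 2) * (t ^ A * E)) := by ring
    _ ≤ 9 * (N : ℝ) ^ 2 * ((C1 + 2) * (t ^ A * E)) := by gcongr
    _ = _ := by ring

/-! ### From representations to lattice points -/

/-- The representations of `n` that `r1 n` counts. -/
noncomputable def primeReps (n : ℕ) : Finset (ℕ × ℕ) := (r1_set_finite n).toFinset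

theorem mem_primeReps {n : ℕ} {q : ℕ × ℕ} :
    q ∈ primeReps n ↔ q.2.Prime ∧ q.1 ^ 2 + q.2 ^ 2 = n := by
  simp [primeReps]

theorem card_primeReps (n : ℕ) : (primeReps n).card = r1 n := by
  rw [primeReps, r1, Set.ncard_eq_toFinset_card _ (r1_set_finite n)]

theorem norm_of_mem_primeReps {n : ℕ} {q : ℕ × ℕ} (hq : q ∈ primeReps n) :
    (⟨q.1, q.2⟩ : GaussianInt).norm = n := by
  rw [GaussianInt.norm_mk, ← (mem_primeReps.1 hq).2]; push_cast; rfl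

theorem r1_le_normCount (n : ℕ) : r1 n ≤ normCount n := by
  rw [← card_primeReps]
  refine Finset.card_le_card_of_injOn (fun q => ⟨q.1, q.2⟩) ?_ ?_
  · intro q hq
    rw [Finset.mem_coe, mem_normSet]
    exact norm_of_mem_primeReps hq
  · rintro ⟨a, p⟩ _ ⟨a', p'⟩ _ h
    simpa [Zsqrtd.ext_iff] using h

open Classical in
/-- The injective `l`-tuples of representations of `n`. -/
noncomputable def repTuples (l n : ℕ) : Finset (Fin l → ℕ × ℕ) :=
  (Fintype.piFinset fun _ => primeReps n).filter Function.Injective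

/-- Every l-element set of representations is the image of some injective tuple; the l! orderings
are not exploited. -/
theorem choose_r1_le_card_repTuples (l n : ℕ) : (r1 n).choose l ≤ (repTuples l n).card := by
  classical
  rw [← card_primeReps, ← Finset.card_powersetCard]
  have : (primeReps n).powersetCard l ⊆ (repTuples l n).image fun f => Finset.univ.image f := by
    intro s hs
    rw [Finset.mem_powersetCard] at hs
    set e := (Finset.equivFinOfCardEq hs.2).symm
    refine Finset.mem_image.2 ⟨fun j => (e j : ℕ × ℕ), ?_, ?_⟩
    · rw [repTuples, Finset.mem_filter, Fintype.mem_piFinset]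
      exact ⟨fun j => hs.1 (e j).2, Subtype.val_injective.comp e.injective⟩
    · ext q
      simp only [Finset.mem_image, Finset.mem_univ, true_and]
      constructor
      · rintro ⟨j, rfl⟩; exact (e j).2
      · intro hq; exact ⟨e.symm ⟨q, hq⟩, by simp⟩
  exact (Finset.card_le_card this).trans Finset.card_image_le

/-- `z` or its conjugate. -/
def conjIf (b : Bool) (z : GaussianInt) : GaussianInt := if b then star z else z

/-- The representation attached to a Gaussian integer. -/
def absPair (z : GaussianInt) : ℕ × ℕ := (z.re.natAbs, z.im.natAbs)

/-- The tuple obtained by multiplying a Gaussian integer or its conjugate into `w`. -/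
def twistTuple {l : ℕ} (w : Fin l → GaussianInt) (ε : Fin l → Bool) (u : ℤ × ℤ) (j : Fin l) :
    ℕ × ℕ :=
  absPair (w j * conjIf (ε j) ⟨u.1, u.2⟩)

/-- The prime of a representation is, up to sign, an imaginary part, hence a linear form in u with
coefficients read off from w: this is what gets sieved. -/
theorem im_mul_conjIf (w : GaussianInt) (b : Bool) (u : ℤ × ℤ) :
    (w * conjIf b ⟨u.1, u.2⟩).im = w.im * u.1 + (if b then -w.re else w.re) * u.2 := by
  cases b <;> simp [conjIf, Zsqrtd.im_mul] <;> ring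

theorem norm_mul_conjIf (w : GaussianInt) (b : Bool) (u : ℤ × ℤ) :
    (w * conjIf b ⟨u.1, u.2⟩).norm = w.norm * (u.1 ^ 2 + u.2 ^ 2) := by
  rw [Zsqrtd.norm_mul]
  cases b
  · simp [conjIf, GaussianInt.norm_mk]
  · simp [conjIf, GaussianInt.norm_mk]

theorem absPair_eq_of_norm_eq {z z' : GaussianInt} (h : z.norm = z'.norm)
    (him : z.im.natAbs = z'.im.natAbs) : absPair z = absPair z' := by
  rw [Zsqrtd.norm_def, Zsqrtd.norm_def] at h
  have h1 : z.im ^ 2 = z'.im ^ 2 := Int.natAbs_eq_iff_sq_eq.1 him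
  have h2 : z.re.natAbs = z'.re.natAbs := Int.natAbs_eq_iff_sq_eq.2 (by nlinarith)
  simp [absPair, h2, him]

/-- Two vectors of equal length with zero determinant agree up to sign. -/
theorem eq_or_eq_neg_of_det_eq_zero {a b c d m : ℤ} (h1 : a ^ 2 + b ^ 2 = m)
    (h2 : c ^ 2 + d ^ 2 = m) (h : a * d - b * c = 0) : (a = c ∧ b = d) ∨ (a = -c ∧ b = -d) := by
  -- By Lagrange's identity (ac + bd)² + (ad − bc)² = m², so the inner product is ±m, the equality
  -- case of Cauchy–Schwarz.
  have h3 : (a * c + b * d - m) * (a * c + b * d + m) = 0 := by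
    subst h1
    linear_combination (a ^ 2 + b ^ 2) * h2 - (a * d - b * c) * h
  rcases mul_eq_zero.1 h3 with h4 | h4
  · left
    have h5 : (a - c) ^ 2 + (b - d) ^ 2 = 0 := by linear_combination h1 + h2 - 2 * h4
    constructor <;> nlinarith [sq_nonneg (a - c), sq_nonneg (b - d)]
  · right
    have h5 : (a + c) ^ 2 + (b + d) ^ 2 = 0 := by linear_combination h1 + h2 + 2 * h4
    constructor <;> nlinarith [sq_nonneg (a + c), sq_nonneg (b + d)]

open Classical in
/-- The lattice points `u` in a square of side `2N` of prime norm whose twists by `w` yield distinct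
representations with large prime part. -/
noncomputable def goodPoints {l : ℕ} (z N : ℕ) (w : Fin l → GaussianInt) (ε : Fin l → Bool) :
    Finset (ℤ × ℤ) :=
  ((Finset.Icc (-(N : ℤ)) N) ×ˢ (Finset.Icc (-(N : ℤ)) N)).filter fun u =>
    (u.1 ^ 2 + u.2 ^ 2).natAbs.Prime ∧ z < (u.1 ^ 2 + u.2 ^ 2).natAbs ∧
    (∀ j, (twistTuple w ε u j).2.Prime ∧ z < (twistTuple w ε u j).2) ∧
    Function.Injective (twistTuple w ε u)

/-- If two of the forms had zero determinant they would agree up to sign, and equal norms would make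
the two twisted representations coincide, against injectivity. One good point thus yields the
nonzero determinants. Primes beyond the sieve level have no prime factor up to it. -/
theorem exists_card_goodPoints_le (l : ℕ) :
    ∃ (A : ℕ) (C t₀ : ℝ), 0 ≤ C ∧ ∀ t : ℝ, t₀ ≤ t → ∀ (m N : ℕ), 1 ≤ m →
      (m : ℝ) ≤ Real.exp (Real.exp t) → Real.exp (Real.exp t / (4 * t ^ 2)) ≤ N →
      ∀ (w : Fin l → GaussianInt) (ε : Fin l → Bool), (∀ j, (w j).norm = m) →
      ((goodPoints (sieveLevel t) N w ε).card : ℝ) ≤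
      C * (N : ℝ) ^ 2 * t ^ A * Real.exp (-((l + 1) * t)) := by
  obtain ⟨A, C, t₀, hC, h⟩ := exists_sieve_bound l
  refine ⟨A, C, max t₀ 0, hC, fun t ht m N hm hmt hN w ε hw => ?_⟩
  have ht0 : 0 ≤ t := (le_max_right _ _).trans ht
  rcases (goodPoints (sieveLevel t) N w ε).eq_empty_or_nonempty with he | ⟨u, hu⟩
  · rw [he]; simp only [Finset.card_empty, Nat.cast_zero]; positivity
  have hform : ∀ j, (w j).im ^ 2 + (if ε j then -(w j).re else (w j).re) ^ 2 = m := by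
    intro j
    have := hw j
    rw [Zsqrtd.norm_def] at this
    split_ifs <;> linarith
  refine h t ((le_max_left _ _).trans ht) m N (fun j => (w j).im)
    (fun j => if ε j then -(w j).re else (w j).re) hm hmt hform ?_ hN _
    (Finset.filter_subset _ _) ?_
  · intro i j hij hdet
    have hinj := (Finset.mem_filter.1 hu).2.2.2.2
    refine hij (hinj (absPair_eq_of_norm_eq ?_ ?_))
    · rw [norm_mul_conjIf, norm_mul_conjIf, hw, hw]
    · rw [im_mul_conjIf, im_mul_conjIf]
      rcases eq_or_eq_neg_of_det_eq_zero (hform i) (hform j) hdet with ⟨h1, h2⟩ | ⟨h1, h2⟩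
      · rw [h1, h2]
      · rw [h1, h2, ← Int.natAbs_neg]; congr 1; ring
  · intro u hu p hp hpz
    obtain ⟨-, h1, h2, h3, -⟩ := Finset.mem_filter.1 hu
    refine ⟨fun hd => ?_, fun j hd => ?_⟩
    · have := (Nat.prime_dvd_prime_iff_eq hp h1).1 (Int.natCast_dvd.1 hd)
      omega
    · obtain ⟨h4, h5⟩ := h3 j
      change (w j * conjIf (ε j) ⟨u.1, u.2⟩).im.natAbs.Prime at h4
      change sieveLevel t < (w j * conjIf (ε j) ⟨u.1, u.2⟩).im.natAbs at h5
      rw [im_mul_conjIf] at h4 h5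
      have := (Nat.prime_dvd_prime_iff_eq hp h4).1 (Int.natCast_dvd.1 hd)
      omega

/-- `n` has a prime factor beyond `y` of multiplicity one, and all its representations have their
prime part beyond `z`. -/
def IsTypical (y : ℝ) (z n : ℕ) : Prop :=
  (∃ q : ℕ, q.Prime ∧ y < q ∧ q ∣ n ∧ ¬ q ^ 2 ∣ n) ∧ ∀ f ∈ primeReps n, z < f.2

/-- The large prime q splits as a norm Nπ, and unique factorization extracts π or its conjugate from
every representation at once. The lattice point u is π itself, inside the box since q ≤ X/m. -/
theorem exists_twist_of_isTypical {l z n X : ℕ} {y : ℝ} (hl : 1 ≤ l) (hy : (z : ℝ) ≤ y)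
    (hz : 2 ≤ z) (hn : n ∈ Finset.Icc 1 X) (h : IsTypical y z n) {f : Fin l → ℕ × ℕ}
    (hf : f ∈ repTuples l n) :
    ∃ m ∈ Finset.Icc 1 X, omegaStar n = omegaStar m + 1 ∧ y < (X / m : ℕ) ∧
      ∃ w ∈ Fintype.piFinset (fun _ : Fin l => normSet m), ∃ ε : Fin l → Bool,
        ∃ u ∈ goodPoints z (Nat.sqrt (X / m)) w ε,
          (m * (u.1 ^ 2 + u.2 ^ 2).natAbs, twistTuple w ε u) = (n, f) := by
  obtain ⟨⟨q, hq, hyq, ⟨m, rfl⟩, hq2⟩, htyp⟩ := h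
  rw [Finset.mem_Icc] at hn
  rw [repTuples, Finset.mem_filter, Fintype.mem_piFinset] at hf
  obtain ⟨hf, hinj⟩ := hf
  have hqm : ¬ q ∣ m := fun h => hq2 (by rw [sq]; exact Nat.mul_dvd_mul_left q h)
  have hzq : z < q := by exact_mod_cast hy.trans_lt hyq
  have hodd : Odd q := hq.odd_of_ne_two (by omega)
  have hm1 : 1 ≤ m := Nat.one_le_iff_ne_zero.2 (by rintro rfl; simp at hn)
  have hqX : q ≤ X / m := by rw [Nat.le_div_iff_mul_le hm1]; exact hn.2
  have hnorm : ∀ j, (⟨(f j).1, (f j).2⟩ : GaussianInt).norm = (q * m : ℕ) := fun j =>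
    norm_of_mem_primeReps (hf j)
  -- An inert q would divide some representation as a Gaussian integer, so q² would divide n. A
  -- representation exists because l ≥ 1.
  have hq4 : q % 4 ≠ 3 := by
    intro h3
    obtain ⟨w, -, hw⟩ := GaussianInt.exists_eq_natCast_mul_of_norm hq h3 (hnorm ⟨0, hl⟩)
    rw [hnorm] at hw
    exact hq2 (Int.natCast_dvd_natCast.1 ⟨w.norm, by rw [hw]; push_cast; ring⟩)
  obtain ⟨π, hπ⟩ := GaussianInt.exists_norm_eq_prime hq hq4
  choose w hw hw' using fun j => GaussianInt.exists_eq_mul_of_norm hq hπ (hnorm j)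
  classical
  set ε : Fin l → Bool := fun j =>
    decide (¬ (⟨(f j).1, (f j).2⟩ : GaussianInt) = w j * π) with hε
  have htw : ∀ j, w j * conjIf (ε j) ⟨π.re, π.im⟩ = ⟨(f j).1, (f j).2⟩ := by
    intro j
    have hπ' : (⟨π.re, π.im⟩ : GaussianInt) = π := rfl
    rw [hπ']
    by_cases hj : (⟨(f j).1, (f j).2⟩ : GaussianInt) = w j * π
    · simp [hε, conjIf, hj]
    · simp only [hε, conjIf, hj, not_false_eq_true, decide_true, if_true]
      exact ((hw' j).resolve_left hj).symm
  have htuple : twistTuple w ε (π.re, π.im) = f := by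
    funext j
    rw [twistTuple, htw]
    simp [absPair]
  have hπq : π.re ^ 2 + π.im ^ 2 = q := by rw [← hπ, Zsqrtd.norm_def]; ring
  have hsq : ∀ a : ℤ, a ^ 2 ≤ q → a ∈ Finset.Icc (-(Nat.sqrt (X / m) : ℤ)) (Nat.sqrt (X / m)) := by
    intro a ha
    have h1 : a.natAbs ≤ Nat.sqrt (X / m) := by
      rw [Nat.le_sqrt']
      zify at hqX ⊢
      rw [sq_abs]
      exact ha.trans hqX
    rw [Finset.mem_Icc]; omega
  refine ⟨m, Finset.mem_Icc.2 ⟨hm1, (Nat.le_mul_of_pos_left m hq.pos).trans hn.2⟩, ?_, ?_, w,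
    Fintype.mem_piFinset.2 fun j => mem_normSet.2 (hw j), ε, (π.re, π.im), ?_, ?_⟩
  · have := omegaStar_mul hq hodd le_rfl hqm
    rwa [pow_one] at this
  · exact hyq.trans_le (by exact_mod_cast hqX)
  · rw [goodPoints, Finset.mem_filter]
    refine ⟨Finset.mem_product.2 ⟨hsq _ (by linarith [sq_nonneg π.im]),
      hsq _ (by linarith [sq_nonneg π.re])⟩, ?_⟩
    simp only [hπq, htuple, Int.natAbs_natCast]
    exact ⟨hq, hzq, fun j => ⟨(mem_primeReps.1 (hf j)).1, htyp _ (hf j)⟩, hinj⟩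
  · simp only [hπq, htuple, Int.natAbs_natCast, mul_comm]

open Classical in
-- The data (m, w, ε, u) determine the pair (n, f), so the pairs are covered by a union of images.
-- No uniqueness of the data is needed.
theorem sum_choose_r1_typical_le {l X z : ℕ} {y : ℝ} (hl : 1 ≤ l) (hy : (z : ℝ) ≤ y) (hz : 2 ≤ z)
    (j : ℕ) :
    ∑ n ∈ (Finset.Icc 1 X).filter (fun n => omegaStar n = j + 1 ∧ IsTypical y z n),
      (r1 n).choose l ≤
    ∑ m ∈ (Finset.Icc 1 X).filter (fun m => omegaStar m = j ∧ y < (X / m : ℕ)),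
      ∑ w ∈ Fintype.piFinset (fun _ : Fin l => normSet m), ∑ ε : Fin l → Bool,
        (goodPoints z (Nat.sqrt (X / m)) w ε).card := by
  set G := (Finset.Icc 1 X).filter (fun n => omegaStar n = j + 1 ∧ IsTypical y z n)
  set Q := (Finset.Icc 1 X).filter (fun m => omegaStar m = j ∧ y < (X / m : ℕ)) with hQ
  set U : Finset (ℕ × (Fin l → ℕ × ℕ)) := Q.biUnion fun m =>
    (Fintype.piFinset (fun _ : Fin l => normSet m)).biUnion fun w =>
      Finset.univ.biUnion fun ε : Fin l → Bool =>
        (goodPoints z (Nat.sqrt (X / m)) w ε).image fun u =>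
          (m * (u.1 ^ 2 + u.2 ^ 2).natAbs, twistTuple w ε u) with hU
  have h1 : ∑ n ∈ G, (r1 n).choose l ≤ U.card := by
    calc ∑ n ∈ G, (r1 n).choose l ≤ ∑ n ∈ G, (repTuples l n).card :=
          Finset.sum_le_sum fun n _ => choose_r1_le_card_repTuples l n
      _ = (G.sigma (repTuples l)).card := (Finset.card_sigma _ _).symm
      _ ≤ U.card := by
        refine Finset.card_le_card_of_injOn (fun q => (q.1, q.2)) ?_ ?_
        · rintro ⟨n, f⟩ hq
          rw [Finset.mem_coe, Finset.mem_sigma] at hq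
          obtain ⟨hn, hf⟩ := hq
          obtain ⟨hn, ho, ht⟩ := Finset.mem_filter.1 hn
          obtain ⟨m, hm, hom, hym, w, hw, ε, u, hu, he⟩ :=
            exists_twist_of_isTypical hl hy hz hn ht hf
          simp only [hU, hQ, Finset.coe_biUnion, Set.mem_iUnion, Finset.mem_coe,
            Finset.mem_filter, Finset.mem_image, Finset.mem_univ]
          exact ⟨m, ⟨hm, by omega, hym⟩, w, hw, ε, trivial, u, hu, he⟩
        · rintro ⟨n, f⟩ _ ⟨n', f'⟩ _ h
          simp only [Prod.mk.injEq] at h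
          rw [h.1, h.2]
  refine h1.trans (Finset.card_biUnion_le.trans (Finset.sum_le_sum fun m _ => ?_))
  refine Finset.card_biUnion_le.trans (Finset.sum_le_sum fun w _ => ?_)
  exact Finset.card_biUnion_le.trans (Finset.sum_le_sum fun ε _ => Finset.card_image_le)

theorem sieveLevel_le_exp {t : ℝ} (ht : 1 ≤ t) :
    (sieveLevel t : ℝ) ≤ Real.exp (Real.exp t / t ^ 2) := by
  refine (Nat.floor_le (Real.exp_pos _).le).trans (Real.exp_le_exp.2 ?_)
  exact div_le_div_of_nonneg_left (Real.exp_pos t).le (by positivity)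
    (pow_le_pow_right₀ ht (by norm_num))

theorem exp_le_sqrt_of_lt {t : ℝ} (ht : 240 ≤ t) {a : ℕ} (ha : Real.exp (Real.exp t / t ^ 2) < a) :
    Real.exp (Real.exp t / (4 * t ^ 2)) ≤ Nat.sqrt a := by
  have ht0 : 0 < t := by linarith
  set Y := Real.exp t / t ^ 2 with hY
  have e1 : Real.exp t / (4 * t ^ 2) = Y / 4 := by rw [hY]; field_simp
  rw [e1]
  have hY4 : 4 ≤ Y := by
    rw [hY, le_div_iff₀ (by positivity)]
    have h := pow_le_exp_mul ht0.le 3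
    have e : ((3 : ℕ).factorial : ℝ) = 6 := by norm_num [Nat.factorial]
    rw [e] at h
    have : 240 * t ^ 2 ≤ t ^ 3 := by rw [pow_succ t 2, mul_comm]; gcongr
    linarith [sq_nonneg t]
  set E := Real.exp (Y / 4) with hE
  have hE2 : 2 ≤ E := by have := Real.add_one_le_exp (Y / 4); linarith
  have h1 : (a : ℝ) < (Nat.sqrt a + 1) ^ 2 := by
    have := Nat.lt_succ_sqrt' a
    exact_mod_cast this
  have h2 : Real.exp Y = (E ^ 2) ^ 2 := by
    rw [hE, ← pow_mul, ← Real.exp_nat_mul]; congr 1; push_cast; ring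
  have h3 : E ^ 2 ≤ Nat.sqrt a + 1 := by
    refine (pow_le_pow_iff_left₀ (by positivity) (by positivity) two_ne_zero).1 ?_
    rw [← h2]; linarith
  nlinarith

open Classical in
-- For given m there are `normCount m ^ l` tuples w and 2^l choices of conjugation, each with a
-- sieve bound proportional to x/m; the mean value of `normCount m ^ l / m` finishes.
theorem exists_sum_typical_le (l : ℕ) (hl : 1 ≤ l) :
    ∃ (A : ℕ) (C t₀ : ℝ), 0 ≤ C ∧ ∀ t : ℝ, t₀ ≤ t → ∀ j : ℕ,
      ((∑ n ∈ (Finset.Icc 1 ⌊Real.exp (Real.exp t)⌋₊).filter (fun n => omegaStar n = j + 1 ∧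
        IsTypical (Real.exp (Real.exp t / t ^ 2)) (sieveLevel t) n), (r1 n).choose l : ℕ) : ℝ) ≤
      C * (Real.exp (Real.exp t) * t ^ A * Real.exp (-((l + 1) * t))) *
        ((2 ^ (l - 1) * t + C) ^ j / (j.factorial : ℝ)) := by
  obtain ⟨A, C, t₀, hC, hgood⟩ := exists_card_goodPoints_le l
  obtain ⟨C', hC', hsum⟩ := exists_sum_normCount_pow_div_le l hl
  refine ⟨A, 2 ^ l * C * C' + C', max t₀ 240, by positivity, fun t ht j => ?_⟩
  have ht240 : 240 ≤ t := (le_max_right _ _).trans ht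
  have ht0 : 0 < t := by linarith
  set x := Real.exp (Real.exp t) with hx
  have hx0 : 0 < x := Real.exp_pos _
  set X := ⌊x⌋₊ with hX
  set z := sieveLevel t
  set y := Real.exp (Real.exp t / t ^ 2) with hy
  have hz4 : 4 ≤ z := (sieveLevel_bounds ht240).1
  set E := Real.exp (-((l + 1) * t)) with hE
  have h1 : ((∑ n ∈ (Finset.Icc 1 X).filter (fun n => omegaStar n = j + 1 ∧ IsTypical y z n),
      (r1 n).choose l : ℕ) : ℝ) ≤ _ := Nat.cast_le.2
    (sum_choose_r1_typical_le hl (sieveLevel_le_exp (by linarith)) (by omega) j)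
  refine h1.trans ?_
  push_cast
  have hterm : ∀ m ∈ (Finset.Icc 1 X).filter (fun m => omegaStar m = j ∧ y < (X / m : ℕ)),
      ∑ w ∈ Fintype.piFinset (fun _ : Fin l => normSet m), ∑ ε : Fin l → Bool,
        ((goodPoints z (Nat.sqrt (X / m)) w ε).card : ℝ) ≤
      2 ^ l * C * (x * t ^ A * E) * ((normCount m : ℝ) ^ l / m) := by
    intro m hm
    obtain ⟨hm, -, hym⟩ := Finset.mem_filter.1 hm
    rw [Finset.mem_Icc] at hm
    have hm0 : (0 : ℝ) < m := by exact_mod_cast hm.1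
    have hXx : (X : ℝ) ≤ x := Nat.floor_le hx0.le
    have hmx : (m : ℝ) ≤ x := (Nat.cast_le.2 hm.2).trans hXx
    set N := Nat.sqrt (X / m) with hN
    have hN2 : (N : ℝ) ^ 2 ≤ x / m := by
      have h2 : N ^ 2 ≤ X / m := Nat.sqrt_le' _
      calc (N : ℝ) ^ 2 ≤ ((X / m : ℕ) : ℝ) := by exact_mod_cast h2
        _ ≤ (X : ℝ) / m := Nat.cast_div_le
        _ ≤ x / m := by gcongr
    have hb : ∀ w ∈ Fintype.piFinset (fun _ : Fin l => normSet m), ∀ ε : Fin l → Bool,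
        ((goodPoints z N w ε).card : ℝ) ≤ C * (x / m) * t ^ A * E := by
      intro w hw ε
      refine (hgood t ((le_max_left _ _).trans ht) m N hm.1 hmx (exp_le_sqrt_of_lt ht240 hym) w ε
        fun i => mem_normSet.1 (Fintype.mem_piFinset.1 hw i)).trans ?_
      gcongr
    calc _ ≤ ∑ w ∈ Fintype.piFinset (fun _ : Fin l => normSet m), ∑ ε : Fin l → Bool,
          C * (x / m) * t ^ A * E :=
          Finset.sum_le_sum fun w hw => Finset.sum_le_sum fun ε _ => hb w hw ε
      _ = _ := by
        simp only [Finset.sum_const, Finset.card_univ, Fintype.card_pi, Fintype.card_bool,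
          Finset.prod_const, Fintype.card_fin, Fintype.card_piFinset, nsmul_eq_mul]
        rw [show (normSet m).card = normCount m from rfl]
        push_cast
        ring
  refine (Finset.sum_le_sum hterm).trans ?_
  rw [← Finset.mul_sum]
  have hlogx : Real.log x = Real.exp t := Real.log_exp _
  have h2 := hsum x j hx0 (by rw [hlogx]; linarith [Real.add_one_le_exp t])
  rw [hlogx, Real.log_exp] at h2
  have h3 : ∑ m ∈ (Finset.Icc 1 X).filter (fun m => omegaStar m = j ∧ y < (X / m : ℕ)),
      (normCount m : ℝ) ^ l / m ≤ C' * ((2 ^ (l - 1) * t + C') ^ j / (j.factorial : ℝ)) := by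
    refine le_trans (Finset.sum_le_sum_of_subset_of_nonneg ?_ fun m _ _ => by positivity) h2
    intro m hm
    rw [Finset.mem_filter] at hm ⊢
    exact ⟨hm.1, hm.2.1⟩
  have hD0 : 0 ≤ 2 ^ l * C * C' := by positivity
  have h4 : (2 ^ (l - 1) * t + C') ^ j / (j.factorial : ℝ) ≤
      (2 ^ (l - 1) * t + (2 ^ l * C * C' + C')) ^ j / (j.factorial : ℝ) := by
    refine div_le_div_of_nonneg_right (pow_le_pow_left₀ (by positivity) (by linarith) j)
      (Nat.cast_nonneg _)
  have hxt : 0 ≤ x * t ^ A * E := by positivity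
  calc _ ≤ 2 ^ l * C * (x * t ^ A * E) * (C' * ((2 ^ (l - 1) * t + C') ^ j / (j.factorial : ℝ))) :=
        mul_le_mul_of_nonneg_left h3 (by positivity)
    _ = (2 ^ l * C * C') * (x * t ^ A * E) *
        ((2 ^ (l - 1) * t + C') ^ j / (j.factorial : ℝ)) := by ring
    _ ≤ _ := by
      refine mul_le_mul ?_ h4 (by positivity) (by positivity)
      exact mul_le_mul_of_nonneg_right (by linarith) hxt

/-! ### Atypical integers -/

theorem card_primeFactors_le (n : ℕ) : n.primeFactors.card ≤ omegaStar n + 1 := by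
  have hsub : n.primeFactors ⊆ insert 2 (n.primeFactors.filter (fun p => Odd p)) := by
    intro p hp
    rcases (Nat.prime_of_mem_primeFactors hp).eq_two_or_odd' with h | h
    · exact Finset.mem_insert.2 (Or.inl h)
    · exact Finset.mem_insert_of_mem (Finset.mem_filter.2 ⟨hp, h⟩)
  exact (Finset.card_le_card hsub).trans (Finset.card_insert_le _ _)

/-- An integer all of whose prime factors beyond `y` are multiple, and which has no square divisor
beyond `y`, is small. -/
theorem le_pow_of_no_large_prime {n : ℕ} (hn : n ≠ 0) {y : ℝ} (hy : 1 ≤ y)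
    (h1 : ∀ q : ℕ, q.Prime → y < q → q ∣ n → q ^ 2 ∣ n) (h2 : ∀ d : ℕ, y < d → ¬ d ^ 2 ∣ n) :
    (n : ℝ) ≤ y ^ (3 * (omegaStar n + 1)) := by
  have hloc : ∀ p ∈ n.primeFactors, ((p ^ n.factorization p : ℕ) : ℝ) ≤ y ^ 3 := by
    intro p hp
    have hpp := Nat.prime_of_mem_primeFactors hp
    have hdv := Nat.dvd_of_mem_primeFactors hp
    set e := n.factorization p with he
    have hp1 : (1 : ℝ) ≤ p := by exact_mod_cast hpp.one_lt.le
    have hpd : p ^ e ∣ n := Nat.ordProj_dvd n p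
    have he1 : 1 ≤ e := hpp.factorization_pos_of_dvd hn hdv
    -- The square of p^⌊e/2⌋ divides n, and e ≤ 3⌊e/2⌋ for e ≥ 2, which gives the exponent 3.
    have hdle : ((p ^ (e / 2) : ℕ) : ℝ) ≤ y := by
      by_contra hlt
      refine h2 _ (not_le.1 hlt) ?_
      rw [← pow_mul]
      exact (pow_dvd_pow p (Nat.div_mul_le_self e 2)).trans hpd
    push_cast at hdle ⊢
    rcases Nat.lt_or_ge 1 e with h | h
    · calc (p : ℝ) ^ e ≤ (p : ℝ) ^ (e / 2 * 3) := pow_le_pow_right₀ hp1 (by omega)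
        _ = ((p : ℝ) ^ (e / 2)) ^ 3 := pow_mul _ _ _
        _ ≤ y ^ 3 := by gcongr
    · have e1 : e = 1 := by omega
      have hpy : (p : ℝ) ≤ y := by
        by_contra hlt
        have h3 := h1 p hpp (not_le.1 hlt) hdv
        rw [hpp.pow_dvd_iff_le_factorization hn] at h3
        omega
      rw [e1, pow_one]
      calc (p : ℝ) ≤ y := hpy
        _ = y ^ 1 := (pow_one y).symm
        _ ≤ y ^ 3 := pow_le_pow_right₀ hy (by norm_num)
  have hcard := card_primeFactors_le n
  calc (n : ℝ) = ∏ p ∈ n.primeFactors, ((p ^ n.factorization p : ℕ) : ℝ) := by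
        rw [← Nat.cast_prod]
        exact congrArg _ (Nat.prod_factorization_pow_eq_self hn).symm
    _ ≤ ∏ p ∈ n.primeFactors, y ^ 3 := Finset.prod_le_prod (fun p _ => Nat.cast_nonneg _) hloc
    _ = y ^ (3 * n.primeFactors.card) := by rw [Finset.prod_const, pow_mul]
    _ ≤ _ := pow_le_pow_right₀ hy (by omega)

open Classical in
/-- Few integers have a large square divisor. -/
theorem card_square_divisor_le (X Y : ℕ) :
    (((Finset.Icc 1 X).filter (fun n => ∃ d, Y < d ∧ d ^ 2 ∣ n)).card : ℝ) ≤ 2 * X / (Y + 1) := by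
  have hsub : (Finset.Icc 1 X).filter (fun n => ∃ d, Y < d ∧ d ^ 2 ∣ n) ⊆
      (Finset.Ioo Y (X + 1)).biUnion fun d => (Finset.Ioc 0 X).filter (fun n => d ^ 2 ∣ n) := by
    intro n hn
    obtain ⟨hn, d, hd, hdn⟩ := Finset.mem_filter.1 hn
    rw [Finset.mem_Icc] at hn
    refine Finset.mem_biUnion.2 ⟨d, Finset.mem_Ioo.2 ⟨hd, ?_⟩,
      Finset.mem_filter.2 ⟨Finset.mem_Ioc.2 ⟨by omega, hn.2⟩, hdn⟩⟩
    have h1 := Nat.le_of_dvd (by omega) hdn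
    have h2 := Nat.le_self_pow two_ne_zero d
    omega
  have h1 : (((Finset.Icc 1 X).filter (fun n => ∃ d, Y < d ∧ d ^ 2 ∣ n)).card : ℝ) ≤
      ∑ d ∈ Finset.Ioo Y (X + 1), (((Finset.Ioc 0 X).filter (fun n => d ^ 2 ∣ n)).card : ℝ) := by
    exact_mod_cast (Finset.card_le_card hsub).trans Finset.card_biUnion_le
  refine h1.trans ?_
  calc _ ≤ ∑ d ∈ Finset.Ioo Y (X + 1), (X : ℝ) * ((d : ℝ) ^ 2)⁻¹ := by
        refine Finset.sum_le_sum fun d _ => ?_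
        rw [Nat.Ioc_filter_dvd_card_eq_div, ← div_eq_mul_inv]
        exact_mod_cast (Nat.cast_div_le (α := ℝ) (m := X) (n := d ^ 2))
    _ = (X : ℝ) * ∑ d ∈ Finset.Ioo Y (X + 1), ((d : ℝ) ^ 2)⁻¹ := by rw [Finset.mul_sum]
    _ ≤ (X : ℝ) * (2 / (Y + 1)) := by gcongr; exact sum_Ioo_inv_sq_le Y (X + 1)
    _ = _ := by ring

open Classical in
/-- Few integers have a representation with small prime part. -/
theorem card_small_rep_le (X z : ℕ) :
    ((Finset.Icc 1 X).filter (fun n => ∃ f ∈ primeReps n, f.2 ≤ z)).card ≤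
      (Nat.sqrt X + 1) * (z + 1) := by
  have hsub : (Finset.Icc 1 X).filter (fun n => ∃ f ∈ primeReps n, f.2 ≤ z) ⊆
      (Finset.range (Nat.sqrt X + 1) ×ˢ Finset.range (z + 1)).image
        fun f => f.1 ^ 2 + f.2 ^ 2 := by
    intro n hn
    obtain ⟨hn, f, hf, hfz⟩ := Finset.mem_filter.1 hn
    rw [Finset.mem_Icc] at hn
    have h := (mem_primeReps.1 hf).2
    refine Finset.mem_image.2 ⟨f, Finset.mem_product.2 ⟨?_, Finset.mem_range.2 (by omega)⟩, h⟩
    rw [Finset.mem_range, Nat.lt_succ_iff, Nat.le_sqrt']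
    omega
  refine (Finset.card_le_card hsub).trans (Finset.card_image_le.trans (le_of_eq ?_))
  rw [Finset.card_product, Finset.card_range, Finset.card_range]

/-- In the divisor bound every factor is at most 1 + log n / log 2 ≤ e^(t+2), and the number of
factors is controlled by `omegaStar`. -/
theorem normCount_le_exp {n : ℕ} (hn : 1 ≤ n) {t : ℝ} (ht : 0 ≤ t)
    (hnt : (n : ℝ) ≤ Real.exp (Real.exp t)) :
    (normCount n : ℝ) ≤ Real.exp ((t + 2) * (omegaStar n + 2)) := by
  have hfac : ∀ p ∈ n.primeFactors, ((n.factorization p + 1 : ℕ) : ℝ) ≤ Real.exp (t + 2) := by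
    intro p hp
    have hpp := Nat.prime_of_mem_primeFactors hp
    have h1 : 2 ^ n.factorization p ≤ n :=
      (Nat.pow_le_pow_left hpp.two_le _).trans (Nat.ordProj_le p (by omega))
    have h2 : (2 : ℝ) ^ n.factorization p ≤ Real.exp (Real.exp t) :=
      le_trans (by exact_mod_cast h1) hnt
    rw [← Real.log_le_iff_le_exp (by positivity), Real.log_pow] at h2
    have h3 := Real.log_two_gt_d9
    have h4 : (n.factorization p : ℝ) ≤ 2 * Real.exp t := by
      have : (0 : ℝ) ≤ n.factorization p := Nat.cast_nonneg _
      nlinarith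
    have h5 : (3 : ℝ) ≤ Real.exp 2 := by have := Real.add_one_le_exp (2 : ℝ); linarith
    have h6 : 1 ≤ Real.exp t := Real.one_le_exp ht
    rw [Real.exp_add]
    push_cast
    nlinarith
  have h4 : (4 : ℝ) ≤ Real.exp (t + 2) := by
    have h5 : Real.exp 2 = Real.exp 1 * Real.exp 1 := by rw [← Real.exp_add]; norm_num
    have h6 := Real.exp_one_gt_d9
    have h7 : Real.exp 2 ≤ Real.exp (t + 2) := Real.exp_le_exp.2 (by linarith)
    nlinarith
  have h1 : (normCount n : ℝ) ≤ 4 * ∏ p ∈ n.primeFactors, ((n.factorization p + 1 : ℕ) : ℝ) := by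
    exact_mod_cast normCount_le (n := n) (by omega)
  have hE1 : 1 ≤ Real.exp (t + 2) := by linarith
  calc (normCount n : ℝ) ≤ _ := h1
    _ ≤ Real.exp (t + 2) * ∏ p ∈ n.primeFactors, Real.exp (t + 2) := by
        gcongr with p hp
        exact hfac p hp
    _ = Real.exp (t + 2) ^ (n.primeFactors.card + 1) := by rw [Finset.prod_const, pow_succ']
    _ ≤ Real.exp (t + 2) ^ (omegaStar n + 2) :=
        pow_le_pow_right₀ hE1 (by have := card_primeFactors_le n; omega)
    _ = _ := by rw [← Real.exp_nat_mul]; push_cast; congr 1; ring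

open Classical in
-- Failure of typicality forces a small prime part, a square divisor d² with d > y, or n ≤
-- y^(3(k+1)). The hypothesis on k makes the last quantity at most √x.
theorem card_not_typical_le {t : ℝ} {k : ℕ} (ht : 240 ≤ t) (hk : 6 * ((k : ℝ) + 1) ≤ t ^ 2) :
    (((Finset.Icc 1 ⌊Real.exp (Real.exp t)⌋₊).filter (fun n => omegaStar n = k ∧
      ¬ IsTypical (Real.exp (Real.exp t / t ^ 2)) (sieveLevel t) n)).card : ℝ) ≤
    7 * (Real.exp (Real.exp t) * Real.exp (-(Real.exp t / t ^ 4))) := by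
  have ht0 : 0 < t := by linarith
  set x := Real.exp (Real.exp t) with hx
  have hx0 : 0 < x := Real.exp_pos _
  set X := ⌊x⌋₊ with hX
  set z := sieveLevel t
  set y := Real.exp (Real.exp t / t ^ 2) with hy
  have hy1 : 1 ≤ y := Real.one_le_exp (by positivity)
  set W := Real.exp t / t ^ 4 with hW
  have hW0 : 0 < W := by positivity
  have hWt : 4 * W ≤ Real.exp t := by
    rw [hW, ← mul_div_assoc, div_le_iff₀ (by positivity), mul_comm]
    have : (4 : ℝ) ≤ t ^ 4 := by
      calc (4 : ℝ) ≤ 240 ^ 4 := by norm_num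
        _ ≤ t ^ 4 := by gcongr
    exact mul_le_mul_of_nonneg_left this (Real.exp_pos t).le
  have hWy : W ≤ Real.exp t / t ^ 2 :=
    div_le_div_of_nonneg_left (Real.exp_pos t).le (by positivity)
      (pow_le_pow_right₀ (by linarith) (by norm_num))
  set s := Real.exp (Real.exp t / 2) with hs
  have hs1 : 1 ≤ s := Real.one_le_exp (by positivity)
  have hss : s ^ 2 = x := by rw [hs, hx, ← Real.exp_nat_mul]; congr 1; push_cast; ring
  have hsub : (Finset.Icc 1 X).filter (fun n => omegaStar n = k ∧ ¬ IsTypical y z n) ⊆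
      (Finset.Icc 1 ⌊s⌋₊ ∪ (Finset.Icc 1 X).filter (fun n => ∃ d, ⌊y⌋₊ < d ∧ d ^ 2 ∣ n)) ∪
        (Finset.Icc 1 X).filter (fun n => ∃ f ∈ primeReps n, f.2 ≤ z) := by
    intro n hn
    obtain ⟨hn, ho, hnt⟩ := Finset.mem_filter.1 hn
    by_contra hcon
    simp only [Finset.mem_union, Finset.mem_filter, not_or, not_and, hn, true_implies] at hcon
    obtain ⟨⟨h1, h2⟩, h3⟩ := hcon
    push Not at h2 h3
    have hn1 := (Finset.mem_Icc.1 hn).1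
    refine hnt ⟨?_, fun f hf => h3 f hf⟩
    by_contra hq
    push Not at hq
    have hle := le_pow_of_no_large_prime (by omega) hy1 hq
      fun d hd => h2 d ((Nat.floor_lt (by linarith)).2 hd)
    refine h1 (Finset.mem_Icc.2 ⟨hn1, Nat.le_floor (hle.trans ?_)⟩)
    rw [ho, hy, ← Real.exp_nat_mul]
    refine Real.exp_le_exp.2 ?_
    rw [mul_div_assoc', div_le_div_iff₀ (by positivity) (by norm_num)]
    push_cast
    have := mul_le_mul_of_nonneg_left hk (Real.exp_pos t).le
    linarith
  have hc1 : ((Finset.Icc 1 ⌊s⌋₊).card : ℝ) ≤ s := by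
    rw [Nat.card_Icc, Nat.add_sub_cancel]; exact Nat.floor_le (by linarith)
  have hXx : (X : ℝ) ≤ x := Nat.floor_le hx0.le
  have hc2 := card_square_divisor_le X ⌊y⌋₊
  have hc2' : 2 * (X : ℝ) / (⌊y⌋₊ + 1) ≤ 2 * x / y := by
    have := Nat.lt_floor_add_one y
    gcongr
  have hsq : (Nat.sqrt X : ℝ) ≤ s := by
    refine (pow_le_pow_iff_left₀ (by positivity) (by positivity) two_ne_zero).1 ?_
    rw [hss]
    refine le_trans ?_ hXx
    exact_mod_cast Nat.sqrt_le' X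
  have hz : (z : ℝ) ≤ Real.exp W := Nat.floor_le (Real.exp_pos _).le
  have hW1 : 1 ≤ Real.exp W := Real.one_le_exp hW0.le
  have hc3 : (((Finset.Icc 1 X).filter (fun n => ∃ f ∈ primeReps n, f.2 ≤ z)).card : ℝ) ≤
      (2 * s) * (2 * Real.exp W) := by
    have h : (((Finset.Icc 1 X).filter (fun n => ∃ f ∈ primeReps n, f.2 ≤ z)).card : ℝ) ≤
        (Nat.sqrt X + 1) * (z + 1) := by exact_mod_cast card_small_rep_le X z
    refine h.trans ?_
    gcongr <;> linarith
  have hcard : (((Finset.Icc 1 X).filter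
      (fun n => omegaStar n = k ∧ ¬ IsTypical y z n)).card : ℝ) ≤
      s + 2 * x / y + (2 * s) * (2 * Real.exp W) := by
    have h := (Finset.card_le_card hsub).trans ((Finset.card_union_le _ _).trans
      (add_le_add_left (Finset.card_union_le _ _) _))
    have h' := (Nat.cast_le (α := ℝ)).2 h
    push_cast at h'
    linarith
  have e1 : s ≤ x * Real.exp (-W) := by
    rw [hs, hx, ← Real.exp_add]; exact Real.exp_le_exp.2 (by linarith)
  have e2 : x / y ≤ x * Real.exp (-W) := by
    rw [div_eq_mul_inv, hy, ← Real.exp_neg]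
    exact mul_le_mul_of_nonneg_left (Real.exp_le_exp.2 (by linarith)) hx0.le
  have e3 : s * Real.exp W ≤ x * Real.exp (-W) := by
    rw [hs, hx, ← Real.exp_add, ← Real.exp_add]; exact Real.exp_le_exp.2 (by linarith)
  refine hcard.trans ?_
  rw [mul_div_assoc]
  linarith

open Classical in
theorem sum_not_typical_le {t : ℝ} {k l : ℕ} (ht : 240 ≤ t) (hk : 6 * ((k : ℝ) + 1) ≤ t ^ 2) :
    ((∑ n ∈ (Finset.Icc 1 ⌊Real.exp (Real.exp t)⌋₊).filter (fun n => omegaStar n = k ∧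
      ¬ IsTypical (Real.exp (Real.exp t / t ^ 2)) (sieveLevel t) n), (r1 n).choose l : ℕ) : ℝ) ≤
    Real.exp (Real.exp t) * Real.exp (2 - Real.exp t / t ^ 4 + l * ((t + 2) * (k + 2))) := by
  have h1 := card_not_typical_le ht hk
  push_cast
  set F := (Finset.Icc 1 ⌊Real.exp (Real.exp t)⌋₊).filter (fun n => omegaStar n = k ∧
      ¬ IsTypical (Real.exp (Real.exp t / t ^ 2)) (sieveLevel t) n)
  have h2 : ∀ n ∈ F, ((r1 n).choose l : ℝ) ≤ Real.exp (l * ((t + 2) * (k + 2))) := by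
    intro n hn
    obtain ⟨hn, ho, -⟩ := Finset.mem_filter.1 hn
    rw [Finset.mem_Icc] at hn
    have h3 := normCount_le_exp hn.1 (by linarith : 0 ≤ t)
      ((Nat.cast_le.2 hn.2).trans (Nat.floor_le (Real.exp_pos _).le))
    rw [ho] at h3
    have h4 : ((r1 n).choose l : ℝ) ≤ (normCount n : ℝ) ^ l := by
      exact_mod_cast (Nat.choose_le_pow (r1 n) l).trans
        (Nat.pow_le_pow_left (r1_le_normCount n) l)
    calc _ ≤ _ := h4
      _ ≤ Real.exp ((t + 2) * (k + 2)) ^ l := by gcongr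
      _ = _ := by rw [← Real.exp_nat_mul]
  have h7 : (7 : ℝ) ≤ Real.exp 2 := by
    have h5 : Real.exp 2 = Real.exp 1 * Real.exp 1 := by rw [← Real.exp_add]; norm_num
    have h6 := Real.exp_one_gt_d9
    nlinarith
  calc _ ≤ ∑ n ∈ F, Real.exp (l * ((t + 2) * (k + 2))) := Finset.sum_le_sum h2
    _ = F.card * Real.exp (l * ((t + 2) * (k + 2))) := by rw [Finset.sum_const, nsmul_eq_mul]
    _ ≤ 7 * (Real.exp (Real.exp t) * Real.exp (-(Real.exp t / t ^ 4))) *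
        Real.exp (l * ((t + 2) * (k + 2))) := by gcongr
    _ ≤ Real.exp 2 * (Real.exp (Real.exp t) * Real.exp (-(Real.exp t / t ^ 4))) *
        Real.exp (l * ((t + 2) * (k + 2))) := by gcongr
    _ = _ := by
      rw [sub_eq_add_neg, Real.exp_add, Real.exp_add]; ring

/-! ### Comparison with the main term and conclusion -/

/-- Since k! ≤ k^k ≤ (Ka)^k and K^k ≤ e^(Kk), the main term is never smaller than a fixed power of
1/log x, so it absorbs the atypical integers. -/
theorem exp_neg_le_pow_div_factorial {K t a : ℝ} {k : ℕ} (hK : 1 ≤ K) (hk : (k : ℝ) ≤ K * t)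
    (ha : t ≤ a) : Real.exp (-(K ^ 2 * t)) ≤ a ^ k / (k.factorial : ℝ) := by
  have h1 : (k.factorial : ℝ) ≤ (k : ℝ) ^ k := by exact_mod_cast Nat.factorial_le_pow k
  have h2 : (k : ℝ) ^ k ≤ (K * a) ^ k :=
    pow_le_pow_left₀ (Nat.cast_nonneg k) (hk.trans (by gcongr)) k
  have h3 : K ^ k ≤ Real.exp (K ^ 2 * t) := by
    calc K ^ k ≤ Real.exp K ^ k := by
          gcongr; linarith [Real.add_one_le_exp K]
      _ = Real.exp (k * K) := by rw [Real.exp_nat_mul]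
      _ ≤ _ := Real.exp_le_exp.2 (by nlinarith)
  have ha0 : 0 ≤ a := by
    have : (0 : ℝ) ≤ k := Nat.cast_nonneg k
    by_contra h
    nlinarith
  rw [Real.exp_neg, le_div_iff₀ (by positivity), inv_mul_le_iff₀ (Real.exp_pos _)]
  calc (k.factorial : ℝ) ≤ K ^ k * a ^ k := by rw [← mul_pow]; exact h1.trans h2
    _ ≤ _ := by gcongr

/-- One factor t absorbs (1 + C/a)^j ≤ e^(CK), the other absorbs (j + 1)/a ≤ K. The dependence on K
thus enters only through how large t must be. -/
theorem add_pow_div_factorial_le {K t a C : ℝ} {j : ℕ} (ht : 0 < t) (hC : 0 ≤ C)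
    (hj : ((j + 1 : ℕ) : ℝ) ≤ K * t) (ha : t ≤ a) (hKt : K ≤ t) (hCt : Real.exp (C * K) ≤ t) :
    (a + C) ^ j / (j.factorial : ℝ) ≤ t ^ 2 * (a ^ (j + 1) / ((j + 1).factorial : ℝ)) := by
  have ha0 : 0 < a := by linarith
  have hK0 : 0 ≤ K := by
    have : (0 : ℝ) ≤ ((j + 1 : ℕ) : ℝ) := Nat.cast_nonneg _
    by_contra h
    nlinarith
  have hja : ((j + 1 : ℕ) : ℝ) ≤ K * a := hj.trans (by gcongr)
  push_cast at hja
  have h1 : (a + C) ^ j ≤ t * a ^ j := by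
    have h2 : a + C ≤ a * Real.exp (C / a) := by
      have := mul_le_mul_of_nonneg_left (Real.add_one_le_exp (C / a)) ha0.le
      refine le_trans (le_of_eq ?_) this
      field_simp
      ring
    calc (a + C) ^ j ≤ (a * Real.exp (C / a)) ^ j := by gcongr
      _ = Real.exp (j * (C / a)) * a ^ j := by rw [mul_pow, ← Real.exp_nat_mul, mul_comm]
      _ ≤ t * a ^ j := by
        gcongr
        refine le_trans (Real.exp_le_exp.2 ?_) hCt
        rw [mul_div_assoc', div_le_iff₀ ha0]
        nlinarith
  have h3 : a ^ j * ((j : ℝ) + 1) ≤ t * a ^ (j + 1) := by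
    rw [pow_succ]
    calc a ^ j * ((j : ℝ) + 1) ≤ a ^ j * (t * a) := by
          gcongr
          exact hja.trans (by gcongr)
      _ = _ := by ring
  rw [Nat.factorial_succ]
  push_cast
  have hf : (0 : ℝ) < j.factorial := by positivity
  rw [mul_div_assoc', div_le_div_iff₀ hf (by positivity)]
  calc (a + C) ^ j * (((j : ℝ) + 1) * j.factorial)
      ≤ t * a ^ j * (((j : ℝ) + 1) * j.factorial) := by gcongr
    _ = t * (a ^ j * ((j : ℝ) + 1)) * j.factorial := by ring
    _ ≤ t * (t * a ^ (j + 1)) * j.factorial := by gcongr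
    _ = _ := by ring

/-- All the other terms are O(t²) for fixed K and l, while e^t/t⁴ ≥ t³/5040 by the seventh term of
the exponential series. -/
theorem atypical_exponent_le {K t : ℝ} {k l : ℕ} (hK : 1 ≤ K) (hk : (k : ℝ) ≤ K * t) (ht2 : 2 ≤ t)
    (ht : 5040 * (2 + 9 * l * K + (l + 1) + K ^ 2) ≤ t) :
    2 - Real.exp t / t ^ 4 + l * ((t + 2) * (k + 2)) ≤ -((l + 1) * t) + -(K ^ 2 * t) := by
  have ht0 : 0 < t := by linarith
  have hl0 : (0 : ℝ) ≤ l := Nat.cast_nonneg l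
  have hW : t ^ 3 / 5040 ≤ Real.exp t / t ^ 4 := by
    have h := pow_le_exp_mul ht0.le 7
    have e : ((7 : ℕ).factorial : ℝ) = 5040 := by norm_num [Nat.factorial]
    rw [e] at h
    rw [div_le_div_iff₀ (by norm_num) (by positivity)]
    calc t ^ 3 * t ^ 4 = t ^ 7 := by ring
      _ ≤ 5040 * Real.exp t := h
      _ = _ := by ring
  set Q := 2 + 9 * l * K + (l + 1) + K ^ 2 with hQ
  have h1 : Q * t ^ 2 ≤ t ^ 3 / 5040 := by
    rw [le_div_iff₀ (by norm_num)]
    calc Q * t ^ 2 * 5040 = (5040 * Q) * t ^ 2 := by ring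
      _ ≤ t * t ^ 2 := by gcongr
      _ = _ := by ring
  have h2 : (t + 2) * ((k : ℝ) + 2) ≤ 9 * K * t ^ 2 := by
    have hKt : t ≤ K * t := le_mul_of_one_le_left ht0.le hK
    calc (t + 2) * ((k : ℝ) + 2) ≤ (3 * t) * (3 * (K * t)) := by gcongr <;> linarith
      _ = _ := by ring
  have h3 : l * ((t + 2) * ((k : ℝ) + 2)) ≤ l * (9 * K * t ^ 2) := by gcongr
  have h4 : t ≤ t ^ 2 := by nlinarith
  have h5 : (l + 1) * t ≤ (l + 1) * t ^ 2 := by gcongr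
  have h6 : K ^ 2 * t ≤ K ^ 2 * t ^ 2 := by gcongr
  have h7 : (2 : ℝ) ≤ 2 * t ^ 2 := by nlinarith
  have h8 : Q * t ^ 2 = 2 * t ^ 2 + l * (9 * K * t ^ 2) + (l + 1) * t ^ 2 + K ^ 2 * t ^ 2 := by
    rw [hQ]; ring
  linarith

theorem mainTheorem3 (l : ℕ) (hl : 1 ≤ l) :
    ∃ (A : ℕ) (C : ℝ), 0 < C ∧ ∀ K : ℝ, 0 < K → ∃ x₀ : ℝ, ∀ x : ℝ, x₀ < x →
      ∀ k : ℕ, (k : ℝ) ≤ K * Real.log (Real.log x) →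
        ((∑ n ∈ (Finset.Icc 1 ⌊x⌋₊).filter (fun n => omegaStar n = k),
            (r1 n).choose l : ℕ) : ℝ) ≤
          C * (x * Real.log (Real.log x) ^ A / Real.log x ^ (l + 1) *
            ((2 ^ (l - 1) * Real.log (Real.log x)) ^ k / (k.factorial : ℝ))) := by
  classical
  obtain ⟨A, C, t₀, hC, htyp⟩ := exists_sum_typical_le l hl
  -- The extra 2 pays for passing from (a + C)^j/j! to a^(j+1)/(j+1)!, the extra 1 for the atypical
  -- integers. Both are fixed before K.
  refine ⟨A + 2, C + 1, by linarith, fun K₀ hK₀ => ?_⟩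
  set K := max K₀ 1 with hK
  have hK1 : 1 ≤ K := le_max_right _ _
  set T := max t₀ (max (240 + 12 * K + 5040 * (2 + 9 * l * K + (l + 1) + K ^ 2))
    (Real.exp (C * K))) with hT
  refine ⟨Real.exp (Real.exp T), fun x hx k hk => ?_⟩
  have hl0 : (0 : ℝ) ≤ l := Nat.cast_nonneg l
  have hT0 : T ≤ Real.log (Real.log x) := by
    have h1 : Real.exp T ≤ Real.log x := by
      rw [Real.le_log_iff_exp_le ((Real.exp_pos _).trans hx)]; exact hx.le
    rwa [Real.le_log_iff_exp_le ((Real.exp_pos _).trans_le h1)]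
  have hlog0 : 0 < Real.log x := by
    refine Real.log_pos ?_
    linarith [Real.add_one_le_exp (Real.exp T), Real.exp_pos T]
  obtain ⟨t, ht⟩ : ∃ t, t = Real.log (Real.log x) := ⟨_, rfl⟩
  have hlogx : Real.log x = Real.exp t := by rw [ht, Real.exp_log hlog0]
  have hxt : x = Real.exp (Real.exp t) := by
    rw [← hlogx, Real.exp_log ((Real.exp_pos _).trans hx)]
  rw [← ht] at hT0 hk ⊢
  have ht₀ : t₀ ≤ t := (le_max_left _ _).trans hT0
  have hTbig : 240 + 12 * K + 5040 * (2 + 9 * l * K + (l + 1) + K ^ 2) ≤ t :=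
    ((le_max_left _ _).trans (le_max_right _ _)).trans hT0
  have hTexp : Real.exp (C * K) ≤ t := ((le_max_right _ _).trans (le_max_right _ _)).trans hT0
  have hQ0 : 0 ≤ 9 * (l : ℝ) * K := by positivity
  have ht240 : 240 ≤ t := by nlinarith [sq_nonneg K]
  have htK : 12 * K ≤ t := by nlinarith [sq_nonneg K]
  have ht0 : 0 < t := by linarith
  have hkK : (k : ℝ) ≤ K * t := hk.trans (by gcongr; exact le_max_left _ _)
  have hk6 : 6 * ((k : ℝ) + 1) ≤ t ^ 2 := by nlinarith
  set a : ℝ := 2 ^ (l - 1) * t with ha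
  have hta : t ≤ a := le_mul_of_one_le_left ht0.le (one_le_pow₀ (by norm_num))
  set E := Real.exp (-((l + 1) * t)) with hE
  have hE0 : 0 < E := Real.exp_pos _
  have hx0 : 0 < x := hxt ▸ Real.exp_pos _
  set V := a ^ k / (k.factorial : ℝ) with hV
  have hform : x * t ^ (A + 2) / Real.log x ^ (l + 1) * V = x * t ^ (A + 2) * E * V := by
    rw [hlogx, ← Real.exp_nat_mul, div_eq_mul_inv, ← Real.exp_neg, hE]
    push_cast
    rfl
  rw [hform]
  set y := Real.exp (Real.exp t / t ^ 2)
  set z := sieveLevel t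
  have hsplit : ∑ n ∈ (Finset.Icc 1 ⌊x⌋₊).filter (fun n => omegaStar n = k), (r1 n).choose l =
      ∑ n ∈ (Finset.Icc 1 ⌊x⌋₊).filter (fun n => omegaStar n = k ∧ IsTypical y z n),
        (r1 n).choose l +
      ∑ n ∈ (Finset.Icc 1 ⌊x⌋₊).filter (fun n => omegaStar n = k ∧ ¬ IsTypical y z n),
        (r1 n).choose l := by
    rw [← Finset.sum_filter_add_sum_filter_not _ (IsTypical y z), Finset.filter_filter,
      Finset.filter_filter]
  rw [hsplit, Nat.cast_add]
  have htA : 1 ≤ t ^ (A + 2) := one_le_pow₀ (by linarith)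
  have hV1 : Real.exp (-(K ^ 2 * t)) ≤ V := exp_neg_le_pow_div_factorial hK1 hkK hta
  have hV0 : 0 ≤ V := (Real.exp_pos _).le.trans hV1
  have hbad : ((∑ n ∈ (Finset.Icc 1 ⌊x⌋₊).filter
      (fun n => omegaStar n = k ∧ ¬ IsTypical y z n), (r1 n).choose l : ℕ) : ℝ) ≤
      x * t ^ (A + 2) * E * V := by
    have h1 := sum_not_typical_le (l := l) ht240 hk6
    rw [← hxt] at h1
    refine h1.trans ?_
    have h2 := atypical_exponent_le (l := l) hK1 hkK (by linarith) (by linarith)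
    calc _ ≤ x * Real.exp (-((l + 1) * t) + -(K ^ 2 * t)) := by gcongr
      _ = x * 1 * E * Real.exp (-(K ^ 2 * t)) := by rw [Real.exp_add, hE]; ring
      _ ≤ x * t ^ (A + 2) * E * V := by gcongr
  have hgood : ((∑ n ∈ (Finset.Icc 1 ⌊x⌋₊).filter
      (fun n => omegaStar n = k ∧ IsTypical y z n), (r1 n).choose l : ℕ) : ℝ) ≤
      C * (x * t ^ (A + 2) * E * V) := by
    cases k with
    -- For k = 0 there is no typical n, because its large prime factor is odd.
    | zero =>
      have hempty : (Finset.Icc 1 ⌊x⌋₊).filter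
          (fun n => omegaStar n = 0 ∧ IsTypical y z n) = ∅ := by
        rw [Finset.filter_eq_empty_iff]
        rintro n hn ⟨ho, ⟨q, hq, hyq, hqn, -⟩, -⟩
        have hn1 := (Finset.mem_Icc.1 hn).1
        have hq2 : (2 : ℝ) < q := by
          refine lt_of_le_of_lt ?_ hyq
          have h4 : (4 : ℝ) ≤ z := by exact_mod_cast (sieveLevel_bounds ht240).1
          linarith [sieveLevel_le_exp (by linarith : 1 ≤ t)]
        have hq2' : 2 < q := by exact_mod_cast hq2
        rw [omegaStar, Finset.card_eq_zero, Finset.filter_eq_empty_iff] at ho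
        exact ho (Nat.mem_primeFactors.2 ⟨hq, hqn, by omega⟩) (hq.odd_of_ne_two (by omega))
      rw [hempty]
      simp only [Finset.sum_empty, Nat.cast_zero]
      positivity
    | succ j =>
      have h1 := htyp t ht₀ j
      rw [← hxt] at h1
      refine h1.trans ?_
      have h2 := add_pow_div_factorial_le ht0 hC hkK hta (by linarith) hTexp
      calc _ ≤ C * (x * t ^ A * E) * (t ^ 2 * V) := by gcongr
        _ = _ := by ring
  linarith
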